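/- Let $\mathbf X=(X_t)_{t\in\mathbb R}$ be a stationary Markov process with polynomial regression (SMPR process), that is: a real process on a probability space such that * the law $\mu$ of $X_t$ does not depend on $t$, and $\mathbf X$ is Markov with transition laws of $X_t$ given $X_s$ ($s<t$) depending only on $t-s$; * all moments of $\mu$ are finite, and $\mu$ is the only probability measure with these moments ("$\mu$ is identifiable by moments"); * if $v\le\infty$ is the number of points of $\operatorname{supp}\mu$, then for every finite $n$ with $0<n<v$ and all distinct times $s_1,\dots,s_n$ the matrix $[\operatorname{cov}(X_{s_i},X_{s_j})]$ is non-singular; * for all $m,j\ge 0$ and all $s$, $t\mapsto E X_t^mX_s^j$ is continuous at $t=s$; * for all $n\ge 0$ and $s<t$, with $\mathcal F_{\le s}=\sigma(X_r:r\le s)$, $E(X_t^n\mid\mathcal F_{\le s})=\sum_{j=0}^n\gamma_{n,j}(t-s)X_s^j$ a.s. (In particular $\mathbf X$ may be regular, i.e. an RSMPR process.) Assume that $\mathbf X$ has the independent regression property: for all $s<t$ and $j\ge1$, $E\big((X_t-E(X_t\mid\mathcal F_{\le s}))^j\mid\mathcal F_{\le s}\big)$ is a.s. constant. Assume $EX_t=0$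 and that time is scaled so that $E(X_1\mid\mathcal F_{\le 0})=e^{-1}X_0$. Then there are real constants $d_0=1,d_1,d_2,\dots$ such that for every finite $n<v$ and $\tau>0$ the lower triangular matrix $\mathbf A_n(\tau)=[\gamma_{i,j}(\tau)]_{0\le j\le i\le n}$ equals $\exp(-\tau\mathbf W_n)$, where $\mathbf W_n$ is lower triangular with entries $i\,d_0$ on the diagonal and $\binom ij d_{i-j}$ for $i>j$, and such that, with $\delta_j=-d_j/j$, the following holds. i) The stationary law $\mu$ is infinitely divisible. Its moment generating function is $$\varphi(y)=\exp\Big(\sum_{j\ge2}\delta_j\frac{y^j}{j!}\Big),$$ as an identity of formal power series with $\varphi(y)=\sum_n EX_0^n\,y^n/n!$, and also, for every real $y$ with $Ee^{yX_0}<\infty$ and $Ee^{-yX_0}<\infty$, as an identity with $\varphi(y)=Ee^{yX_0}$, the series being convergent. If $\delta_2>0$, there is a probability measure $\chi$ on $\mathbb R$, identifiable by moments, with $\int x^{j-2}\chi(dx)=\delta_j/\delta_2$ for all $j\ge2$, such that for all real $u$ $$Ee^{iuX_0}=\exp\Big(\delta_2\int\frac{e^{iux}-1-iux}{x^2}\chi(dx)\Big),$$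 and, for every real $y$ with $Ee^{yX_0}<\infty$, the function $x\mapsto (e^{yx}-1-xy)/x^2$ is $\chi$-integrable and $$Ee^{yX_0}=\exp\Big(\delta_2\int\frac{e^{yx}-1-xy}{x^2}\chi(dx)\Big)$$ (the integrands being extended by continuity to $x=0$). ii) For $s<t$ the moment generating function of $X_t-e^{-(t-s)}X_s$ equals $$\exp\Big(\sum_{j\ge2}\delta_j\big(1-e^{-j(t-s)}\big)\frac{y^j}{j!}\Big),$$ as formal power series, and also, for every real $y$ with $Ee^{yX_0}<\infty$ and $Ee^{-yX_0}<\infty$, as an identity of (finite) expectations with a convergent series. -/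

import Mathlib

open MeasureTheory ProbabilityTheory

/-- The σ-algebra `𝓕_{≤ s} = σ(X_r : r ≤ s)` of the past of a process indexed by `ℝ`. -/
@[reducible]
def pastSigma {Ω : Type*} (X : ℝ → Ω → ℝ) (s : ℝ) : MeasurableSpace Ω :=
  ⨆ r : Set.Iic s, MeasurableSpace.comap (X r) inferInstance

/-- A law on `ℝ` identifiable by its moments: all moments are finite, and no other probability
measure has the same moments. -/
def IsMomentDeterminate (μ : Measure ℝ) : Prop :=
  (∀ n : ℕ, Integrable (fun x : ℝ => x ^ n) μ) ∧
  ∀ ν : Measure ℝ, IsProbabilityMeasure ν →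
    (∀ n : ℕ, Integrable (fun x : ℝ => x ^ n) ν) →
    (∀ n : ℕ, ∫ x, x ^ n ∂ν = ∫ x, x ^ n ∂μ) → ν = μ

/-- Infinite divisibility: for every `n ≥ 1`, `μ` is the law of a sum of `n` independent
identically distributed real random variables. -/
def IsInfDivisible (μ : Measure ℝ) : Prop :=
  ∀ n : ℕ, 1 ≤ n → ∃ ν : Measure ℝ, IsProbabilityMeasure ν ∧
    (Measure.pi (fun _ : Fin n => ν)).map (fun x : Fin n → ℝ => ∑ i, x i) = μ

/-- Number of points (possibly `⊤`) of the support of the marginal law of `X`. -/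
noncomputable def supportCard {Ω : Type*} [MeasurableSpace Ω] (P : Measure Ω)
    (X : ℝ → Ω → ℝ) : ℕ∞ :=
  (P.map (X 0)).support.encard

/-- A stationary Markov process with polynomial regression, with time set `ℝ`. The function
`γ n j` gives the coefficient of `x ^ j` in the polynomial
`Q_n(x, t - s) = ∑_{j ≤ n} γ_{n,j}(t - s) x ^ j` with `E(X_t ^ n | 𝓕_{≤ s}) = Q_n(X_s, t - s)`. -/
structure IsSMPR {Ω : Type*} [MeasurableSpace Ω] (P : Measure Ω) (X : ℝ → Ω → ℝ)
    (γ : ℕ → ℕ → ℝ → ℝ) : Prop where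
  measurable : ∀ t, Measurable (X t)
  /-- the one-dimensional marginal law does not depend on time -/
  stationary : ∀ t, P.map (X t) = P.map (X 0)
  /-- Markov property; the conditional law of `X t` given the past up to `s` depends only on
  `X s` and on `t - s` -/
  markov : ∃ η : ℝ → Kernel ℝ ℝ, (∀ τ, IsMarkovKernel (η τ)) ∧
    ∀ s t : ℝ, s < t → ∀ B : Set ℝ, MeasurableSet B →
      P[(X t ⁻¹' B).indicator (fun _ => (1 : ℝ)) | pastSigma X s]
        =ᵐ[P] fun ω => (η (t - s) (X s ω)).real B
  /-- the marginal law is identifiable by its moments -/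
  determinate : IsMomentDeterminate (P.map (X 0))
  /-- the process is totally linearly dependent: non-singular covariance matrices of the variables `X_{s_1}, …, X_{s_n}` -/
  tld : ∀ n : ℕ, 0 < n → (n : ℕ∞) < supportCard P X → ∀ s : Fin n → ℝ, Function.Injective s →
    (Matrix.of fun i j : Fin n => cov[X (s i), X (s j); P]).det ≠ 0
  /-- mean-square continuity -/
  msc : ∀ (m j : ℕ) (s : ℝ), ContinuousAt (fun t => ∫ ω, X t ω ^ m * X s ω ^ j ∂P) s
  /-- polynomial regression -/
  regression : ∀ (n : ℕ) (s t : ℝ), s < t →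
    P[fun ω => X t ω ^ n | pastSigma X s]
      =ᵐ[P] fun ω => ∑ j ∈ Finset.range (n + 1), γ n j (t - s) * X s ω ^ j

/-- Independent regression property: the conditional central moments
`E((X_t - E(X_t | 𝓕_{≤ s})) ^ j | 𝓕_{≤ s})` are non-random. -/
def HasIndependentRegression {Ω : Type*} [MeasurableSpace Ω] (P : Measure Ω)
    (X : ℝ → Ω → ℝ) : Prop :=
  ∀ s t : ℝ, s < t → ∀ j : ℕ, 1 ≤ j → ∃ c : ℝ,
    P[fun ω => (X t ω - (P[X t | pastSigma X s]) ω) ^ j | pastSigma X s] =ᵐ[P] fun _ => c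

/-- The `(n + 1) × (n + 1)` lower triangular structural matrix `A_n(τ) = (γ_{i,j}(τ))`. -/
def structuralMatrix (γ : ℕ → ℕ → ℝ → ℝ) (n : ℕ) (τ : ℝ) :
    Matrix (Fin (n + 1)) (Fin (n + 1)) ℝ :=
  Matrix.of fun i j => if (j : ℕ) ≤ i then γ i j τ else 0

/-- The lower triangular matrix `W_n` with diagonal entries `i d_0` and entries
`(i choose j) d_{i - j}` below the diagonal. -/
def generatorMatrix (d : ℕ → ℝ) (n : ℕ) : Matrix (Fin (n + 1)) (Fin (n + 1)) ℝ :=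
  Matrix.of fun i j =>
    if i < j then 0
    else if i = j then (i : ℕ) * d 0
    else ((i : ℕ).choose j : ℝ) * d ((i : ℕ) - j)

/-- The constants `δ_j = - d_j / j`. -/
noncomputable def deltaCoeff (d : ℕ → ℝ) (j : ℕ) : ℝ := -d j / j

/-- The formal power series `∑_n m_n y ^ n / n!` of the moments `m_n` of a random variable. -/
noncomputable def momentSeries {Ω : Type*} [MeasurableSpace Ω] (P : Measure Ω) (Y : Ω → ℝ) :
    PowerSeries ℝ :=
  PowerSeries.mk fun n => (∫ ω, Y ω ^ n ∂P) / (n.factorial : ℝ)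

/-- The formal power series `∑_{j ≥ 2} κ_j y ^ j / j!`. -/
noncomputable def exponentSeries (κ : ℕ → ℝ) : PowerSeries ℝ :=
  PowerSeries.mk fun j => if 2 ≤ j then κ j / (j.factorial : ℝ) else 0

/-- The function `x ↦ (exp (y x) - 1 - x y) / x ^ 2`, extended by continuity to `x = 0`. -/
noncomputable def kolmogorovKernel (y x : ℝ) : ℝ :=
  if x = 0 then y ^ 2 / 2 else (Real.exp (y * x) - 1 - x * y) / x ^ 2

/-- The same function for a complex parameter `z`. -/
noncomputable def kolmogorovKernelC (z : ℂ) (x : ℝ) : ℂ :=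
  if x = 0 then z ^ 2 / 2 else (Complex.exp (z * x) - 1 - x * z) / (x : ℂ) ^ 2

/-!
The proof passes from the process to its one-dimensional law `μ`, and then works with `μ` alone.

Independent regression makes the moments of the increment `ε = X_t - e ^ (-(t - s)) X_s` factor
from those of `X_s`, so `μ` and the convolution of the dilation of `μ` by `e ^ (-(t - s))` with
the law of `ε` have the same moments. Since `μ` is identifiable by moments, the two laws are equal
(`IsSMPR.conv_increment`). Hence `μ` is self-decomposable with cofactors that have all moments. If
`exp ∘ K` is the moment series of `μ`, that of the cofactor for the ratio `a` is `exp ∘ (K(y) -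
K(a y))`, which is the formal part of the claim on the increments, and `δ_j = j! [y ^ j] K`.

The `n`-th convolution roots of `μ` arise from the cofactors: if `ν_a` is the cofactor of the
dilation by `a`, the convolution of the dilations of `ν_a` by `a ^ (n k)` has the moment series
`exp ∘ ∑_k (K(a ^ (n k) y) - K(a ^ (n k + 1) y))`, which tends coefficientwise to `exp ∘ (K / n)`
as `a → 1`. A weak limit point is a law with this moment series, and its `n`-th convolution power
has the moments of `μ` (`exists_conv_root`).

If `ρ_n` is the `n`-th root, the measures `(n / δ_2) x ^ 2 ρ_n(dx)` have moments tending to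
`δ_{j+2} / δ_2`; a weak limit point is `χ`. Conversely, any law `χ` with these moments gives, as a
limit of sums of small independent jumps, a law with the moments of `μ` and with the
characteristic function of Kolmogorov form (`exists_law_of_kolmogorov`), so this law is `μ`. As
the Kolmogorov measure is determined by the characteristic function, `χ` is identifiable by
moments. The moment generating function in Kolmogorov form follows from `∫ e ^ (y x) ρ_n(dx) = (E
e ^ (y X_0)) ^ (1 / n)`: this bounds the integrals of the kernel, and the quantities for a
parameter slightly smaller than `y` are uniformly integrable; dominated convergence then reaches
`y` itself. When both `y` and `-y` are admissible, the kernel may be expanded under the integral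
(`hasSum_cumulants`). For the increments, the moment generating function of `X_t` is that of `e ^
(-(t - s)) X_s` times that of `ε`.

For the structural matrices, expanding `(e ^ (-τ) X_s + ε) ^ i` shows that the regression
polynomial of degree `i` is `∑_j (i choose j) e ^ (-jτ) E ε ^ (i - j) x ^ j`; here the
coefficients are unique because `μ` has more than `i` points of support. Both this matrix and `exp
(-τ W_n)` are conjugate to the diagonal matrix `(e ^ (-iτ))` by the matrix with entries `(i choose
j) E X_0 ^ (i - j)`, since `M = exp ∘ K` solves `y M' = y K' M` (`exp_neg_smul_generatorMatrix`).
-/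

/-! ### Exponentials of formal power series -/

/-- The composition `exp ∘ K` of the exponential series with a formal power series. -/
noncomputable abbrev expOf (K : PowerSeries ℝ) : PowerSeries ℝ := (PowerSeries.exp ℝ).subst K

open PowerSeries in
theorem constantCoeff_expOf {K : PowerSeries ℝ} (hK : constantCoeff K = 0) :
    constantCoeff (expOf K) = 1 := by
  have h1 : PowerSeries.exp ℝ = 1 + (PowerSeries.exp ℝ - 1) := by ring
  have hs := HasSubst.of_constantCoeff_zero' hK
  rw [expOf, h1, subst_add hs, map_add]
  have h2 := constantCoeff_subst_eq_zero (S := ℝ) (a := K) hK (PowerSeries.exp ℝ - 1) (by simp)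
  have h3 : (1 : PowerSeries ℝ).subst K = (1 : PowerSeries ℝ) := by
    rw [← coe_substAlgHom hs, map_one]
  rw [h3]
  erw [h2]
  simp

open PowerSeries in
theorem derivative_expOf {K : PowerSeries ℝ} (hK : constantCoeff K = 0) :
    d⁄dX ℝ (expOf K) = d⁄dX ℝ K * expOf K := by
  rw [expOf, derivative_subst (HasSubst.of_constantCoeff_zero' hK), PowerSeries.derivative_exp,
    mul_comm]

open PowerSeries in
/-- The initial value problem `F' = K' F`, `F(0) = 1` characterises the exponential of `K`. -/
theorem eq_expOf {F K : PowerSeries ℝ} (hK : constantCoeff K = 0) (hF : constantCoeff F = 1)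
    (hd : d⁄dX ℝ F = d⁄dX ℝ K * F) : F = expOf K := by
  have hG0 : constantCoeff (expOf K) ≠ 0 := by rw [constantCoeff_expOf hK]; exact one_ne_zero
  have h : F * (expOf K)⁻¹ = 1 := by
    apply derivative.ext
    · have hm := PowerSeries.mul_inv_cancel _ hG0
      rw [Derivation.leibniz, derivative_inv', hd, derivative_expOf hK, derivative_one]
      simp only [smul_eq_mul]
      linear_combination (-(expOf K)⁻¹ * d⁄dX ℝ K * F) * hm
    · simp [hF, constantCoeff_expOf hK]
  calc F = F * (expOf K)⁻¹ * expOf K := by rw [mul_assoc, PowerSeries.inv_mul_cancel _ hG0, mul_one]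
    _ = expOf K := by rw [h, one_mul]

open PowerSeries in
theorem expOf_zero : expOf 0 = 1 :=
  (eq_expOf (by simp) (by simp) (by simp)).symm

open PowerSeries in
theorem expOf_add {K L : PowerSeries ℝ} (hK : constantCoeff K = 0) (hL : constantCoeff L = 0) :
    expOf (K + L) = expOf K * expOf L := by
  refine (eq_expOf (by simp [hK, hL]) (by simp [constantCoeff_expOf hK, constantCoeff_expOf hL])
    ?_).symm
  rw [Derivation.leibniz, derivative_expOf hK, derivative_expOf hL, map_add]
  simp only [smul_eq_mul]
  ring

open PowerSeries in
theorem expOf_sum {ι : Type*} (s : Finset ι) (K : ι → PowerSeries ℝ)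
    (hK : ∀ i, constantCoeff (K i) = 0) :
    expOf (∑ i ∈ s, K i) = ∏ i ∈ s, expOf (K i) := by
  classical
  induction s using Finset.induction_on with
  | empty => simpa using expOf_zero
  | insert i s hi ih =>
    rw [Finset.sum_insert hi, Finset.prod_insert hi, expOf_add (hK i) (by simp [hK]), ih]

open PowerSeries in
theorem expOf_pow {K : PowerSeries ℝ} (hK : constantCoeff K = 0) (n : ℕ) :
    expOf K ^ n = expOf ((n : ℝ) • K) := by
  have := expOf_sum (Finset.range n) (fun _ => K) (fun _ => hK)
  rw [Finset.prod_const, Finset.sum_const, Finset.card_range] at this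
  rw [← this, Nat.cast_smul_eq_nsmul]

open PowerSeries in
theorem derivative_rescale (a : ℝ) (K : PowerSeries ℝ) :
    d⁄dX ℝ (rescale a K) = a • rescale a (d⁄dX ℝ K) := by
  ext n
  simp only [coeff_derivative, coeff_rescale, map_smul, smul_eq_mul]
  ring

open PowerSeries in
theorem rescale_expOf {K : PowerSeries ℝ} (hK : constantCoeff K = 0) (a : ℝ) :
    rescale a (expOf K) = expOf (rescale a K) := by
  have hc (F : PowerSeries ℝ) : constantCoeff (rescale a F) = constantCoeff F := by
    rw [← coeff_zero_eq_constantCoeff_apply, ← coeff_zero_eq_constantCoeff_apply, coeff_rescale]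
    simp
  refine eq_expOf (by rw [hc, hK]) (by rw [hc, constantCoeff_expOf hK]) ?_
  rw [derivative_rescale, derivative_rescale, derivative_expOf hK, map_mul, smul_mul_assoc]

open PowerSeries in
theorem expOf_injective {K L : PowerSeries ℝ} (hK : constantCoeff K = 0)
    (hL : constantCoeff L = 0) (h : expOf K = expOf L) : K = L := by
  apply derivative.ext _ (by rw [hK, hL])
  have hne : expOf L ≠ 0 := fun h0 => by
    have := constantCoeff_expOf hL
    rw [h0] at this
    simp at this
  apply mul_right_cancel₀ hne
  rw [← derivative_expOf hL, ← h, derivative_expOf hK]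

open PowerSeries in
/-- Existence of a formal logarithm. It is the formal antiderivative of `F' / F`. -/
theorem exists_expOf_eq {F : PowerSeries ℝ} (hF : constantCoeff F = 1) :
    ∃ K : PowerSeries ℝ, constantCoeff K = 0 ∧ expOf K = F := by
  set D := d⁄dX ℝ F * F⁻¹ with hD
  let K : PowerSeries ℝ := PowerSeries.mk fun n => if n = 0 then 0 else coeff (n - 1) D / n
  have hK0 : constantCoeff K = 0 := by
    rw [← coeff_zero_eq_constantCoeff_apply]; simp [K]
  have hKd : d⁄dX ℝ K = D := by
    ext n
    rw [coeff_derivative]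
    simp only [K, coeff_mk]
    have : ((n : ℝ) + 1) ≠ 0 := by positivity
    simp
    field_simp
  refine ⟨K, hK0, (eq_expOf hK0 hF ?_).symm⟩
  rw [hKd, hD, mul_assoc, PowerSeries.inv_mul_cancel _ (by rw [hF]; exact one_ne_zero), mul_one]

open PowerSeries Filter Topology in
theorem tendsto_coeff_mul {F G : ℕ → PowerSeries ℝ} {F' G' : PowerSeries ℝ} (n : ℕ)
    (hF : ∀ k ≤ n, Tendsto (fun l => coeff k (F l)) atTop (𝓝 (coeff k F')))
    (hG : ∀ k ≤ n, Tendsto (fun l => coeff k (G l)) atTop (𝓝 (coeff k G'))) :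
    Tendsto (fun l => coeff n (F l * G l)) atTop (𝓝 (coeff n (F' * G'))) := by
  simp only [coeff_mul]
  refine tendsto_finsetSum _ fun p hp => (hF _ ?_).mul (hG _ ?_)
  · have := Finset.HasAntidiagonal.mem_antidiagonal.1 hp; omega
  · have := Finset.HasAntidiagonal.mem_antidiagonal.1 hp; omega

open PowerSeries Filter Topology in
/-- Coefficientwise stability of the initial value problem for `expOf K`: if `F' S = G F` and
`F(0) = 1`, where `S → 1` and `G → K'`, then `F → expOf K`. -/
theorem tendsto_coeff_expOf {F S G : ℕ → PowerSeries ℝ} {K : PowerSeries ℝ}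
    (hK : constantCoeff K = 0) (hF : ∀ l, constantCoeff (F l) = 1)
    (hS0 : ∀ l, constantCoeff (S l) = 1)
    (hd : ∀ l, d⁄dX ℝ (F l) * S l = G l * F l)
    (hS : ∀ k, Tendsto (fun l => coeff k (S l)) atTop (𝓝 (coeff k 1)))
    (hG : ∀ k, Tendsto (fun l => coeff k (G l)) atTop (𝓝 (coeff k (d⁄dX ℝ K)))) (n : ℕ) :
    Tendsto (fun l => coeff n (F l)) atTop (𝓝 (coeff n (expOf K))) := by
  induction n using Nat.strong_induction_on with
  | _ n ih =>
    cases n with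
    | zero =>
      simp only [coeff_zero_eq_constantCoeff_apply, hF, constantCoeff_expOf hK]
      exact tendsto_const_nhds
    | succ n =>
      have hn : ((n : ℝ) + 1) ≠ 0 := by positivity
      have h1 : Tendsto (fun l => coeff n (G l * F l)) atTop
          (𝓝 (coeff n (d⁄dX ℝ K * expOf K))) :=
        tendsto_coeff_mul n (fun k _ => hG k) (fun k hk => ih k (by omega))
      -- the part of the convolution on the left that does not contain the top coefficient
      have h2 : Tendsto (fun l => coeff n ((X : PowerSeries ℝ) * (d⁄dX ℝ (F l) *
          (PowerSeries.mk fun k => coeff (k + 1) (S l))))) atTop (𝓝 0) := by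
        cases n with
        | zero => simp
        | succ m =>
          simp only [coeff_succ_X_mul]
          have := tendsto_coeff_mul (F := fun l => d⁄dX ℝ (F l))
            (G := fun l => PowerSeries.mk fun k => coeff (k + 1) (S l))
            (F' := d⁄dX ℝ (expOf K)) (G' := 0) m
            (fun k hk => by
              simp only [coeff_derivative]
              exact (ih (k + 1) (by omega)).mul_const _)
            (fun k _ => by
              have := hS (k + 1)
              rw [coeff_one, if_neg (by omega)] at this
              simpa using this)
          simpa using this
      have hsplit (l : ℕ) : S l = 1 + X * PowerSeries.mk fun k => coeff (k + 1) (S l) := by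
        ext k
        cases k with
        | zero => simp [hS0 l]
        | succ k => simp [coeff_succ_X_mul, coeff_one]
      have h3 (l : ℕ) : coeff (n + 1) (F l) = (coeff n (G l * F l) -
          coeff n ((X : PowerSeries ℝ) * (d⁄dX ℝ (F l) *
          (PowerSeries.mk fun k => coeff (k + 1) (S l))))) / (n + 1) := by
        rw [eq_div_iff hn, ← coeff_derivative, ← map_sub, ← hd l]
        congr 1
        linear_combination -(d⁄dX ℝ (F l)) * hsplit l
      have h4 : coeff (n + 1) (expOf K) = (coeff n (d⁄dX ℝ K * expOf K) - 0) / (n + 1) := by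
        rw [eq_div_iff hn, ← coeff_derivative, derivative_expOf hK, sub_zero]
      rw [h4]
      simp only [h3]
      exact (h1.sub h2).div_const _

open PowerSeries Filter Topology in
theorem tendsto_coeff_expOf_of_tendsto {L : ℕ → PowerSeries ℝ} {K : PowerSeries ℝ}
    (hK : constantCoeff K = 0) (hL0 : ∀ l, constantCoeff (L l) = 0)
    (hL : ∀ k, Tendsto (fun l => coeff k (L l)) atTop (𝓝 (coeff k K))) (n : ℕ) :
    Tendsto (fun l => coeff n (expOf (L l))) atTop (𝓝 (coeff n (expOf K))) := by
  refine tendsto_coeff_expOf (S := fun _ => 1) (G := fun l => d⁄dX ℝ (L l)) hK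
    (fun l => constantCoeff_expOf (hL0 l)) (by simp)
    (fun l => by rw [derivative_expOf (hL0 l), mul_one]) (fun k => tendsto_const_nhds)
    (fun k => ?_) n
  simp only [coeff_derivative]
  exact (hL (k + 1)).mul_const _

open PowerSeries Filter Topology in
/-- The formal version of `(1 + T / N + o(1 / N)) ^ N → exp T`. -/
theorem tendsto_coeff_pow_expOf {S : ℕ → PowerSeries ℝ} {T : PowerSeries ℝ} {N : ℕ → ℕ}
    (hT : constantCoeff T = 0) (hN : Tendsto N atTop atTop) (hS0 : ∀ l, constantCoeff (S l) = 1)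
    (hS : ∀ k, Tendsto (fun l => (N l : ℝ) * coeff (k + 1) (S l)) atTop (𝓝 (coeff (k + 1) T)))
    (n : ℕ) :
    Tendsto (fun l => coeff n (S l ^ N l)) atTop (𝓝 (coeff n (expOf T))) := by
  have hN' : Tendsto (fun l => (N l : ℝ)) atTop atTop := tendsto_natCast_atTop_atTop.comp hN
  refine tendsto_coeff_expOf (S := S) (G := fun l => (N l : ℝ) • d⁄dX ℝ (S l)) hT
    (by simp [hS0]) hS0 (fun l => ?_) (fun k => ?_) (fun k => ?_) n
  · rw [derivative_pow]
    rcases Nat.eq_zero_or_pos (N l) with h | h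
    · simp [h]
    · have h2 : S l ^ N l = S l ^ (N l - 1) * S l := by rw [← pow_succ]; congr 1; omega
      rw [h2, Nat.cast_smul_eq_nsmul, nsmul_eq_mul]
      ring
  · cases k with
    | zero => simp [hS0]
    | succ k =>
      rw [coeff_one, if_neg (by omega)]
      have h1 := (hS k).mul (tendsto_inv_atTop_zero.comp hN')
      rw [mul_zero] at h1
      refine h1.congr' ?_
      filter_upwards [hN'.eventually_gt_atTop 0] with l hl
      simp only [Function.comp]
      field_simp
  · simp only [map_smul, coeff_derivative, smul_eq_mul, ← mul_assoc]
    exact (hS k).mul_const _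

/-! ### Moments of measures on the line -/

/-- All moments of `μ` are finite. -/
def HasMoments (μ : Measure ℝ) : Prop := ∀ n : ℕ, Integrable (fun x : ℝ => x ^ n) μ

theorem coeff_momentSeries {Ω : Type*} [MeasurableSpace Ω] (P : Measure Ω) (Y : Ω → ℝ) (n : ℕ) :
    PowerSeries.coeff n (momentSeries P Y) = (∫ ω, Y ω ^ n ∂P) / (n.factorial : ℝ) := by
  simp [momentSeries]

theorem constantCoeff_momentSeries {Ω : Type*} [MeasurableSpace Ω] (P : Measure Ω)
    [IsProbabilityMeasure P] (Y : Ω → ℝ) :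
    PowerSeries.constantCoeff (momentSeries P Y) = 1 := by
  rw [← PowerSeries.coeff_zero_eq_constantCoeff_apply, coeff_momentSeries]
  simp

theorem momentSeries_map {Ω : Type*} [MeasurableSpace Ω] (P : Measure Ω) {Y : Ω → ℝ}
    (hY : Measurable Y) : momentSeries (P.map Y) id = momentSeries P Y := by
  ext n
  rw [coeff_momentSeries, coeff_momentSeries, integral_map hY.aemeasurable (by fun_prop)]
  rfl

theorem integral_pow_eq_of_momentSeries_eq {μ ν : Measure ℝ}
    (h : momentSeries μ id = momentSeries ν id) (n : ℕ) :
    ∫ x, x ^ n ∂μ = ∫ x, x ^ n ∂ν := by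
  have := congrArg (PowerSeries.coeff n) h
  rw [coeff_momentSeries, coeff_momentSeries] at this
  have hn : (n.factorial : ℝ) ≠ 0 := by positivity
  simpa using (div_left_inj' hn).1 this

theorem hasMoments_map_iff {Ω : Type*} [MeasurableSpace Ω] {P : Measure Ω} {Y : Ω → ℝ}
    (hY : Measurable Y) : HasMoments (P.map Y) ↔ ∀ n : ℕ, Integrable (fun ω => Y ω ^ n) P := by
  refine forall_congr' fun n => ?_
  rw [integrable_map_measure (by fun_prop) hY.aemeasurable]
  rfl

theorem HasMoments.map_mul {μ : Measure ℝ} (h : HasMoments μ) (a : ℝ) :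
    HasMoments (μ.map (a * ·)) := by
  rw [hasMoments_map_iff (by fun_prop)]
  intro n
  simp only [mul_pow]
  exact (h n).const_mul _

theorem momentSeries_map_mul (μ : Measure ℝ) (a : ℝ) :
    momentSeries (μ.map (a * ·)) id = PowerSeries.rescale a (momentSeries μ id) := by
  rw [momentSeries_map μ (by fun_prop)]
  ext n
  simp only [coeff_momentSeries, PowerSeries.coeff_rescale, mul_pow, integral_const_mul, id]
  ring

theorem integrable_add_pow_prod {μ ν : Measure ℝ} [IsProbabilityMeasure μ]
    [IsProbabilityMeasure ν] (hμ : HasMoments μ) (hν : HasMoments ν) (n : ℕ) :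
    Integrable (fun p : ℝ × ℝ => (p.1 + p.2) ^ n) (μ.prod ν) := by
  simp only [add_pow]
  exact integrable_finsetSum _ fun m _ => ((hμ m).mul_prod (hν (n - m))).mul_const _

theorem HasMoments.conv {μ ν : Measure ℝ} [IsProbabilityMeasure μ] [IsProbabilityMeasure ν]
    (hμ : HasMoments μ) (hν : HasMoments ν) : HasMoments (μ.conv ν) := fun n => by
  rw [Measure.conv, integrable_map_measure (by fun_prop) (by fun_prop)]
  exact integrable_add_pow_prod hμ hν n

/-- The moment series of a sum is the product of the moment series as soon as all mixed moments
factorise. Independence is not needed. -/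
theorem momentSeries_add {Ω : Type*} [MeasurableSpace Ω] {P : Measure Ω} {Y Z : Ω → ℝ}
    (hi : ∀ i j : ℕ, Integrable (fun ω => Y ω ^ i * Z ω ^ j) P)
    (hm : ∀ i j : ℕ, ∫ ω, Y ω ^ i * Z ω ^ j ∂P = (∫ ω, Y ω ^ i ∂P) * ∫ ω, Z ω ^ j ∂P) :
    momentSeries P (fun ω => Y ω + Z ω) = momentSeries P Y * momentSeries P Z := by
  ext n
  rw [coeff_momentSeries, PowerSeries.coeff_mul,
    Finset.Nat.sum_antidiagonal_eq_sum_range_succ_mk]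
  simp only [coeff_momentSeries, add_pow]
  rw [integral_finsetSum _ fun m _ => (hi m (n - m)).mul_const _, Finset.sum_div]
  refine Finset.sum_congr rfl fun m hmn => ?_
  have hmn' : m ≤ n := by simpa [Nat.lt_succ_iff] using hmn
  rw [integral_mul_const, hm, Nat.cast_choose ℝ hmn']
  field_simp

theorem momentSeries_conv {μ ν : Measure ℝ} [IsProbabilityMeasure μ] [IsProbabilityMeasure ν]
    (hμ : HasMoments μ) (hν : HasMoments ν) :
    momentSeries (μ.conv ν) id = momentSeries μ id * momentSeries ν id := by
  rw [Measure.conv, momentSeries_map _ (by fun_prop),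
    momentSeries_add (fun i j => (hμ i).mul_prod (hν j)) (fun i j => ?_),
    ← momentSeries_map _ measurable_fst, ← momentSeries_map _ measurable_snd]
  · simp
  · rw [integral_prod_mul (fun x : ℝ => x ^ i) (fun x : ℝ => x ^ j),
      integral_fun_fst (fun x : ℝ => x ^ i), integral_fun_snd (fun x : ℝ => x ^ j)]
    simp

/-- The `n`-fold convolution of `μ` with itself. -/
noncomputable def convPow (μ : Measure ℝ) : ℕ → Measure ℝ
  | 0 => Measure.dirac 0
  | n + 1 => (convPow μ n).conv μ

instance isProbabilityMeasure_convPow (μ : Measure ℝ) [IsProbabilityMeasure μ] (n : ℕ) :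
    IsProbabilityMeasure (convPow μ n) := by
  induction n with
  | zero => exact Measure.dirac.isProbabilityMeasure
  | succ n ih => rw [convPow]; infer_instance

theorem hasMoments_dirac (x : ℝ) : HasMoments (Measure.dirac x) :=
  fun _ => integrable_dirac (by simp [enorm])

theorem momentSeries_dirac_zero : momentSeries (Measure.dirac (0 : ℝ)) id = 1 := by
  ext n
  rw [coeff_momentSeries, integral_dirac, PowerSeries.coeff_one]
  rcases eq_or_ne n 0 with h | h <;> simp [h]

theorem HasMoments.convPow {μ : Measure ℝ} [IsProbabilityMeasure μ] (hμ : HasMoments μ) (n : ℕ) :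
    HasMoments (convPow μ n) := by
  induction n with
  | zero => exact hasMoments_dirac 0
  | succ n ih => exact ih.conv hμ

theorem momentSeries_convPow {μ : Measure ℝ} [IsProbabilityMeasure μ] (hμ : HasMoments μ) (n : ℕ) :
    momentSeries (convPow μ n) id = momentSeries μ id ^ n := by
  induction n with
  | zero => rw [pow_zero]; exact momentSeries_dirac_zero
  | succ n ih => rw [convPow, momentSeries_conv (hμ.convPow n) hμ, ih, pow_succ]

theorem charFun_convPow (μ : Measure ℝ) [IsProbabilityMeasure μ] (n : ℕ) (u : ℝ) :
    charFun (convPow μ n) u = charFun μ u ^ n := by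
  induction n with
  | zero => simp [convPow]
  | succ n ih => rw [convPow, charFun_conv, ih, pow_succ]

theorem lintegral_exp_conv (μ ν : Measure ℝ) [IsProbabilityMeasure μ] [IsProbabilityMeasure ν]
    (y : ℝ) : ∫⁻ x, ENNReal.ofReal (Real.exp (y * x)) ∂(μ.conv ν) =
      (∫⁻ x, ENNReal.ofReal (Real.exp (y * x)) ∂μ) *
        ∫⁻ x, ENNReal.ofReal (Real.exp (y * x)) ∂ν := by
  rw [Measure.lintegral_conv (by fun_prop)]
  simp only [mul_add, Real.exp_add, ENNReal.ofReal_mul (Real.exp_nonneg _)]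
  simp_rw [lintegral_const_mul _ (show Measurable fun x : ℝ => ENNReal.ofReal (Real.exp (y * x))
    by fun_prop)]
  rw [lintegral_mul_const _ (by fun_prop)]

theorem lintegral_exp_convPow (μ : Measure ℝ) [IsProbabilityMeasure μ] (n : ℕ) (y : ℝ) :
    ∫⁻ x, ENNReal.ofReal (Real.exp (y * x)) ∂(convPow μ n) =
      (∫⁻ x, ENNReal.ofReal (Real.exp (y * x)) ∂μ) ^ n := by
  induction n with
  | zero =>
    rw [convPow, lintegral_dirac' _ (by fun_prop)]
    simp
  | succ n ih => rw [convPow, lintegral_exp_conv, ih, pow_succ]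

theorem map_sum_pi_eq_convPow (μ : Measure ℝ) [IsProbabilityMeasure μ] (n : ℕ) :
    (Measure.pi (fun _ : Fin n => μ)).map (fun x : Fin n → ℝ => ∑ i, x i) = convPow μ n := by
  have : IsProbabilityMeasure ((Measure.pi (fun _ : Fin n => μ)).map
      (fun x : Fin n → ℝ => ∑ i, x i)) := Measure.isProbabilityMeasure_map (by fun_prop)
  apply Measure.ext_of_charFun
  ext u
  rw [charFun_map_sum_pi_eq_prod, charFun_convPow]
  simp

/-! ### Weak limits and convergence of moments -/

open Filter Topology in
theorem tendsto_integral_of_bounded {μs : ℕ → ProbabilityMeasure ℝ} {μ : ProbabilityMeasure ℝ}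
    (h : Tendsto μs atTop (𝓝 μ)) {g : ℝ → ℝ} (hg : Continuous g) {C : ℝ} (hC : ∀ x, |g x| ≤ C) :
    Tendsto (fun l => ∫ x, g x ∂(μs l : Measure ℝ)) atTop (𝓝 (∫ x, g x ∂(μ : Measure ℝ))) :=
  (ProbabilityMeasure.tendsto_iff_forall_integral_tendsto.1 h)
    (BoundedContinuousFunction.ofNormedAddCommGroup g hg C hC)

open Filter Topology in
/-- Fatou's lemma for weakly convergent sequences. -/
theorem integrable_of_tendsto_of_integral_le {μs : ℕ → ProbabilityMeasure ℝ}
    {μ : ProbabilityMeasure ℝ} (hμ : Tendsto μs atTop (𝓝 μ)) {h : ℝ → ℝ} (hc : Continuous h)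
    (h0 : ∀ x, 0 ≤ h x) (hi : ∀ l, Integrable h (μs l : Measure ℝ)) {C : ℝ}
    (hC : ∀ l, ∫ x, h x ∂(μs l : Measure ℝ) ≤ C) :
    Integrable h (μ : Measure ℝ) ∧ ∫ x, h x ∂(μ : Measure ℝ) ≤ C := by
  have hC0 : 0 ≤ C := (integral_nonneg h0).trans (hC 0)
  have hb (M : ℕ) (x : ℝ) : |min (h x) M| ≤ M := by
    rw [abs_of_nonneg (le_min (h0 x) (Nat.cast_nonneg M))]
    exact min_le_right _ _
  have hint (M : ℕ) (ρ : ProbabilityMeasure ℝ) :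
      Integrable (fun x => min (h x) M) (ρ : Measure ℝ) :=
    Integrable.of_bound (by fun_prop) (M : ℝ) (.of_forall (hb M))
  have h1 (M : ℕ) : ∫ x, min (h x) M ∂(μ : Measure ℝ) ≤ C := by
    refine le_of_tendsto (tendsto_integral_of_bounded hμ (by fun_prop) (hb M))
      (.of_forall fun l => (integral_mono (hint M _) (hi l) fun x => min_le_left _ _).trans (hC l))
  have h2 : ∫⁻ x, ENNReal.ofReal (h x) ∂(μ : Measure ℝ) ≤ ENNReal.ofReal C := by
    calc ∫⁻ x, ENNReal.ofReal (h x) ∂(μ : Measure ℝ)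
        = ∫⁻ x, liminf (fun M : ℕ => ENNReal.ofReal (min (h x) M)) atTop ∂(μ : Measure ℝ) := by
          refine lintegral_congr fun x => (Tendsto.liminf_eq ?_).symm
          refine tendsto_const_nhds.congr' ?_
          filter_upwards [eventually_ge_atTop ⌈h x⌉₊] with M hM
          rw [min_eq_left (Nat.ceil_le.1 hM)]
      _ ≤ liminf (fun M : ℕ => ∫⁻ x, ENNReal.ofReal (min (h x) M) ∂(μ : Measure ℝ)) atTop :=
          lintegral_liminf_le fun M => by fun_prop
      _ ≤ ENNReal.ofReal C := by
          refine liminf_le_of_frequently_le' (.of_forall fun M => ?_)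
          rw [← ofReal_integral_eq_lintegral_ofReal (hint M μ)
            (.of_forall fun x => le_min (h0 x) (Nat.cast_nonneg M))]
          exact ENNReal.ofReal_le_ofReal (h1 M)
  have h3 : Integrable h (μ : Measure ℝ) := by
    refine ⟨hc.aestronglyMeasurable, ?_⟩
    rw [hasFiniteIntegral_iff_ofReal (.of_forall h0)]
    exact h2.trans_lt ENNReal.ofReal_lt_top
  refine ⟨h3, ?_⟩
  rw [← ofReal_integral_eq_lintegral_ofReal h3 (.of_forall h0)] at h2
  exact (ENNReal.ofReal_le_ofReal_iff hC0).1 h2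

open Filter Topology in
/-- Weak convergence passes to the integrals of an unbounded continuous `g` that is
uniformly integrable, being dominated by `ε h + A` for every `ε > 0` with `∫ h` bounded. -/
theorem tendsto_integral_of_uniform {μs : ℕ → ProbabilityMeasure ℝ}
    {μ : ProbabilityMeasure ℝ} (hμ : Tendsto μs atTop (𝓝 μ)) {h g : ℝ → ℝ} (hc : Continuous h)
    (h0 : ∀ x, 0 ≤ h x) (hi : ∀ l, Integrable h (μs l : Measure ℝ)) {C : ℝ}
    (hC : ∀ l, ∫ x, h x ∂(μs l : Measure ℝ) ≤ C) (hg : Continuous g)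
    (hgh : ∀ ε : ℝ, 0 < ε → ∃ A : ℝ, ∀ x, |g x| ≤ ε * h x + A) :
    Integrable g (μ : Measure ℝ) ∧
    Tendsto (fun l => ∫ x, g x ∂(μs l : Measure ℝ)) atTop (𝓝 (∫ x, g x ∂(μ : Measure ℝ))) := by
  obtain ⟨hiμ, hCμ⟩ := integrable_of_tendsto_of_integral_le hμ hc h0 hi hC
  have hC0 : 0 ≤ C := (integral_nonneg h0).trans (hC 0)
  have hgi (ρ : ProbabilityMeasure ℝ) (hρ : Integrable h (ρ : Measure ℝ)) :
      Integrable g (ρ : Measure ℝ) := by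
    obtain ⟨A, hA⟩ := hgh 1 one_pos
    exact ((hρ.const_mul 1).add (integrable_const A)).mono' hg.aestronglyMeasurable (.of_forall hA)
  refine ⟨hgi μ hiμ, ?_⟩
  rw [Metric.tendsto_atTop]
  intro δ hδ
  obtain ⟨A, hA⟩ := hgh (δ / (4 * (C + 1))) (by positivity)
  set ε := δ / (4 * (C + 1)) with hε
  have hεC : ε * C ≤ δ / 4 := by
    rw [hε, div_mul_eq_mul_div, div_le_div_iff₀ (by positivity) (by positivity)]
    nlinarith
  have hε0 : 0 < ε := by positivity
  have hA0 : 0 ≤ |A| := abs_nonneg A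
  -- truncation of `g` at height `|A|`
  set k : ℝ → ℝ := fun x => max (min (g x) |A|) (-|A|) with hk
  have hkc : Continuous k := by fun_prop
  have hkb (x : ℝ) : |k x| ≤ |A| := by
    rw [abs_le]
    exact ⟨le_max_right _ _, max_le (min_le_right _ _) (by linarith)⟩
  have hgk (x : ℝ) : |g x - k x| ≤ ε * h x := by
    have h1 := hA x
    have h2 := le_abs_self A
    have h3 : 0 ≤ ε * h x := mul_nonneg hε0.le (h0 x)
    have h4 := abs_le.1 h1
    simp only [hk]
    rw [abs_le]
    rcases le_total (g x) |A| with h5 | h5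
    · rw [min_eq_left h5]
      rcases le_total (g x) (-|A|) with h6 | h6
      · rw [max_eq_right h6]; constructor <;> linarith [h4.1]
      · rw [max_eq_left h6]; constructor <;> linarith
    · rw [min_eq_right h5, max_eq_left (by linarith)]; constructor <;> linarith [h4.2]
  have hdiff (ρ : ProbabilityMeasure ℝ) (hρ : Integrable h (ρ : Measure ℝ))
      (hρC : ∫ x, h x ∂(ρ : Measure ℝ) ≤ C) :
      |∫ x, g x ∂(ρ : Measure ℝ) - ∫ x, k x ∂(ρ : Measure ℝ)| ≤ δ / 4 := by
    have hki : Integrable k (ρ : Measure ℝ) :=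
      Integrable.of_bound hkc.aestronglyMeasurable |A| (.of_forall hkb)
    rw [← integral_sub (hgi ρ hρ) hki]
    calc |∫ x, (g x - k x) ∂(ρ : Measure ℝ)| ≤ ∫ x, ε * h x ∂(ρ : Measure ℝ) := by
          rw [← Real.norm_eq_abs]
          exact norm_integral_le_of_norm_le (hρ.const_mul ε) (.of_forall hgk)
      _ = ε * ∫ x, h x ∂(ρ : Measure ℝ) := integral_const_mul _ _
      _ ≤ ε * C := by gcongr
      _ ≤ δ / 4 := hεC
  obtain ⟨n, hn⟩ := (Metric.tendsto_atTop.1 (tendsto_integral_of_bounded hμ hkc hkb)) (δ / 4)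
    (by positivity)
  refine ⟨n, fun l hl => ?_⟩
  have h1 := hn l hl
  have h2 := hdiff (μs l) (hi l) (hC l)
  have h3 := hdiff μ hiμ hCμ
  rw [Real.dist_eq] at h1 ⊢
  rw [abs_le] at h2 h3
  rw [abs_lt] at h1 ⊢
  constructor <;> linarith [h1.1, h1.2, h2.1, h2.2, h3.1, h3.2]

open Filter Topology in
/-- **Method of moments.** If all moments of a sequence of probability measures converge, then a
subsequence converges weakly to a measure with the limiting moments. -/
theorem exists_subseq_tendsto_of_tendsto_moments {μs : ℕ → ProbabilityMeasure ℝ} {m : ℕ → ℝ}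
    (hμ : ∀ l, HasMoments (μs l : Measure ℝ))
    (hm : ∀ j, Tendsto (fun l => ∫ x, x ^ j ∂(μs l : Measure ℝ)) atTop (𝓝 (m j))) :
    ∃ (ρ : ProbabilityMeasure ℝ) (φ : ℕ → ℕ), StrictMono φ ∧ Tendsto (μs ∘ φ) atTop (𝓝 ρ) ∧
      HasMoments (ρ : Measure ℝ) ∧ ∀ j, ∫ x, x ^ j ∂(ρ : Measure ℝ) = m j := by
  have hbd (j : ℕ) : ∃ C, ∀ l, ∫ x, x ^ j ∂(μs l : Measure ℝ) ≤ C := by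
    obtain ⟨C, hC⟩ := (hm j).bddAbove_range
    exact ⟨C, fun l => hC ⟨l, rfl⟩⟩
  have htight : IsTightMeasureSet
      {((ρ : ProbabilityMeasure ℝ) : Measure ℝ) | ρ ∈ Set.range μs} := by
    obtain ⟨C, hC⟩ := hbd 2
    apply isTightMeasureSet_of_tendsto_measure_norm_gt
    have h1 : Tendsto (fun r : ℝ => ENNReal.ofReal (C / r ^ 2)) atTop (𝓝 0) := by
      rw [← ENNReal.ofReal_zero]
      refine ENNReal.tendsto_ofReal ?_
      exact tendsto_const_nhds.div_atTop (tendsto_pow_atTop (by norm_num))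
    refine tendsto_of_tendsto_of_tendsto_of_le_of_le' tendsto_const_nhds h1
      (.of_forall fun _ => zero_le) ?_
    filter_upwards [eventually_gt_atTop 0] with r hr
    refine iSup₂_le ?_
    rintro _ ⟨_, ⟨l, rfl⟩, rfl⟩
    have h2 := mul_meas_ge_le_integral_of_nonneg (μ := (μs l : Measure ℝ))
      (.of_forall fun x : ℝ => sq_nonneg x) (hμ l 2) (r ^ 2)
    have h3 : (μs l : Measure ℝ).real {x | r ^ 2 ≤ x ^ 2} ≤ C / r ^ 2 := by
      rw [le_div_iff₀ (by positivity), mul_comm]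
      exact h2.trans (hC l)
    calc (μs l : Measure ℝ) {x | r < ‖x‖} ≤ (μs l : Measure ℝ) {x | r ^ 2 ≤ x ^ 2} := by
          refine measure_mono fun x hx => ?_
          have hx' : r < |x| := hx
          show r ^ 2 ≤ x ^ 2
          rw [← sq_abs x]
          gcongr
      _ ≤ ENNReal.ofReal (C / r ^ 2) := by
          rw [← ENNReal.ofReal_toReal (measure_ne_top (μs l : Measure ℝ) {x | r ^ 2 ≤ x ^ 2})]
          exact ENNReal.ofReal_le_ofReal h3
  obtain ⟨ρ, -, φ, hφ, hρ⟩ := (isCompact_closure_of_isTightMeasureSet htight).isSeqCompact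
    (fun l => subset_closure (Set.mem_range_self l))
  refine ⟨ρ, φ, hφ, hρ, ?_⟩
  choose C hC using hbd
  have key (j : ℕ) := tendsto_integral_of_uniform hρ
      (h := fun x => x ^ (2 * j)) (g := fun x => x ^ j) (by fun_prop)
      (fun x => by rw [pow_mul']; positivity) (fun l => hμ (φ l) (2 * j))
      (fun l => hC (2 * j) (φ l)) (by fun_prop) (fun ε hε => ⟨1 / (4 * ε), fun x => by
        rw [pow_mul', ← sq_abs (x ^ j)]
        have h1 : ε * |x ^ j| ^ 2 + 1 / (4 * ε) - |x ^ j| =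
            (2 * ε * |x ^ j| - 1) ^ 2 / (4 * ε) := by
          field_simp; ring
        have h2 : 0 ≤ (2 * ε * |x ^ j| - 1) ^ 2 / (4 * ε) := by positivity
        linarith⟩)
  exact ⟨fun j => (key j).1, fun j =>
    tendsto_nhds_unique (key j).2 ((hm j).comp hφ.tendsto_atTop)⟩

open Filter Topology in
theorem exists_subseq_tendsto_of_tendsto_momentSeries {μs : ℕ → ProbabilityMeasure ℝ}
    {F : PowerSeries ℝ} (hμ : ∀ l, HasMoments (μs l : Measure ℝ))
    (hF : ∀ j, Tendsto (fun l => PowerSeries.coeff j (momentSeries (μs l : Measure ℝ) id)) atTop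
      (𝓝 (PowerSeries.coeff j F))) :
    ∃ (ρ : ProbabilityMeasure ℝ) (φ : ℕ → ℕ), StrictMono φ ∧ Tendsto (μs ∘ φ) atTop (𝓝 ρ) ∧
      HasMoments (ρ : Measure ℝ) ∧ momentSeries (ρ : Measure ℝ) id = F := by
  obtain ⟨ρ, φ, hφ, hρ, hm, hmom⟩ := exists_subseq_tendsto_of_tendsto_moments
    (m := fun j => (j.factorial : ℝ) * PowerSeries.coeff j F) hμ (fun j => by
      refine ((hF j).const_mul (j.factorial : ℝ)).congr fun l => ?_
      rw [coeff_momentSeries]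
      have : (j.factorial : ℝ) ≠ 0 := by positivity
      simp only [id]
      field_simp)
  refine ⟨ρ, φ, hφ, hρ, hm, ?_⟩
  ext j
  rw [coeff_momentSeries]
  simp only [id]
  rw [hmom j]
  have : (j.factorial : ℝ) ≠ 0 := by positivity
  field_simp

theorem IsMomentDeterminate.eq_of_momentSeries_eq {μ ν : Measure ℝ} (h : IsMomentDeterminate μ)
    [IsProbabilityMeasure ν] (hν : HasMoments ν)
    (hs : momentSeries ν id = momentSeries μ id) : ν = μ :=
  h.2 ν inferInstance hν (integral_pow_eq_of_momentSeries_eq hs)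

/-! ### Convolution roots of self-decomposable laws -/

/-- Every dilation of `μ` by a factor in `(0, 1)` is a convolution factor of `μ`, and the
cofactor has finite moments. -/
def IsSelfDecomposable (μ : Measure ℝ) : Prop :=
  ∀ a : ℝ, 0 < a → a < 1 → ∃ ν : Measure ℝ, IsProbabilityMeasure ν ∧ HasMoments ν ∧
    (μ.map (a * ·)).conv ν = μ

open PowerSeries in
theorem constantCoeff_rescale_eq_zero {K : PowerSeries ℝ} (hK : constantCoeff K = 0) (a : ℝ) :
    constantCoeff (rescale a K) = 0 := by
  rw [← coeff_zero_eq_constantCoeff_apply, coeff_rescale, coeff_zero_eq_constantCoeff_apply, hK,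
    mul_zero]

open PowerSeries in
theorem momentSeries_cofactor {μ ν : Measure ℝ} [IsProbabilityMeasure μ] [IsProbabilityMeasure ν]
    {K : PowerSeries ℝ} {a : ℝ} (hμ : HasMoments μ) (hν : HasMoments ν)
    (hK : constantCoeff K = 0) (hμK : momentSeries μ id = expOf K)
    (h : (μ.map (a * ·)).conv ν = μ) :
    momentSeries ν id = expOf (K - rescale a K) := by
  have hK' := constantCoeff_rescale_eq_zero hK a
  have : IsProbabilityMeasure (μ.map (a * ·)) := Measure.isProbabilityMeasure_map (by fun_prop)
  have h1 := momentSeries_conv (hμ.map_mul a) hν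
  rw [h, momentSeries_map_mul, hμK, rescale_expOf hK] at h1
  have hne : expOf (rescale a K) ≠ 0 := fun h0 => by
    have := constantCoeff_expOf hK'
    rw [h0] at this
    simp at this
  apply mul_left_cancel₀ hne
  rw [← h1, ← expOf_add hK' (by simp [hK, hK'])]
  congr 1
  ring

open PowerSeries in
/-- With `ν` the cofactor of the dilation by `a`, the convolution of the laws `a ^ (n k) ν`,
`k < m`, has the indicated moment series. -/
theorem exists_conv_dilations {μ : Measure ℝ} [IsProbabilityMeasure μ] {K : PowerSeries ℝ}
    (hμ : HasMoments μ) (hK : constantCoeff K = 0) (hμK : momentSeries μ id = expOf K)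
    (hsd : IsSelfDecomposable μ) {a : ℝ} (ha : 0 < a) (ha1 : a < 1) (n m : ℕ) :
    ∃ ρ : Measure ℝ, IsProbabilityMeasure ρ ∧ HasMoments ρ ∧ momentSeries ρ id =
      expOf (∑ k ∈ Finset.range m, rescale (a ^ (n * k)) (K - rescale a K)) := by
  obtain ⟨ν, hνp, hνm, hν⟩ := hsd a ha ha1
  have hνs := momentSeries_cofactor hμ hνm hK hμK hν
  have h0 : constantCoeff (K - rescale a K) = 0 := by
    rw [map_sub, hK, constantCoeff_rescale_eq_zero hK, sub_zero]
  induction m with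
  | zero =>
    refine ⟨Measure.dirac 0, Measure.dirac.isProbabilityMeasure, hasMoments_dirac 0, ?_⟩
    rw [momentSeries_dirac_zero, Finset.sum_range_zero, expOf_zero]
  | succ m ih =>
    obtain ⟨ρ, hρp, hρm, hρs⟩ := ih
    have : IsProbabilityMeasure (ν.map (a ^ (n * m) * ·)) :=
      Measure.isProbabilityMeasure_map (by fun_prop)
    refine ⟨ρ.conv (ν.map (a ^ (n * m) * ·)), inferInstance, hρm.conv (hνm.map_mul _), ?_⟩
    rw [momentSeries_conv hρm (hνm.map_mul _), hρs, momentSeries_map_mul, hνs, rescale_expOf h0,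
      Finset.sum_range_succ, expOf_add _ (constantCoeff_rescale_eq_zero h0 _)]
    rw [map_sum]
    exact Finset.sum_eq_zero fun k _ => constantCoeff_rescale_eq_zero h0 _

open Filter Topology in
/-- For `a = e ^ (-1 / (l + 1))` the geometric sum `(1 - a ^ j) ∑_{k < (l + 1) ^ 2} a ^ (n k j)`
tends to `1 / n`: there are so many terms that the last one is negligible. -/
theorem tendsto_geometric_quotient {n : ℕ} (hn : 1 ≤ n) {j : ℕ} (hj : 1 ≤ j) :
    Tendsto (fun l : ℕ => ∑ k ∈ Finset.range ((l + 1) ^ 2),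
      ((Real.exp (-(1 / ((l : ℝ) + 1))) ^ (n * k)) ^ j *
        (1 - Real.exp (-(1 / ((l : ℝ) + 1))) ^ j))) atTop (𝓝 (n : ℝ)⁻¹) := by
  have hj0 : (0 : ℝ) < j := by exact_mod_cast hj
  have hn0 : (0 : ℝ) < n := by exact_mod_cast hn
  -- `b l` is the `j`-th power of the dilation factor
  set b : ℕ → ℝ := fun l => Real.exp (-(1 / ((l : ℝ) + 1))) ^ j with hb
  have hbe (l : ℕ) : b l = Real.exp (-(j / ((l : ℝ) + 1))) := by
    simp only [hb]
    rw [← Real.exp_nat_mul]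
    congr 1
    ring
  have hb0 (l : ℕ) : 0 < b l := by rw [hbe]; positivity
  have hb1 (l : ℕ) : b l < 1 := by
    rw [hbe, Real.exp_lt_one_iff]
    have : 0 < (j : ℝ) / ((l : ℝ) + 1) := by positivity
    linarith
  have hblim : Tendsto b atTop (𝓝 1) := by
    have h1 : Tendsto (fun l : ℕ => -((j : ℝ) / ((l : ℝ) + 1))) atTop (𝓝 (-0)) :=
      (tendsto_const_nhds.div_atTop
        (tendsto_natCast_atTop_atTop.atTop_add tendsto_const_nhds)).neg
    have h2 := (Real.continuous_exp.tendsto _).comp h1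
    rw [neg_zero, Real.exp_zero] at h2
    exact h2.congr fun l => (hbe l).symm
  have hpow : Tendsto (fun l => (b l ^ n) ^ ((l + 1) ^ 2)) atTop (𝓝 0) := by
    have h1 : Tendsto (fun l : ℕ => -((n : ℝ) * j * ((l : ℝ) + 1))) atTop atBot :=
      tendsto_neg_atTop_atBot.comp ((tendsto_natCast_atTop_atTop.atTop_add
        tendsto_const_nhds).const_mul_atTop (by positivity))
    refine (Real.tendsto_exp_atBot.comp h1).congr fun l => ?_
    simp only [Function.comp]
    rw [hbe, ← Real.exp_nat_mul, ← Real.exp_nat_mul]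
    congr 1
    push_cast
    field_simp
  have hsum : Tendsto (fun l => ∑ i ∈ Finset.range n, b l ^ i) atTop (𝓝 (n : ℝ)) := by
    have := tendsto_finsetSum (Finset.range n) fun i _ => hblim.pow i
    simpa using this
  have hfin := (tendsto_const_nhds (x := (1 : ℝ)).sub hpow).div hsum hn0.ne'
  rw [sub_zero, one_div] at hfin
  refine hfin.congr fun l => ?_
  have hne : b l ^ n ≠ 1 := (pow_lt_one₀ (hb0 l).le (hb1 l) (by omega)).ne
  have hs0 : (∑ i ∈ Finset.range n, b l ^ i) ≠ 0 := by
    refine (Finset.sum_pos (fun i _ => pow_pos (hb0 l) i) ?_).ne'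
    exact Finset.nonempty_range_iff.2 (by omega)
  have h1 (k : ℕ) : (Real.exp (-(1 / ((l : ℝ) + 1))) ^ (n * k)) ^ j = (b l ^ n) ^ k := by
    simp only [hb, ← pow_mul]; congr 1; ring
  rw [Pi.div_apply]
  simp only [h1]
  rw [← Finset.sum_mul, geom_sum_eq hne]
  have h2 : b l ^ n - 1 ≠ 0 := sub_ne_zero.2 hne
  have h3 := geom_sum_mul (b l) n
  change _ = _ * (1 - b l)
  rw [div_eq_iff hs0]
  field_simp
  linear_combination ((b l ^ n) ^ ((l + 1) ^ 2) - 1) * h3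

open PowerSeries Filter Topology in
/-- A self-decomposable law identified by its moments has convolution roots of all orders. The
`n`-th root is the limit, as `a → 1`, of the convolutions of the laws `a ^ (n k) ν_a`, `k ≥ 0`,
where `ν_a` is the cofactor of the dilation by `a`. -/
theorem exists_conv_root {μ : Measure ℝ} [IsProbabilityMeasure μ] {K : PowerSeries ℝ}
    (hdet : IsMomentDeterminate μ) (hK : constantCoeff K = 0)
    (hμK : momentSeries μ id = expOf K) (hsd : IsSelfDecomposable μ) {n : ℕ} (hn : 1 ≤ n) :
    ∃ ρ : Measure ℝ, IsProbabilityMeasure ρ ∧ HasMoments ρ ∧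
      momentSeries ρ id = expOf ((n : ℝ)⁻¹ • K) ∧ convPow ρ n = μ := by
  have ha (l : ℕ) : Real.exp (-(1 / ((l : ℝ) + 1))) < 1 := by
    rw [Real.exp_lt_one_iff]
    have : 0 < 1 / ((l : ℝ) + 1) := by positivity
    linarith
  choose ρ hρp hρm hρs using fun l : ℕ => exists_conv_dilations hdet.1 hK hμK hsd
    (Real.exp_pos _) (ha l) n ((l + 1) ^ 2)
  have hL0 (l : ℕ) : constantCoeff (∑ k ∈ Finset.range ((l + 1) ^ 2),
      rescale (Real.exp (-(1 / ((l : ℝ) + 1))) ^ (n * k))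
        (K - rescale (Real.exp (-(1 / ((l : ℝ) + 1)))) K)) = 0 := by
    rw [map_sum]
    refine Finset.sum_eq_zero fun k _ => constantCoeff_rescale_eq_zero ?_ _
    rw [map_sub, hK, constantCoeff_rescale_eq_zero hK, sub_zero]
  have hnK : constantCoeff ((n : ℝ)⁻¹ • K) = 0 := by simp [hK]
  obtain ⟨σ, -, -, -, hσm, hσs⟩ := exists_subseq_tendsto_of_tendsto_momentSeries
    (μs := fun l => ⟨ρ l, hρp l⟩) (F := expOf ((n : ℝ)⁻¹ • K)) hρm (fun j => by
      simp only [ProbabilityMeasure.coe_mk, hρs]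
      refine tendsto_coeff_expOf_of_tendsto hnK hL0 (fun k => ?_) j
      rcases Nat.eq_zero_or_pos k with rfl | hk
      · simp only [coeff_zero_eq_constantCoeff_apply, hL0, hnK]
        exact tendsto_const_nhds
      · have h1 := (tendsto_geometric_quotient hn hk).mul_const (coeff k K)
        rw [map_smul, smul_eq_mul]
        refine h1.congr fun l => ?_
        simp only [map_sum, coeff_rescale, map_sub, Finset.sum_mul]
        refine Finset.sum_congr rfl fun i _ => by ring)
  refine ⟨σ, inferInstance, hσm, hσs, ?_⟩
  refine hdet.eq_of_momentSeries_eq (hσm.convPow n) ?_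
  rw [momentSeries_convPow hσm, hσs, expOf_pow hnK, hμK, smul_smul, mul_inv_cancel₀ (by positivity),
    one_smul]

theorem isInfDivisible_of_exists_root {μ : Measure ℝ}
    (h : ∀ n : ℕ, 1 ≤ n → ∃ ρ : Measure ℝ, IsProbabilityMeasure ρ ∧ convPow ρ n = μ) :
    IsInfDivisible μ := by
  intro n hn
  obtain ⟨ρ, hρ, hρn⟩ := h n hn
  exact ⟨ρ, hρ, by rw [map_sum_pi_eq_convPow, hρn]⟩

/-! ### The Kolmogorov kernel -/

/-- The entire function `(exp z - 1 - z) / z ^ 2`. -/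
noncomputable def expQuotC (z : ℂ) : ℂ := if z = 0 then 1 / 2 else (Complex.exp z - 1 - z) / z ^ 2

/-- The function `(exp w - 1 - w) / w ^ 2` of a real variable. -/
noncomputable def expQuot (w : ℝ) : ℝ := if w = 0 then 1 / 2 else (Real.exp w - 1 - w) / w ^ 2

theorem sq_mul_expQuotC (z : ℂ) : z ^ 2 * expQuotC z = Complex.exp z - 1 - z := by
  rcases eq_or_ne z 0 with rfl | h
  · simp
  · rw [expQuotC, if_neg h]; field_simp

theorem sq_mul_expQuot (w : ℝ) : w ^ 2 * expQuot w = Real.exp w - 1 - w := by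
  rcases eq_or_ne w 0 with rfl | h
  · simp
  · rw [expQuot, if_neg h]; field_simp

theorem expQuotC_ofReal (w : ℝ) : expQuotC w = (expQuot w : ℂ) := by
  rcases eq_or_ne w 0 with rfl | h
  · simp [expQuot, expQuotC]
  · rw [expQuot, expQuotC, if_neg h, if_neg (by exact_mod_cast h)]
    push_cast
    rfl

theorem kolmogorovKernelC_eq (z : ℂ) (x : ℝ) :
    kolmogorovKernelC z x = z ^ 2 * expQuotC (z * x) := by
  rcases eq_or_ne x 0 with rfl | hx
  · simp [kolmogorovKernelC, expQuotC]; ring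
  · rcases eq_or_ne z 0 with rfl | hz
    · simp [kolmogorovKernelC]
    · have hx' : (x : ℂ) ≠ 0 := by exact_mod_cast hx
      rw [kolmogorovKernelC, if_neg hx, expQuotC, if_neg (mul_ne_zero hz hx')]
      field_simp

theorem kolmogorovKernel_eq (y x : ℝ) : kolmogorovKernel y x = y ^ 2 * expQuot (y * x) := by
  rcases eq_or_ne x 0 with rfl | hx
  · simp [kolmogorovKernel, expQuot]; ring
  · rcases eq_or_ne y 0 with rfl | hy
    · simp [kolmogorovKernel]
    · rw [kolmogorovKernel, if_neg hx, expQuot, if_neg (mul_ne_zero hy hx)]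
      field_simp

theorem sq_mul_kolmogorovKernel (y x : ℝ) :
    x ^ 2 * kolmogorovKernel y x = Real.exp (y * x) - 1 - y * x := by
  rw [kolmogorovKernel_eq, ← sq_mul_expQuot]; ring

open Filter Topology in
theorem continuous_expQuotC : Continuous expQuotC := by
  rw [continuous_iff_continuousAt]
  intro z
  rcases eq_or_ne z 0 with rfl | hz
  · rw [ContinuousAt, tendsto_iff_norm_sub_tendsto_zero]
    have h0 : expQuotC 0 = 1 / 2 := by simp [expQuotC]
    refine squeeze_zero' (g := fun z : ℂ => ‖z‖) (.of_forall fun _ => norm_nonneg _) ?_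
      (tendsto_norm_zero)
    filter_upwards [Metric.ball_mem_nhds (0 : ℂ) one_pos] with z hz1
    have hz1' : ‖z‖ ≤ 1 := by simpa using (mem_ball_zero_iff.1 hz1).le
    rcases eq_or_ne z 0 with rfl | hz
    · simp
    have hb := Complex.exp_bound (x := z) hz1' (n := 3) (by norm_num)
    have he : expQuotC z - expQuotC 0 =
        (Complex.exp z - ∑ m ∈ Finset.range 3, z ^ m / (m.factorial : ℂ)) / z ^ 2 := by
      rw [h0, expQuotC, if_neg hz]
      simp [Finset.sum_range_succ, Nat.factorial]
      field_simp
      ring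
    rw [he, norm_div, norm_pow, div_le_iff₀ (by positivity)]
    refine hb.trans ?_
    have : ‖z‖ ^ 3 = ‖z‖ * ‖z‖ ^ 2 := by ring
    rw [this]
    refine mul_le_of_le_one_right (by positivity) ?_
    norm_num [Nat.factorial]
  · have h1 : ContinuousAt (fun z : ℂ => (Complex.exp z - 1 - z) / z ^ 2) z :=
      ContinuousAt.div (by fun_prop) (by fun_prop) (pow_ne_zero 2 hz)
    refine h1.congr ?_
    filter_upwards [isOpen_ne.mem_nhds hz] with w hw
    rw [expQuotC, if_neg hw]

theorem continuous_expQuot : Continuous expQuot := by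
  have h : Continuous fun w : ℝ => (expQuotC w).re :=
    Complex.continuous_re.comp (continuous_expQuotC.comp Complex.continuous_ofReal)
  simpa only [expQuotC_ofReal, Complex.ofReal_re] using h

theorem continuous_kolmogorovKernel (y : ℝ) : Continuous (kolmogorovKernel y) := by
  have : kolmogorovKernel y = fun x => y ^ 2 * expQuot (y * x) := funext (kolmogorovKernel_eq y)
  rw [this]
  exact continuous_const.mul (continuous_expQuot.comp (by fun_prop))

theorem continuous_kolmogorovKernelC (z : ℂ) : Continuous (kolmogorovKernelC z) := by
  have : kolmogorovKernelC z = fun x : ℝ => z ^ 2 * expQuotC (z * x) :=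
    funext (kolmogorovKernelC_eq z)
  rw [this]
  exact continuous_const.mul (continuous_expQuotC.comp (by fun_prop))

theorem expQuot_nonneg (w : ℝ) : 0 ≤ expQuot w := by
  rcases eq_or_ne w 0 with rfl | h
  · simp [expQuot]
  · rw [expQuot, if_neg h]
    have := Real.add_one_le_exp w
    exact div_nonneg (by linarith) (sq_nonneg w)

theorem kolmogorovKernel_nonneg (y x : ℝ) : 0 ≤ kolmogorovKernel y x := by
  rw [kolmogorovKernel_eq]
  exact mul_nonneg (sq_nonneg y) (expQuot_nonneg _)

theorem norm_expQuotC_mul_I_le (θ : ℝ) : ‖expQuotC (θ * Complex.I)‖ ≤ 2 := by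
  rcases eq_or_ne θ 0 with rfl | h
  · simp [expQuotC]; norm_num
  · have hne : (θ : ℂ) * Complex.I ≠ 0 := by simp [h]
    have hn : ‖(θ : ℂ) * Complex.I‖ = |θ| := by simp
    rw [expQuotC, if_neg hne, norm_div, norm_pow, hn, div_le_iff₀ (by positivity)]
    rcases le_total |θ| 1 with h1 | h1
    · have := Complex.norm_exp_sub_one_sub_id_le (x := (θ : ℂ) * Complex.I) (by rwa [hn])
      rw [hn] at this
      nlinarith [sq_nonneg |θ|]
    · calc ‖Complex.exp (θ * Complex.I) - 1 - θ * Complex.I‖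
          ≤ ‖Complex.exp (θ * Complex.I) - 1‖ + ‖(θ : ℂ) * Complex.I‖ := norm_sub_le _ _
        _ ≤ |θ| + |θ| := by
            rw [hn, mul_comm (θ : ℂ)]
            gcongr
            exact Real.norm_exp_I_mul_ofReal_sub_one_le
        _ ≤ 2 * |θ| ^ 2 := by nlinarith

theorem norm_kolmogorovKernelC_mul_I_le (u x : ℝ) :
    ‖kolmogorovKernelC (u * Complex.I) x‖ ≤ 2 * u ^ 2 := by
  rw [kolmogorovKernelC_eq, norm_mul, norm_pow]
  have h : (u : ℂ) * Complex.I * x = ((u * x : ℝ) : ℂ) * Complex.I := by push_cast; ring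
  rw [h]
  have h1 : ‖(u : ℂ) * Complex.I‖ ^ 2 = u ^ 2 := by simp
  rw [h1]
  nlinarith [norm_expQuotC_mul_I_le (u * x), sq_nonneg u]

/-! ### Laws with a prescribed Kolmogorov measure -/

/-- The law of a point drawn by first choosing `x` according to `χ`, then taking `f x` with
probability `p x` and `g x` with probability `1 - p x`. -/
noncomputable def twoPointMix (χ : Measure ℝ) (p f g : ℝ → ℝ) : Measure ℝ :=
  (χ.withDensity fun x => ENNReal.ofReal (p x)).map f +
    (χ.withDensity fun x => ENNReal.ofReal (1 - p x)).map g

theorem integral_withDensity_map {E : Type*} [NormedAddCommGroup E] [NormedSpace ℝ E]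
    {χ : Measure ℝ} {p f : ℝ → ℝ} (hp : Measurable p) (hp0 : ∀ x, 0 ≤ p x)
    (hp1 : ∀ x, p x ≤ 1) (hf : Measurable f) {F : ℝ → E} (hF : StronglyMeasurable F)
    (hFf : Integrable (fun x => F (f x)) χ) :
    Integrable F ((χ.withDensity fun x => ENNReal.ofReal (p x)).map f) ∧
    Integrable (fun x => p x • F (f x)) χ ∧
    ∫ x, F x ∂((χ.withDensity fun x => ENNReal.ofReal (p x)).map f) = ∫ x, p x • F (f x) ∂χ := by
  have h1 : Integrable (fun x => p x • F (f x)) χ := by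
    refine hFf.norm.mono' (hp.aestronglyMeasurable.smul hFf.aestronglyMeasurable)
      (.of_forall fun x => ?_)
    rw [norm_smul, Real.norm_of_nonneg (hp0 x)]
    exact mul_le_of_le_one_left (norm_nonneg _) (hp1 x)
  refine ⟨?_, h1, ?_⟩
  · rw [integrable_map_measure hF.aestronglyMeasurable hf.aemeasurable,
      integrable_withDensity_iff_integrable_smul₀' (by fun_prop) (by simp)]
    simpa [hp0] using h1
  · rw [integral_map hf.aemeasurable hF.aestronglyMeasurable,
      integral_withDensity_eq_integral_toReal_smul (by fun_prop) (by simp)]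
    simp [hp0]

section TwoPoint

variable {χ : Measure ℝ} {p f g : ℝ → ℝ}

theorem integral_twoPointMix {E : Type*} [NormedAddCommGroup E] [NormedSpace ℝ E]
    (hp : Measurable p) (hp0 : ∀ x, 0 ≤ p x) (hp1 : ∀ x, p x ≤ 1) (hf : Measurable f)
    (hg : Measurable g) {F : ℝ → E} (hF : StronglyMeasurable F)
    (hFf : Integrable (fun x => F (f x)) χ) (hFg : Integrable (fun x => F (g x)) χ) :
    Integrable F (twoPointMix χ p f g) ∧
    ∫ x, F x ∂(twoPointMix χ p f g) = ∫ x, (p x • F (f x) + (1 - p x) • F (g x)) ∂χ := by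
  obtain ⟨h1, h2, h3⟩ := integral_withDensity_map hp hp0 hp1 hf hF hFf
  obtain ⟨h4, h5, h6⟩ := integral_withDensity_map (p := fun x => 1 - p x) (by fun_prop)
    (fun x => sub_nonneg.2 (hp1 x)) (fun x => by linarith [hp0 x]) hg hF hFg
  refine ⟨h1.add_measure h4, ?_⟩
  rw [twoPointMix, integral_add_measure h1 h4, h3, h6, integral_add h2 h5]

theorem isProbabilityMeasure_twoPointMix [IsProbabilityMeasure χ]
    (hp : Measurable p) (hp0 : ∀ x, 0 ≤ p x) (hp1 : ∀ x, p x ≤ 1) (hf : Measurable f)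
    (hg : Measurable g) : IsProbabilityMeasure (twoPointMix χ p f g) := by
  constructor
  rw [twoPointMix, Measure.add_apply, Measure.map_apply hf .univ, Measure.map_apply hg .univ,
    Set.preimage_univ, Set.preimage_univ, withDensity_apply _ .univ, withDensity_apply _ .univ,
    Measure.restrict_univ, ← lintegral_add_left (by fun_prop)]
  have (x : ℝ) : ENNReal.ofReal (p x) + ENNReal.ofReal (1 - p x) = 1 := by
    rw [← ENNReal.ofReal_add (hp0 x) (sub_nonneg.2 (hp1 x))]
    simp
  simp [this]

end TwoPoint

/-- The point `x`, moved to `h` if it lies within distance `h` of the origin. -/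
noncomputable def awayFromZero (h x : ℝ) : ℝ := if h ≤ |x| then x else h

theorem measurable_awayFromZero (h : ℝ) : Measurable (awayFromZero h) := by
  refine Measurable.ite ?_ measurable_id measurable_const
  exact measurableSet_le measurable_const (by fun_prop)

theorem le_abs_awayFromZero {h : ℝ} (x : ℝ) : h ≤ |awayFromZero h x| := by
  rw [awayFromZero]
  split_ifs with hx
  · exact hx
  · exact le_abs_self h

theorem abs_awayFromZero_sub_le {h : ℝ} (h0 : 0 ≤ h) (x : ℝ) : |awayFromZero h x - x| ≤ 2 * h := by
  rw [awayFromZero]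
  split_ifs with hx
  · simpa using h0
  · have := abs_lt.1 (not_le.1 hx)
    rw [abs_le]; constructor <;> linarith

theorem abs_awayFromZero_le {h : ℝ} (h0 : 0 ≤ h) (x : ℝ) : |awayFromZero h x| ≤ |x| + h := by
  rw [awayFromZero]
  split_ifs with hx
  · linarith
  · rw [abs_of_nonneg h0]; linarith [abs_nonneg x]

/-- The cut-off `n ^ (-1/4)` at stage `n` of the approximation. -/
noncomputable def cutoff (n : ℕ) : ℝ := 1 / √(√n)

theorem cutoff_nonneg (n : ℕ) : 0 ≤ cutoff n := by unfold cutoff; positivity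

theorem cutoff_pos {n : ℕ} (hn : 0 < n) : 0 < cutoff n := by
  unfold cutoff
  have : (0 : ℝ) < n := by exact_mod_cast hn
  positivity

theorem cutoff_le_one {n : ℕ} (hn : 0 < n) : cutoff n ≤ 1 := by
  have : (1 : ℝ) ≤ n := by exact_mod_cast hn
  rw [cutoff, div_le_one (by positivity), Real.one_le_sqrt, Real.one_le_sqrt]
  exact this

theorem mul_cutoff_sq (n : ℕ) : n * cutoff n ^ 2 = √n := by
  rcases Nat.eq_zero_or_pos n with rfl | hn
  · simp
  have : (0 : ℝ) < n := by exact_mod_cast hn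
  have h2 : 0 < √(n : ℝ) := by positivity
  rw [cutoff, div_pow, Real.sq_sqrt (by positivity), one_pow]
  have := Real.mul_self_sqrt this.le
  field_simp
  linarith

open Filter Topology in
theorem tendsto_cutoff : Tendsto cutoff atTop (𝓝 0) := by
  have h : Tendsto (fun n : ℕ => √(√(n : ℝ))) atTop atTop :=
    Real.tendsto_sqrt_atTop.comp (Real.tendsto_sqrt_atTop.comp tendsto_natCast_atTop_atTop)
  exact tendsto_const_nhds.div_atTop h

/-- The size of a jump at stage `n`. -/
noncomputable def jump (n : ℕ) (x : ℝ) : ℝ := awayFromZero (cutoff n) x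

/-- The probability `c / (n x ^ 2)` of a jump of size `x` at stage `n`. -/
noncomputable def jumpProb (c : ℝ) (n : ℕ) (x : ℝ) : ℝ := c / (n * jump n x ^ 2)

/-- One of the `n` independent steps whose sum approximates the infinitely divisible law with
Kolmogorov measure `c χ`: a centred jump of size `x` with probability `c / (n x ^ 2)`, where `x`
is drawn from `χ`. -/
noncomputable def stepLaw (χ : Measure ℝ) (c : ℝ) (n : ℕ) : Measure ℝ :=
  twoPointMix χ (jumpProb c n) (fun x => jump n x * (1 - jumpProb c n x))
    (fun x => -(jumpProb c n x * jump n x))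

section Step

variable {c : ℝ} {n : ℕ}

theorem measurable_jump (n : ℕ) : Measurable (jump n) := measurable_awayFromZero _

theorem measurable_jumpProb (c : ℝ) (n : ℕ) : Measurable (jumpProb c n) := by
  unfold jumpProb
  have := measurable_jump n
  fun_prop

theorem sq_jump_pos (hn : 0 < n) (x : ℝ) : 0 < jump n x ^ 2 := by
  have h1 := le_abs_awayFromZero (h := cutoff n) x
  rw [jump, ← sq_abs]
  exact pow_pos ((cutoff_pos hn).trans_le h1) 2

theorem jump_ne_zero (hn : 0 < n) (x : ℝ) : jump n x ≠ 0 := fun h => by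
  have := sq_jump_pos hn x
  simp [h] at this

theorem jumpProb_nonneg (hc : 0 ≤ c) (x : ℝ) : 0 ≤ jumpProb c n x := by
  unfold jumpProb; positivity

theorem jumpProb_le (hc : 0 ≤ c) (hn : 0 < n) (x : ℝ) : jumpProb c n x ≤ c / √n := by
  have hn' : (0 : ℝ) < n := by exact_mod_cast hn
  unfold jumpProb
  refine div_le_div_of_nonneg_left hc (by positivity) ?_
  rw [← mul_cutoff_sq]
  refine mul_le_mul_of_nonneg_left ?_ hn'.le
  rw [jump, ← sq_abs (awayFromZero _ _)]
  exact pow_le_pow_left₀ (cutoff_nonneg n) (le_abs_awayFromZero x) 2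

theorem jumpProb_le_one (hc : 0 ≤ c) (hn : 0 < n) (hcn : c ≤ √n) (x : ℝ) :
    jumpProb c n x ≤ 1 :=
  (jumpProb_le hc hn x).trans (div_le_one_of_le₀ hcn (by positivity))

theorem mul_jumpProb (hn : 0 < n) (x : ℝ) : n * jumpProb c n x * jump n x ^ 2 = c := by
  have hn' : (0 : ℝ) < n := by exact_mod_cast hn
  have := jump_ne_zero hn x
  unfold jumpProb
  field_simp

theorem abs_jump_le (hn : 0 < n) (x : ℝ) : |jump n x| ≤ |x| + 1 :=
  (abs_awayFromZero_le (cutoff_nonneg n) x).trans (by linarith [cutoff_le_one hn])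

open Filter Topology in
theorem tendsto_jump (x : ℝ) : Tendsto (fun n => jump n x) atTop (𝓝 x) := by
  rw [tendsto_iff_norm_sub_tendsto_zero]
  refine squeeze_zero (fun _ => norm_nonneg _)
    (fun n => abs_awayFromZero_sub_le (cutoff_nonneg n) x) ?_
  simpa using tendsto_cutoff.const_mul 2

open Filter Topology in
theorem tendsto_jumpProb (hc : 0 ≤ c) (x : ℝ) :
    Tendsto (fun n => jumpProb c n x) atTop (𝓝 0) := by
  refine squeeze_zero' (.of_forall fun n => jumpProb_nonneg hc x) ?_
    (tendsto_const_nhds.div_atTop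
      (Real.tendsto_sqrt_atTop.comp tendsto_natCast_atTop_atTop) :
      Tendsto (fun n : ℕ => c / √(n : ℝ)) atTop (𝓝 0))
  filter_upwards [eventually_gt_atTop 0] with n hn
  exact jumpProb_le hc hn x

end Step

section Step

variable {χ : Measure ℝ} {c : ℝ} {n : ℕ}

theorem HasMoments.integrable_abs_add_one_pow (hχ : HasMoments χ) (j : ℕ) :
    Integrable (fun x : ℝ => (|x| + 1) ^ j) χ := by
  simp only [add_pow, one_pow, mul_one]
  refine integrable_finsetSum _ fun k _ => Integrable.mul_const ?_ _
  simpa using (hχ k).norm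

theorem integrable_jump_mul_pow (hχ : HasMoments χ) (hn : 0 < n) {b : ℝ → ℝ} (hb : Measurable b)
    (hb1 : ∀ x, |b x| ≤ 1) (j : ℕ) : Integrable (fun x => (jump n x * b x) ^ j) χ := by
  have := measurable_jump n
  refine (hχ.integrable_abs_add_one_pow j).mono' (by fun_prop) (.of_forall fun x => ?_)
  rw [norm_pow, Real.norm_eq_abs, abs_mul]
  refine pow_le_pow_left₀ (by positivity) ?_ j
  calc |jump n x| * |b x| ≤ |jump n x| * 1 := by gcongr; exact hb1 x
    _ ≤ |x| + 1 := by rw [mul_one]; exact abs_jump_le hn x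

theorem isProbabilityMeasure_stepLaw [IsProbabilityMeasure χ] (hc : 0 ≤ c) (hn : 0 < n)
    (hcn : c ≤ √n) : IsProbabilityMeasure (stepLaw χ c n) := by
  have h1 := measurable_jump n
  have h2 := measurable_jumpProb c n
  exact isProbabilityMeasure_twoPointMix h2 (jumpProb_nonneg hc) (jumpProb_le_one hc hn hcn)
    (by fun_prop) (by fun_prop)

theorem integral_pow_stepLaw (hχ : HasMoments χ) (hc : 0 ≤ c) (hn : 0 < n) (hcn : c ≤ √n)
    (j : ℕ) : Integrable (fun x => x ^ j) (stepLaw χ c n) ∧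
      ∫ x, x ^ j ∂(stepLaw χ c n) = ∫ x, (jumpProb c n x * (jump n x * (1 - jumpProb c n x)) ^ j +
        (1 - jumpProb c n x) * (-(jumpProb c n x * jump n x)) ^ j) ∂χ := by
  have h1 := measurable_jump n
  have h2 := measurable_jumpProb c n
  have h3 := jumpProb_le_one hc hn hcn
  have h4 := jumpProb_nonneg (c := c) (n := n) hc
  refine integral_twoPointMix h2 h4 h3 (by fun_prop) (by fun_prop)
    (F := fun x : ℝ => x ^ j) (by fun_prop) ?_ ?_
  · exact integrable_jump_mul_pow hχ hn (by fun_prop)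
      (fun x => by rw [abs_le]; constructor <;> linarith [h3 x, h4 x]) j
  · have := integrable_jump_mul_pow hχ hn (b := fun x => -jumpProb c n x) (by fun_prop)
      (fun x => by rw [abs_le]; constructor <;> linarith [h3 x, h4 x]) j
    refine this.congr (.of_forall fun x => ?_)
    simp only
    congr 1
    ring

theorem hasMoments_stepLaw (hχ : HasMoments χ) (hc : 0 ≤ c) (hn : 0 < n) (hcn : c ≤ √n) :
    HasMoments (stepLaw χ c n) := fun j => (integral_pow_stepLaw hχ hc hn hcn j).1

theorem integral_stepLaw (hχ : HasMoments χ) (hc : 0 ≤ c) (hn : 0 < n) (hcn : c ≤ √n) :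
    ∫ x, x ^ 1 ∂(stepLaw χ c n) = 0 := by
  rw [(integral_pow_stepLaw hχ hc hn hcn 1).2, ← integral_zero ℝ ℝ (μ := χ)]
  refine integral_congr_ae (.of_forall fun x => ?_)
  simp only
  ring

theorem mul_integral_pow_stepLaw (hχ : HasMoments χ) (hc : 0 ≤ c) (hn : 0 < n) (hcn : c ≤ √n)
    (j : ℕ) : n * ∫ x, x ^ (j + 2) ∂(stepLaw χ c n) =
      ∫ x, c * jump n x ^ j * ((1 - jumpProb c n x) ^ (j + 2) +
        (-1) ^ j * (1 - jumpProb c n x) * jumpProb c n x ^ (j + 1)) ∂χ := by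
  rw [(integral_pow_stepLaw hχ hc hn hcn (j + 2)).2, ← integral_const_mul]
  refine integral_congr_ae (.of_forall fun x => ?_)
  have h := mul_jumpProb (c := c) hn x
  have h2 : (-(jumpProb c n x * jump n x)) ^ (j + 2) =
      (-1) ^ j * (jumpProb c n x * jump n x) ^ (j + 2) := by
    rw [neg_eq_neg_one_mul, mul_pow, pow_add]; norm_num
  simp only [h2, mul_pow]
  linear_combination (jump n x ^ j * ((1 - jumpProb c n x) ^ (j + 2) +
    (-1) ^ j * (1 - jumpProb c n x) * jumpProb c n x ^ (j + 1))) * h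

end Step

open Filter Topology in
theorem tendsto_moment_stepLaw {χ : Measure ℝ} {c : ℝ} (hχ : HasMoments χ)
    (hc : 0 ≤ c) (j : ℕ) :
    Tendsto (fun n : ℕ => n * ∫ x, x ^ (j + 2) ∂(stepLaw χ c n)) atTop
      (𝓝 (c * ∫ x, x ^ j ∂χ)) := by
  have hev : ∀ᶠ n : ℕ in atTop, 0 < n ∧ c ≤ √(n : ℝ) :=
    (eventually_gt_atTop 0).and
      ((Real.tendsto_sqrt_atTop.comp tendsto_natCast_atTop_atTop).eventually_ge_atTop c)
  rw [← integral_const_mul]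
  have hmain : Tendsto (fun n : ℕ => ∫ x, c * jump n x ^ j * ((1 - jumpProb c n x) ^ (j + 2) +
        (-1) ^ j * (1 - jumpProb c n x) * jumpProb c n x ^ (j + 1)) ∂χ) atTop
      (𝓝 (∫ x, c * x ^ j ∂χ)) := by
    refine tendsto_integral_filter_of_dominated_convergence
      (fun x => c * (|x| + 1) ^ j * 2) (.of_forall fun n => ?_) ?_ ?_ ?_
    · have h1 := measurable_jump n
      have h2 := measurable_jumpProb c n
      fun_prop
    · filter_upwards [hev] with n hn
      refine .of_forall fun x => ?_
      have h3 := jumpProb_le_one hc hn.1 hn.2 x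
      have h4 := jumpProb_nonneg (c := c) (n := n) hc x
      rw [norm_mul, norm_mul, norm_pow, Real.norm_of_nonneg hc, Real.norm_eq_abs]
      gcongr
      · exact abs_jump_le hn.1 x
      · have h5 : ‖(1 - jumpProb c n x) ^ (j + 2)‖ ≤ 1 := by
          rw [norm_pow]
          refine pow_le_one₀ (norm_nonneg _) ?_
          rw [Real.norm_eq_abs, abs_le]
          constructor <;> linarith
        have h6 : ‖(-1) ^ j * (1 - jumpProb c n x) * jumpProb c n x ^ (j + 1)‖ ≤ 1 := by
          rw [norm_mul, norm_mul, norm_pow, norm_pow, norm_neg, norm_one, one_pow, one_mul]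
          refine mul_le_one₀ ?_ (by positivity) (pow_le_one₀ (norm_nonneg _) ?_) <;>
          · rw [Real.norm_eq_abs, abs_le]; constructor <;> linarith
        exact (norm_add_le _ _).trans (by linarith)
    · exact ((hχ.integrable_abs_add_one_pow j).const_mul c).mul_const 2
    · refine .of_forall fun x => ?_
      have h1 := tendsto_jump x
      have h2 := tendsto_jumpProb hc x
      have h3 := ((h1.pow j).const_mul c).mul (((tendsto_const_nhds (x := (1 : ℝ)).sub h2).pow
        (j + 2)).add (((tendsto_const_nhds (x := (1 : ℝ)).sub h2).const_mul ((-1) ^ j)).mul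
          (h2.pow (j + 1))))
      simpa using h3
  refine hmain.congr' ?_
  filter_upwards [hev] with n hn
  exact (mul_integral_pow_stepLaw hχ hc hn.1 hn.2 j).symm

/-- The characteristic exponent of a step, written with the Kolmogorov kernel. -/
theorem mul_charFun_stepLaw_sub_one {χ : Measure ℝ} [IsProbabilityMeasure χ] {c : ℝ} {n : ℕ}
    (hc : 0 ≤ c) (hn : 0 < n) (hcn : c ≤ √n) (u : ℝ) :
    n * (charFun (stepLaw χ c n) u - 1) = ∫ x, (c : ℂ) * (u * Complex.I) ^ 2 *
      ((1 - jumpProb c n x) ^ 2 *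
          expQuotC (((u * (jump n x * (1 - jumpProb c n x)) : ℝ) : ℂ) * Complex.I) +
        (1 - jumpProb c n x) * jumpProb c n x *
          expQuotC (((u * -(jumpProb c n x * jump n x) : ℝ) : ℂ) * Complex.I)) ∂χ := by
  have h1 := measurable_jump n
  have h2 := measurable_jumpProb c n
  have h3 := jumpProb_le_one hc hn hcn
  have h4 := jumpProb_nonneg (c := c) (n := n) hc
  have hb (f : ℝ → ℝ) (hf : Measurable f) :
      Integrable (fun x => Complex.exp (u * (f x : ℝ) * Complex.I)) χ := by
    refine Integrable.of_bound (by fun_prop) 1 (.of_forall fun x => ?_)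
    rw [← Complex.ofReal_mul, Complex.norm_exp_ofReal_mul_I]
  have h5 := (integral_twoPointMix h2 h4 h3
    (f := fun x => jump n x * (1 - jumpProb c n x)) (g := fun x => -(jumpProb c n x * jump n x))
    (by fun_prop) (by fun_prop) (F := fun x : ℝ => Complex.exp (u * x * Complex.I))
    (by fun_prop) (hb _ (by fun_prop)) (hb _ (by fun_prop))).2
  have hi1 : Integrable (fun x => jumpProb c n x • Complex.exp
      (u * ((jump n x * (1 - jumpProb c n x) : ℝ) : ℂ) * Complex.I) +
      (1 - jumpProb c n x) • Complex.exp
      (u * ((-(jumpProb c n x * jump n x) : ℝ) : ℂ) * Complex.I)) χ := by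
    refine Integrable.of_bound (by fun_prop) (1 + 1) (.of_forall fun x => ?_)
    refine (norm_add_le _ _).trans ?_
    rw [norm_smul, norm_smul, ← Complex.ofReal_mul, ← Complex.ofReal_mul,
      Complex.norm_exp_ofReal_mul_I, Complex.norm_exp_ofReal_mul_I, mul_one, mul_one,
      Real.norm_of_nonneg (h4 x), Real.norm_of_nonneg (sub_nonneg.2 (h3 x))]
    linarith [h3 x, h4 x]
  rw [charFun_apply_real, stepLaw, h5]
  have h6 := integral_sub hi1 (integrable_const (1 : ℂ))
  rw [integral_const, probReal_univ, one_smul] at h6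
  rw [← h6, ← integral_const_mul]
  refine integral_congr_ae (.of_forall fun x => ?_)
  have h := mul_jumpProb (c := c) hn x
  have hC : (n : ℂ) * jumpProb c n x * jump n x ^ 2 = c := by exact_mod_cast h
  simp only [Complex.real_smul]
  generalize jumpProb c n x = p at hC ⊢
  generalize jump n x = J at hC ⊢
  have e1 := sq_mul_expQuotC (((u * (J * (1 - p)) : ℝ) : ℂ) * Complex.I)
  have e2 := sq_mul_expQuotC (((u * -(p * J) : ℝ) : ℂ) * Complex.I)
  push_cast at e1 e2 ⊢
  have e1' : Complex.exp (u * (J * (1 - p)) * Complex.I) = 1 + u * (J * (1 - p)) * Complex.I +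
    (u * (J * (1 - p)) * Complex.I) ^ 2 * expQuotC (u * (J * (1 - p)) * Complex.I) := by
    rw [e1]; ring
  have e2' : Complex.exp (u * -(p * J) * Complex.I) = 1 + u * -(p * J) * Complex.I +
    (u * -(p * J) * Complex.I) ^ 2 * expQuotC (u * -(p * J) * Complex.I) := by
    rw [e2]; ring
  rw [e1', e2']
  linear_combination ((u * Complex.I) ^ 2 *
    ((1 - p) ^ 2 * expQuotC (u * (J * (1 - p)) * Complex.I) +
      (1 - p) * p * expQuotC (u * -(p * J) * Complex.I)) : ℂ) * hC

open Filter Topology in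
theorem tendsto_charFun_stepLaw {χ : Measure ℝ} [IsProbabilityMeasure χ] {c : ℝ} (hc : 0 ≤ c)
    (u : ℝ) :
    Tendsto (fun n : ℕ => (n : ℂ) * (charFun (stepLaw χ c n) u - 1)) atTop
      (𝓝 (c * ∫ x, kolmogorovKernelC (u * Complex.I) x ∂χ)) := by
  have hev : ∀ᶠ n : ℕ in atTop, 0 < n ∧ c ≤ √(n : ℝ) :=
    (eventually_gt_atTop 0).and
      ((Real.tendsto_sqrt_atTop.comp tendsto_natCast_atTop_atTop).eventually_ge_atTop c)
  rw [← integral_const_mul]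
  have hq := continuous_expQuotC
  refine Tendsto.congr' (f₁ := fun n : ℕ => ∫ x, (c : ℂ) * (u * Complex.I) ^ 2 *
      ((1 - jumpProb c n x) ^ 2 *
          expQuotC (((u * (jump n x * (1 - jumpProb c n x)) : ℝ) : ℂ) * Complex.I) +
        (1 - jumpProb c n x) * jumpProb c n x *
          expQuotC (((u * -(jumpProb c n x * jump n x) : ℝ) : ℂ) * Complex.I)) ∂χ) ?_ ?_
  · filter_upwards [hev] with n hn
    exact (mul_charFun_stepLaw_sub_one hc hn.1 hn.2 u).symm
  refine tendsto_integral_filter_of_dominated_convergence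
      (fun x => c * u ^ 2 * 4) (.of_forall fun n => ?_) ?_ (integrable_const _) ?_
  · have h1 := measurable_jump n
    have h2 := measurable_jumpProb c n
    have hq' := hq.measurable
    fun_prop
  · filter_upwards [hev] with n hn
    refine .of_forall fun x => ?_
    have h3 := jumpProb_le_one hc hn.1 hn.2 x
    have h4 := jumpProb_nonneg (c := c) (n := n) hc x
    have h5 : ‖(c : ℂ) * (u * Complex.I) ^ 2‖ = c * u ^ 2 := by
      rw [norm_mul, norm_pow, norm_mul, Complex.norm_I, mul_one, Complex.norm_real,
        Complex.norm_real, Real.norm_of_nonneg hc, Real.norm_eq_abs, sq_abs]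
    have hp1 : ‖((1 - jumpProb c n x : ℝ) : ℂ)‖ ≤ 1 := by
      rw [Complex.norm_real, Real.norm_of_nonneg (by linarith)]; linarith
    have hp2 : ‖((jumpProb c n x : ℝ) : ℂ)‖ ≤ 1 := by
      rw [Complex.norm_real, Real.norm_of_nonneg h4]; exact h3
    rw [norm_mul, h5]
    refine mul_le_mul_of_nonneg_left ?_ (by positivity)
    refine (norm_add_le _ _).trans ?_
    have h6 := norm_expQuotC_mul_I_le (u * (jump n x * (1 - jumpProb c n x)))
    have h7 := norm_expQuotC_mul_I_le (u * -(jumpProb c n x * jump n x))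
    push_cast at hp1
    rw [norm_mul, norm_mul, norm_mul, norm_pow]
    have h8 : ‖(1 : ℂ) - jumpProb c n x‖ ^ 2 ≤ 1 := pow_le_one₀ (norm_nonneg _) hp1
    have h9 : ‖(1 : ℂ) - jumpProb c n x‖ * ‖(jumpProb c n x : ℂ)‖ ≤ 1 :=
      mul_le_one₀ hp1 (norm_nonneg _) hp2
    have h10 := mul_le_mul h8 h6 (norm_nonneg _) zero_le_one
    have h11 := mul_le_mul h9 h7 (norm_nonneg _) zero_le_one
    linarith
  · refine .of_forall fun x => ?_
    have h1 := tendsto_jump x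
    have h2 := tendsto_jumpProb hc x
    have h2C : Tendsto (fun n => (jumpProb c n x : ℂ)) atTop (𝓝 ((0 : ℝ) : ℂ)) :=
      (Complex.continuous_ofReal.tendsto _).comp h2
    have hs := tendsto_const_nhds (x := (1 : ℝ)) (f := (atTop : Filter ℕ)) |>.sub h2
    have hsC := tendsto_const_nhds (x := (1 : ℂ)) (f := (atTop : Filter ℕ)) |>.sub h2C
    have hg : Continuous fun r : ℝ => expQuotC ((r : ℂ) * Complex.I) := by fun_prop
    have h3 := (hg.tendsto _).comp ((h1.mul hs).const_mul u)
    have h4 := (hg.tendsto _).comp (((h2.mul h1).neg).const_mul u)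
    have h5 := (((hsC.pow 2).mul h3).add ((hsC.mul h2C).mul h4)).const_mul
      ((c : ℂ) * (u * Complex.I) ^ 2)
    have h6 : (c : ℂ) * kolmogorovKernelC (u * Complex.I) x = (c : ℂ) * (u * Complex.I) ^ 2 *
        ((1 - ((0 : ℝ) : ℂ)) ^ 2 * expQuotC (((u * (x * (1 - 0)) : ℝ) : ℂ) * Complex.I) +
          (1 - ((0 : ℝ) : ℂ)) * ((0 : ℝ) : ℂ) *
            expQuotC (((u * -(0 * x) : ℝ) : ℂ) * Complex.I)) := by
      rw [kolmogorovKernelC_eq]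
      have : (u : ℂ) * Complex.I * x = ((u * x : ℝ) : ℂ) * Complex.I := by push_cast; ring
      rw [this, sub_zero, mul_one]
      push_cast
      ring
    rw [h6]
    exact h5

open Filter Topology PowerSeries in
/-- Every finite measure `c χ` with all moments is the Kolmogorov measure of an infinitely
divisible law, whose cumulants are the moments of `c χ`. It is a weak limit of the laws of the sums
of `n` independent steps. -/
theorem exists_law_of_kolmogorov {χ : Measure ℝ} [IsProbabilityMeasure χ] (hχ : HasMoments χ)
    {c : ℝ} (hc : 0 ≤ c) :
    ∃ ρ : Measure ℝ, IsProbabilityMeasure ρ ∧ HasMoments ρ ∧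
      momentSeries ρ id = expOf (exponentSeries fun j => c * ∫ x, x ^ (j - 2) ∂χ) ∧
      ∀ u : ℝ, charFun ρ u =
        Complex.exp (c * ∫ x, kolmogorovKernelC (u * Complex.I) x ∂χ) := by
  obtain ⟨n₀, hn₀⟩ := eventually_atTop.1 ((eventually_gt_atTop 0).and
      ((Real.tendsto_sqrt_atTop.comp tendsto_natCast_atTop_atTop).eventually_ge_atTop c))
  have hN : Tendsto (fun l : ℕ => l + n₀) atTop atTop := tendsto_add_atTop_nat n₀
  have hl (l : ℕ) := hn₀ (l + n₀) (by omega)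
  have hp (l : ℕ) : IsProbabilityMeasure (stepLaw χ c (l + n₀)) :=
    isProbabilityMeasure_stepLaw hc (hl l).1 (hl l).2
  have hm (l : ℕ) : HasMoments (stepLaw χ c (l + n₀)) :=
    hasMoments_stepLaw hχ hc (hl l).1 (hl l).2
  have hT0 : constantCoeff (exponentSeries fun j => c * ∫ x, x ^ (j - 2) ∂χ) = 0 := by
    rw [← coeff_zero_eq_constantCoeff_apply, exponentSeries, coeff_mk, if_neg (by omega)]
  have hS (k : ℕ) : Tendsto (fun l => ((l + n₀ : ℕ) : ℝ) *
      coeff (k + 1) (momentSeries (stepLaw χ c (l + n₀)) id)) atTop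
      (𝓝 (coeff (k + 1) (exponentSeries fun j => c * ∫ x, x ^ (j - 2) ∂χ))) := by
    simp only [coeff_momentSeries, exponentSeries, coeff_mk, id]
    cases k with
    | zero =>
      simp only [zero_add, integral_stepLaw hχ hc (hl _).1 (hl _).2]
      simp
    | succ k =>
      rw [if_pos (by omega)]
      have h1 := ((tendsto_moment_stepLaw hχ hc k).comp hN).div_const ((k + 2).factorial : ℝ)
      refine h1.congr fun l => ?_
      simp only [Function.comp]
      ring
  have hF := tendsto_coeff_pow_expOf hT0 hN
    (fun l => constantCoeff_momentSeries (stepLaw χ c (l + n₀)) id) hS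
  obtain ⟨ρ, φ, hφ, hρ, hρm, hρs⟩ := exists_subseq_tendsto_of_tendsto_momentSeries
    (μs := fun l => ⟨convPow (stepLaw χ c (l + n₀)) (l + n₀), inferInstance⟩)
    (fun l => (hm l).convPow _) (fun j => by
      simp only [ProbabilityMeasure.coe_mk, momentSeries_convPow (hm _)]
      exact hF j)
  refine ⟨ρ, inferInstance, hρm, hρs, fun u => ?_⟩
  have h1 := (Complex.tendsto_one_add_pow_exp_of_tendsto
    (tendsto_charFun_stepLaw (χ := χ) hc u)).comp (hN.comp hφ.tendsto_atTop)
  have h2 := ProbabilityMeasure.tendsto_iff_tendsto_charFun.1 hρ u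
  refine tendsto_nhds_unique h2 (h1.congr fun l => ?_)
  change _ = charFun (convPow (stepLaw χ c (φ l + n₀)) (φ l + n₀)) u
  rw [charFun_convPow]
  simp

/-! ### Uniqueness of the Kolmogorov measure -/

theorem integrable_kolmogorovKernelC (χ : Measure ℝ) [IsProbabilityMeasure χ] (u : ℝ) :
    Integrable (kolmogorovKernelC (u * Complex.I)) χ :=
  Integrable.of_bound (continuous_kolmogorovKernelC _).aestronglyMeasurable (2 * u ^ 2)
    (.of_forall (norm_kolmogorovKernelC_mul_I_le u))

theorem continuous_integral_kolmogorovKernelC (χ : Measure ℝ) [IsProbabilityMeasure χ] :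
    Continuous fun u : ℝ => ∫ x, kolmogorovKernelC (u * Complex.I) x ∂χ := by
  have hq := continuous_expQuotC
  have h : Continuous fun u : ℝ => ∫ x, expQuotC (((u * x : ℝ) : ℂ) * Complex.I) ∂χ :=
    continuous_of_dominated (bound := fun _ => 2) (fun u => by fun_prop)
      (fun u => .of_forall fun x => norm_expQuotC_mul_I_le _) (integrable_const _)
      (.of_forall fun x => by fun_prop)
  have h2 (u : ℝ) : ∫ x, kolmogorovKernelC (u * Complex.I) x ∂χ =
      (u * Complex.I) ^ 2 * ∫ x, expQuotC (((u * x : ℝ) : ℂ) * Complex.I) ∂χ := by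
    rw [← integral_const_mul]
    refine integral_congr_ae (.of_forall fun x => ?_)
    simp only [kolmogorovKernelC_eq]
    congr 2
    push_cast
    ring
  simp only [h2]
  fun_prop

/-- A continuous function `g` on the line with `exp g = 1` and `g 0 = 0` vanishes. -/
theorem eq_zero_of_exp_eq_one {g : ℝ → ℂ} (hg : Continuous g) (h0 : g 0 = 0)
    (h1 : ∀ u, Complex.exp (g u) = 1) (u : ℝ) : g u = 0 := by
  choose k hk using fun u => Complex.exp_eq_one_iff.1 (h1 u)
  have hpi : (2 * Real.pi : ℝ) ≠ 0 := by positivity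
  have hk' (u : ℝ) : ((k u : ℤ) : ℝ) = (g u).im / (2 * Real.pi) := by
    rw [hk u, eq_div_iff hpi]
    simp
  have hc : Continuous k := by
    rw [Int.isClosedEmbedding_coe_real.isEmbedding.continuous_iff]
    have : ((↑) : ℤ → ℝ) ∘ k = fun u => (g u).im / (2 * Real.pi) := funext hk'
    rw [this]
    fun_prop
  have hku : k u = k 0 := PreconnectedSpace.constant inferInstance hc
  have hk0 : k 0 = 0 := by
    have := hk' 0
    rw [h0] at this
    simpa using this
  rw [hk u, hku, hk0]
  simp

/-- The second difference of `z ↦ kolmogorovKernelC z x` along the imaginary axis. -/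
theorem kolmogorovKernelC_second_difference (u h x : ℝ) :
    kolmogorovKernelC ((u + h : ℝ) * Complex.I) x + kolmogorovKernelC ((u - h : ℝ) * Complex.I) x -
      2 * kolmogorovKernelC (u * Complex.I) x =
    -(h : ℂ) ^ 2 * (Complex.exp (u * x * Complex.I) *
      (expQuotC (((h * x : ℝ) : ℂ) * Complex.I) + expQuotC (((-h * x : ℝ) : ℂ) * Complex.I))) := by
  rcases eq_or_ne x 0 with rfl | hx
  · simp only [kolmogorovKernelC, expQuotC, mul_zero]
    simp
    ring_nf
    simp
  · have hx' : (x : ℂ) ≠ 0 := by exact_mod_cast hx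
    apply mul_left_cancel₀ (pow_ne_zero 2 hx')
    have e1 := sq_mul_expQuotC (((h * x : ℝ) : ℂ) * Complex.I)
    have e2 := sq_mul_expQuotC (((-h * x : ℝ) : ℂ) * Complex.I)
    have k (z : ℂ) : (x : ℂ) ^ 2 * kolmogorovKernelC z x = Complex.exp (z * x) - 1 - x * z := by
      rw [kolmogorovKernelC, if_neg hx]; field_simp
    rw [mul_sub, mul_add, mul_left_comm _ (2 : ℂ), k, k, k]
    have x1 : Complex.exp (((u + h : ℝ) : ℂ) * Complex.I * x) =
        Complex.exp (u * x * Complex.I) * Complex.exp (((h * x : ℝ) : ℂ) * Complex.I) := by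
      rw [← Complex.exp_add]; congr 1; push_cast; ring
    have x2 : Complex.exp (((u - h : ℝ) : ℂ) * Complex.I * x) =
        Complex.exp (u * x * Complex.I) * Complex.exp (((-h * x : ℝ) : ℂ) * Complex.I) := by
      rw [← Complex.exp_add]; congr 1; push_cast; ring
    have x3 : Complex.exp ((u : ℂ) * Complex.I * x) = Complex.exp (u * x * Complex.I) := by
      congr 1; ring
    rw [x1, x2, x3]
    push_cast at e1 e2 ⊢
    have hI := Complex.I_sq
    linear_combination (-Complex.exp (u * x * Complex.I)) * (e1 + e2) +
      (Complex.exp (u * x * Complex.I) * h ^ 2 * x ^ 2 * (expQuotC (h * x * Complex.I) +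
        expQuotC (-h * x * Complex.I))) * hI

open Filter Topology in
/-- The Kolmogorov measure is determined by the exponent, whose second difference quotients tend to
minus the characteristic function of the measure. -/
theorem eq_of_integral_kolmogorovKernelC_eq {χ ν : Measure ℝ} [IsProbabilityMeasure χ]
    [IsProbabilityMeasure ν] (h : ∀ u : ℝ, ∫ x, kolmogorovKernelC (u * Complex.I) x ∂χ =
      ∫ x, kolmogorovKernelC (u * Complex.I) x ∂ν) : χ = ν := by
  apply Measure.ext_of_charFun
  ext u
  have hq := continuous_expQuotC
  -- the second difference quotient of the exponent, up to sign
  set D : Measure ℝ → ℝ → ℂ := fun ρ s => ∫ x, Complex.exp (u * x * Complex.I) *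
      (expQuotC (((s * x : ℝ) : ℂ) * Complex.I) + expQuotC (((-s * x : ℝ) : ℂ) * Complex.I)) ∂ρ
    with hD
  have hDeq (ρ : Measure ℝ) [IsProbabilityMeasure ρ] (s : ℝ) : -(s : ℂ) ^ 2 * D ρ s =
      ∫ x, kolmogorovKernelC ((u + s : ℝ) * Complex.I) x ∂ρ +
        ∫ x, kolmogorovKernelC ((u - s : ℝ) * Complex.I) x ∂ρ -
        2 * ∫ x, kolmogorovKernelC (u * Complex.I) x ∂ρ := by
    have h1 := integrable_kolmogorovKernelC ρ (u + s)
    have h2 := integrable_kolmogorovKernelC ρ (u - s)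
    have h3 := (integrable_kolmogorovKernelC ρ u).const_mul 2
    have h4 := integral_sub (h1.add h2) h3
    simp only [Pi.add_apply] at h4
    rw [integral_add h1 h2, integral_const_mul 2 (kolmogorovKernelC (u * Complex.I))] at h4
    rw [← h4, ← integral_const_mul]
    exact integral_congr_ae (.of_forall fun x => (kolmogorovKernelC_second_difference u s x).symm)
  have hlim (ρ : Measure ℝ) [IsProbabilityMeasure ρ] :
      Tendsto (fun l : ℕ => D ρ (1 / ((l : ℝ) + 1))) atTop (𝓝 (charFun ρ u)) := by
    rw [charFun_apply_real]
    refine tendsto_integral_of_dominated_convergence (fun _ => 4) (fun l => by fun_prop)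
      (integrable_const _) (fun l => .of_forall fun x => ?_) (.of_forall fun x => ?_)
    · rw [norm_mul, ← Complex.ofReal_mul, Complex.norm_exp_ofReal_mul_I, one_mul]
      refine (norm_add_le _ _).trans ?_
      linarith [norm_expQuotC_mul_I_le (1 / ((l : ℝ) + 1) * x),
        norm_expQuotC_mul_I_le (-(1 / ((l : ℝ) + 1)) * x)]
    · have hc : Continuous fun s : ℝ => Complex.exp (u * x * Complex.I) *
        (expQuotC (((s * x : ℝ) : ℂ) * Complex.I) +
          expQuotC (((-s * x : ℝ) : ℂ) * Complex.I)) := by fun_prop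
      have h1 := (hc.tendsto 0).comp (tendsto_one_div_add_atTop_nhds_zero_nat (𝕜 := ℝ))
      have h2 : Complex.exp (u * x * Complex.I) * (expQuotC (((0 * x : ℝ) : ℂ) * Complex.I) +
          expQuotC (((-0 * x : ℝ) : ℂ) * Complex.I)) = Complex.exp (u * x * Complex.I) := by
        simp [expQuotC]
        norm_num
      rw [h2] at h1
      exact h1
  refine tendsto_nhds_unique (hlim χ) ((hlim ν).congr fun l => ?_)
  have hs : -((1 / ((l : ℝ) + 1) : ℝ) : ℂ) ^ 2 ≠ 0 := by
    rw [neg_ne_zero]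
    refine pow_ne_zero 2 ?_
    have : (1 / ((l : ℝ) + 1) : ℝ) ≠ 0 := by positivity
    exact_mod_cast this
  apply mul_left_cancel₀ hs
  rw [hDeq, hDeq, h, h, h]

/-- Equality of the exponents follows from that of their exponentials by continuity. -/
theorem eq_of_exp_integral_kolmogorovKernelC_eq {χ ν : Measure ℝ} [IsProbabilityMeasure χ]
    [IsProbabilityMeasure ν] {q : ℝ} (hq : 0 < q)
    (h : ∀ u : ℝ, Complex.exp (q * ∫ x, kolmogorovKernelC (u * Complex.I) x ∂χ) =
      Complex.exp (q * ∫ x, kolmogorovKernelC (u * Complex.I) x ∂ν)) : χ = ν := by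
  have h1 := continuous_integral_kolmogorovKernelC χ
  have h2 := continuous_integral_kolmogorovKernelC ν
  have hq' : (q : ℂ) ≠ 0 := by exact_mod_cast hq.ne'
  apply eq_of_integral_kolmogorovKernelC_eq
  intro u
  have h3 := eq_zero_of_exp_eq_one (g := fun u : ℝ =>
    q * ∫ x, kolmogorovKernelC (u * Complex.I) x ∂χ -
      q * ∫ x, kolmogorovKernelC (u * Complex.I) x ∂ν) (by fun_prop)
    (by simp [kolmogorovKernelC_eq]) (fun u => by
      rw [Complex.exp_sub, h, div_self (Complex.exp_ne_zero _)]) u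
  exact mul_left_cancel₀ hq' (sub_eq_zero.1 h3)

/-! ### The Kolmogorov measure of a law with convolution roots -/

/-- The cumulants `j! [y ^ j] K` of a law with moment series `exp K`. -/
noncomputable def cumulant (K : PowerSeries ℝ) (j : ℕ) : ℝ := j.factorial * PowerSeries.coeff j K

open PowerSeries in
theorem exponentSeries_cumulant {K : PowerSeries ℝ} (h0 : constantCoeff K = 0)
    (h1 : coeff 1 K = 0) : exponentSeries (cumulant K) = K := by
  ext j
  rw [exponentSeries, coeff_mk]
  split_ifs with h
  · have : (j.factorial : ℝ) ≠ 0 := by positivity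
    rw [cumulant]; field_simp
  · have : j = 0 ∨ j = 1 := by omega
    rcases this with rfl | rfl
    · rw [coeff_zero_eq_constantCoeff_apply, h0]
    · rw [h1]

open PowerSeries in
theorem coeff_one_expOf {K : PowerSeries ℝ} (h0 : constantCoeff K = 0) :
    coeff 1 (expOf K) = coeff 1 K := by
  have := congrArg (coeff 0) (derivative_expOf h0)
  rw [coeff_derivative, coeff_zero_eq_constantCoeff_apply, map_mul, constantCoeff_expOf h0,
    ← coeff_zero_eq_constantCoeff_apply, coeff_derivative] at this
  simpa using this

open PowerSeries in
theorem coeff_two_expOf {K : PowerSeries ℝ} (h0 : constantCoeff K = 0) (h1 : coeff 1 K = 0) :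
    coeff 2 (expOf K) = coeff 2 K := by
  have := congrArg (coeff 1) (derivative_expOf h0)
  rw [coeff_derivative, coeff_mul, Finset.Nat.sum_antidiagonal_eq_sum_range_succ_mk] at this
  simp [Finset.sum_range_succ, coeff_derivative, h1, constantCoeff_expOf h0] at this
  linarith

/-- The measure `s x ^ 2 ρ(dx)`. -/
noncomputable def sqDensity (ρ : Measure ℝ) (s : ℝ) : Measure ℝ :=
  ρ.withDensity fun x => ENNReal.ofReal (s * x ^ 2)

theorem integrable_sqDensity_iff {ρ : Measure ℝ} {s : ℝ} (hs : 0 ≤ s) {f : ℝ → ℝ} :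
    Integrable f (sqDensity ρ s) ↔ Integrable (fun x => s * x ^ 2 * f x) ρ := by
  have h (x : ℝ) : 0 ≤ s * x ^ 2 := by positivity
  rw [sqDensity, integrable_withDensity_iff_integrable_smul₀' (by fun_prop) (by simp)]
  simp [h]

theorem integral_sqDensity {ρ : Measure ℝ} {s : ℝ} (hs : 0 ≤ s) (f : ℝ → ℝ) :
    ∫ x, f x ∂(sqDensity ρ s) = ∫ x, s * x ^ 2 * f x ∂ρ := by
  have h (x : ℝ) : 0 ≤ s * x ^ 2 := by positivity
  rw [sqDensity, integral_withDensity_eq_integral_toReal_smul (by fun_prop) (by simp)]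
  simp [h]

theorem isProbabilityMeasure_sqDensity {ρ : Measure ℝ} {s : ℝ} (hs : 0 ≤ s)
    (hi : Integrable (fun x : ℝ => x ^ 2) ρ) (h : s * ∫ x, x ^ 2 ∂ρ = 1) :
    IsProbabilityMeasure (sqDensity ρ s) := by
  constructor
  rw [sqDensity, withDensity_apply _ .univ, Measure.restrict_univ,
    ← ofReal_integral_eq_lintegral_ofReal (hi.const_mul s) (.of_forall fun x => by positivity),
    integral_const_mul, h, ENNReal.ofReal_one]

/-- `ρ l` is a convolution root of order `l + 1` of the law `μ` with moment series `exp K`, with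
the moment series `exp (K / (l + 1))`. -/
structure IsRootSequence (μ : Measure ℝ) (K : PowerSeries ℝ) (ρ : ℕ → Measure ℝ) : Prop where
  isProbabilityMeasure : ∀ l, IsProbabilityMeasure (ρ l)
  hasMoments : ∀ l, HasMoments (ρ l)
  momentSeries_eq : ∀ l, momentSeries (ρ l) id = expOf (((l + 1 : ℕ) : ℝ)⁻¹ • K)
  convPow_eq : ∀ l, convPow (ρ l) (l + 1) = μ

section Root

variable {μ : Measure ℝ} {K : PowerSeries ℝ} {ρ : ℕ → Measure ℝ}

open PowerSeries in
theorem IsRootSequence.integral_id (h : IsRootSequence μ K ρ) (h0 : constantCoeff K = 0)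
    (h1 : coeff 1 K = 0) (l : ℕ) : ∫ x, x ∂(ρ l) = 0 := by
  have := congrArg (coeff 1) (h.momentSeries_eq l)
  rw [coeff_one_expOf (by simp [h0]), coeff_momentSeries] at this
  simpa [h1] using this

open PowerSeries in
theorem IsRootSequence.mul_integral_sq (h : IsRootSequence μ K ρ) (h0 : constantCoeff K = 0)
    (h1 : coeff 1 K = 0) (l : ℕ) : ((l + 1 : ℕ) : ℝ) * ∫ x, x ^ 2 ∂(ρ l) = cumulant K 2 := by
  have := congrArg (coeff 2) (h.momentSeries_eq l)
  rw [coeff_two_expOf (by simp [h0]) (by simp [h1]), coeff_momentSeries, map_smul,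
    smul_eq_mul] at this
  simp only [id] at this
  have hl : ((l + 1 : ℕ) : ℝ) ≠ 0 := by positivity
  rw [cumulant]
  field_simp at this ⊢
  rw [← this]

open PowerSeries Filter Topology in
theorem IsRootSequence.tendsto_moment (h : IsRootSequence μ K ρ) (h0 : constantCoeff K = 0)
    (j : ℕ) :
    Tendsto (fun l : ℕ => ((l + 1 : ℕ) : ℝ) * ∫ x, x ^ (j + 1) ∂(ρ l)) atTop
      (𝓝 (cumulant K (j + 1))) := by
  have hinv : Tendsto (fun l : ℕ => ((l + 1 : ℕ) : ℝ)⁻¹) atTop (𝓝 0) := by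
    simpa using tendsto_one_div_add_atTop_nhds_zero_nat (𝕜 := ℝ)
  have h1 (k : ℕ) : Tendsto (fun l : ℕ => coeff k (expOf (((l + 1 : ℕ) : ℝ)⁻¹ • K))) atTop
      (𝓝 (coeff k 1)) := by
    rw [← expOf_zero]
    refine tendsto_coeff_expOf_of_tendsto (by simp) (by simp [h0]) (fun k => ?_) k
    simpa using hinv.mul_const (coeff k K)
  have h2 := tendsto_coeff_mul (F := fun _ => d⁄dX ℝ K) (F' := d⁄dX ℝ K) j
    (fun k _ => tendsto_const_nhds) (fun k _ => h1 k)
  rw [mul_one, coeff_derivative] at h2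
  have h3 := h2.const_mul (j.factorial : ℝ)
  have e : cumulant K (j + 1) = (j.factorial : ℝ) * (coeff (j + 1) K * (j + 1)) := by
    rw [cumulant, Nat.factorial_succ]; push_cast; ring
  rw [e]
  refine h3.congr fun l => ?_
  have h4 := congrArg (coeff j) (derivative_expOf (K := ((l + 1 : ℕ) : ℝ)⁻¹ • K) (by simp [h0]))
  rw [← h.momentSeries_eq l, coeff_derivative, Derivation.map_smul, smul_mul_assoc, map_smul,
    smul_eq_mul, coeff_momentSeries] at h4
  simp only [id] at h4
  have hl : ((l + 1 : ℕ) : ℝ) ≠ 0 := by positivity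
  rw [← h.momentSeries_eq l]
  rw [Nat.factorial_succ] at h4
  have hj : (j.factorial : ℝ) ≠ 0 := by positivity
  have hj1 : ((j : ℝ) + 1) ≠ 0 := by positivity
  have h5 : coeff j (d⁄dX ℝ K * momentSeries (ρ l) id) =
      ((l + 1 : ℕ) : ℝ) * ((∫ x, x ^ (j + 1) ∂(ρ l)) / (((j + 1) * j.factorial : ℕ) : ℝ) *
        ((j : ℝ) + 1)) := by
    rw [h4, ← mul_assoc, mul_inv_cancel₀ hl, one_mul]
  rw [h5]
  push_cast
  field_simp

open PowerSeries Filter Topology in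
/-- The Kolmogorov measure is the weak limit of the measures `n x ^ 2 ρ_n(dx) / κ_2`, where `ρ_n`
is the convolution root of order `n`. -/
theorem IsRootSequence.exists_kolmogorov_measure (h : IsRootSequence μ K ρ)
    (h0 : constantCoeff K = 0) (h1 : coeff 1 K = 0) (hq : 0 < cumulant K 2) :
    ∃ (χs : ℕ → ProbabilityMeasure ℝ) (χ : ProbabilityMeasure ℝ) (φ : ℕ → ℕ),
      (∀ l, (χs l : Measure ℝ) = sqDensity (ρ l) (((l + 1 : ℕ) : ℝ) / cumulant K 2)) ∧
      StrictMono φ ∧ Tendsto (χs ∘ φ) atTop (𝓝 χ) ∧ HasMoments (χ : Measure ℝ) ∧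
      ∀ j, ∫ x, x ^ j ∂(χ : Measure ℝ) = cumulant K (j + 2) / cumulant K 2 := by
  have hs (l : ℕ) : 0 ≤ ((l + 1 : ℕ) : ℝ) / cumulant K 2 := by positivity
  have hp (l : ℕ) : IsProbabilityMeasure
      (sqDensity (ρ l) (((l + 1 : ℕ) : ℝ) / cumulant K 2)) := by
    refine isProbabilityMeasure_sqDensity (hs l) (h.hasMoments l 2) ?_
    rw [div_mul_eq_mul_div, h.mul_integral_sq h0 h1 l, div_self hq.ne']
  have he (l j : ℕ) (x : ℝ) : ((l + 1 : ℕ) : ℝ) / cumulant K 2 * x ^ 2 * x ^ j =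
      ((l + 1 : ℕ) : ℝ) / cumulant K 2 * x ^ (j + 2) := by ring
  obtain ⟨χ, φ, hφ, hχ, hm, hmom⟩ := exists_subseq_tendsto_of_tendsto_moments
    (μs := fun l => ⟨_, hp l⟩) (m := fun j => cumulant K (j + 2) / cumulant K 2) (fun l j => by
      rw [ProbabilityMeasure.coe_mk, integrable_sqDensity_iff (hs l)]
      simp only [he]
      exact (h.hasMoments l (j + 2)).const_mul _) (fun j => by
      simp only [ProbabilityMeasure.coe_mk]
      refine ((h.tendsto_moment h0 (j + 1)).div_const (cumulant K 2)).congr fun l => ?_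
      rw [integral_sqDensity (hs l)]
      simp only [he]
      rw [integral_const_mul]
      ring)
  exact ⟨_, χ, φ, fun l => rfl, hφ, hχ, hm, hmom⟩

theorem lintegral_exp_ne_top_iff {ρ : Measure ℝ} {y : ℝ} :
    ∫⁻ x, ENNReal.ofReal (Real.exp (y * x)) ∂ρ ≠ ⊤ ↔ Integrable (fun x => Real.exp (y * x)) ρ := by
  rw [← lt_top_iff_ne_top,
    ← hasFiniteIntegral_iff_ofReal (.of_forall fun x => (Real.exp_pos (y * x)).le)]
  exact ⟨fun h => ⟨by fun_prop, h⟩, fun h => h.2⟩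

theorem IsRootSequence.integrable_exp (h : IsRootSequence μ K ρ) {y : ℝ}
    (hy : Integrable (fun x => Real.exp (y * x)) μ) (l : ℕ) :
    Integrable (fun x => Real.exp (y * x)) (ρ l) ∧
      (∫ x, Real.exp (y * x) ∂(ρ l)) ^ (l + 1) = ∫ x, Real.exp (y * x) ∂μ := by
  have := h.isProbabilityMeasure l
  have h1 := lintegral_exp_convPow (ρ l) (l + 1) y
  rw [h.convPow_eq] at h1
  have h2 : Integrable (fun x => Real.exp (y * x)) (ρ l) := by
    rw [← lintegral_exp_ne_top_iff] at hy ⊢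
    intro htop
    rw [htop, ENNReal.top_pow (by omega)] at h1
    exact hy h1
  refine ⟨h2, ?_⟩
  rw [← ofReal_integral_eq_lintegral_ofReal hy (.of_forall fun x => (Real.exp_pos _).le),
    ← ofReal_integral_eq_lintegral_ofReal h2 (.of_forall fun x => (Real.exp_pos _).le),
    ← ENNReal.ofReal_pow (integral_nonneg fun x => (Real.exp_pos _).le)] at h1
  exact ((ENNReal.ofReal_eq_ofReal_iff (integral_nonneg fun x => (Real.exp_pos _).le)
    (pow_nonneg (integral_nonneg fun x => (Real.exp_pos _).le) _)).1 h1).symm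

open Filter Topology in
theorem tendsto_mul_exp_div_sub_one (f : ℝ) :
    Tendsto (fun l : ℕ => ((l + 1 : ℕ) : ℝ) * (Real.exp (f / ((l + 1 : ℕ) : ℝ)) - 1)) atTop
      (𝓝 f) := by
  have hd : HasDerivAt (fun s : ℝ => Real.exp (s * f)) f 0 := by
    have := ((hasDerivAt_id (0 : ℝ)).mul_const f).exp
    simpa using this
  have h1 := hd.tendsto_slope_zero
  have h2 : Tendsto (fun l : ℕ => ((l + 1 : ℕ) : ℝ)⁻¹) atTop (𝓝[≠] 0) := by
    refine tendsto_nhdsWithin_iff.2 ⟨?_, .of_forall fun l => ?_⟩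
    · simpa using tendsto_one_div_add_atTop_nhds_zero_nat (𝕜 := ℝ)
    · have : ((l + 1 : ℕ) : ℝ)⁻¹ ≠ 0 := by positivity
      exact this
  refine (h1.comp h2).congr fun l => ?_
  simp only [Function.comp, zero_add, inv_inv, smul_eq_mul, zero_mul, Real.exp_zero]
  congr 3
  ring

open PowerSeries Filter Topology in
/-- The integrals of the kernel are multiples of `n (M ^ (1 / n) - 1)`, with `M` the exponential
moment of `μ`, and this tends to `log M`. -/
theorem IsRootSequence.tendsto_integral_kolmogorovKernel [IsProbabilityMeasure μ]
    (h : IsRootSequence μ K ρ)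
    (h0 : constantCoeff K = 0) (h1 : coeff 1 K = 0) (hq : 0 < cumulant K 2) {y : ℝ}
    (hy : Integrable (fun x => Real.exp (y * x)) μ) :
    (∀ l, Integrable (kolmogorovKernel y) (sqDensity (ρ l) (((l + 1 : ℕ) : ℝ) / cumulant K 2))) ∧
    Tendsto (fun l => ∫ x, kolmogorovKernel y x
      ∂(sqDensity (ρ l) (((l + 1 : ℕ) : ℝ) / cumulant K 2))) atTop
      (𝓝 (Real.log (∫ x, Real.exp (y * x) ∂μ) / cumulant K 2)) := by
  have hs (l : ℕ) : 0 ≤ ((l + 1 : ℕ) : ℝ) / cumulant K 2 := by positivity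
  have hid (l : ℕ) : Integrable (fun x : ℝ => x) (ρ l) := by simpa using h.hasMoments l 1
  have hp := h.isProbabilityMeasure
  have hi (l : ℕ) : Integrable (fun x => Real.exp (y * x) - 1 - y * x) (ρ l) :=
    ((h.integrable_exp hy l).1.sub (integrable_const 1)).sub ((hid l).const_mul y)
  have he (l : ℕ) (x : ℝ) : ((l + 1 : ℕ) : ℝ) / cumulant K 2 * x ^ 2 * kolmogorovKernel y x =
      ((l + 1 : ℕ) : ℝ) / cumulant K 2 * (Real.exp (y * x) - 1 - y * x) := by
    rw [mul_assoc, sq_mul_kolmogorovKernel]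
  refine ⟨fun l => ?_, ?_⟩
  · rw [integrable_sqDensity_iff (hs l)]
    simp only [he]
    exact (hi l).const_mul _
  · have hpos : 0 < ∫ x, Real.exp (y * x) ∂μ := integral_exp_pos hy
    refine ((tendsto_mul_exp_div_sub_one (Real.log (∫ x, Real.exp (y * x) ∂μ))).div_const
      (cumulant K 2)).congr fun l => ?_
    rw [integral_sqDensity (hs l)]
    simp only [he]
    have hsub := integral_sub ((h.integrable_exp hy l).1.sub (integrable_const 1))
      ((hid l).const_mul y)
    simp only [Pi.sub_apply] at hsub
    rw [integral_const_mul, hsub, integral_sub (h.integrable_exp hy l).1 (integrable_const 1),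
      integral_const_mul, h.integral_id h0 h1 l]
    have hl : ((l + 1 : ℕ) : ℝ) ≠ 0 := by positivity
    have hroot : Real.exp (Real.log (∫ x, Real.exp (y * x) ∂μ) / ((l + 1 : ℕ) : ℝ)) =
        ∫ x, Real.exp (y * x) ∂(ρ l) := by
      have hpl : 0 < ∫ x, Real.exp (y * x) ∂(ρ l) := integral_exp_pos (h.integrable_exp hy l).1
      rw [← (h.integrable_exp hy l).2, Real.log_pow, mul_comm, mul_div_assoc, div_self hl,
        mul_one, Real.exp_log hpl]
    rw [hroot]
    simp
    ring

end Root

/-! ### The moment generating function in Kolmogorov form -/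

theorem exp_mul_sub_le {t : ℝ} (ht0 : 0 ≤ t) (ht1 : t ≤ 1) (w : ℝ) :
    Real.exp (t * w) - 1 - t * w ≤ Real.exp w - 1 - w := by
  have h1 := convexOn_exp.2 (Set.mem_univ w) (Set.mem_univ 0) ht0 (sub_nonneg.2 ht1)
    (by ring : t + (1 - t) = 1)
  simp only [smul_eq_mul, mul_zero, add_zero, Real.exp_zero, mul_one] at h1
  have h2 := Real.add_one_le_exp w
  nlinarith

theorem kolmogorovKernel_mul_le {t : ℝ} (ht0 : 0 ≤ t) (ht1 : t ≤ 1) (y x : ℝ) :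
    kolmogorovKernel (t * y) x ≤ kolmogorovKernel y x := by
  rcases eq_or_ne x 0 with rfl | hx
  · simp only [kolmogorovKernel, if_true]
    rw [mul_pow]
    have : t ^ 2 ≤ 1 := pow_le_one₀ ht0 ht1
    nlinarith [sq_nonneg y]
  · have := exp_mul_sub_le ht0 ht1 (y * x)
    rw [← mul_assoc] at this
    rw [kolmogorovKernel, if_neg hx, kolmogorovKernel, if_neg hx]
    have hx2 : 0 < x ^ 2 := by positivity
    rw [div_le_div_iff_of_pos_right hx2]
    linarith [mul_comm x y, mul_comm x (t * y)]

/-- For `t < 1` the exponential growth of `expQuot (t w)` is negligible compared with that of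
`expQuot w`. -/
theorem exists_expQuot_mul_le {t : ℝ} (ht0 : 0 ≤ t) (ht1 : t < 1) {ε : ℝ} (hε : 0 < ε) :
    ∃ B : ℝ, ∀ w : ℝ, t ^ 2 * expQuot (t * w) ≤ ε * expQuot w + B := by
  have ht : 0 < 1 - t := by linarith
  set R : ℝ := max 4 (2 / (ε * (1 - t))) with hR
  have hcont : ContinuousOn (fun w => t ^ 2 * expQuot (t * w) - ε * expQuot w)
      (Set.Icc (-1) R) := by
    have := continuous_expQuot
    fun_prop
  obtain ⟨C, hC⟩ := isCompact_Icc.exists_bound_of_continuousOn hcont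
  refine ⟨max C 1, fun w => ?_⟩
  have hkey (hw0 : w ≠ 0) : t ^ 2 * expQuot (t * w) * w ^ 2 = Real.exp (t * w) - 1 - t * w := by
    rw [← sq_mul_expQuot]; ring
  rcases lt_or_ge w (-1) with hw | hw
  · have hw0 : w ≠ 0 := by linarith
    have h1 : Real.exp (t * w) ≤ 1 := by
      rw [Real.exp_le_one_iff]; nlinarith
    have h2 : t ^ 2 * expQuot (t * w) ≤ 1 := by
      have hw2 : 0 < w ^ 2 := by positivity
      refine le_of_mul_le_mul_right ?_ hw2
      rw [hkey hw0]
      nlinarith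
    have := mul_nonneg hε.le (expQuot_nonneg w)
    linarith [le_max_right C 1]
  rcases le_or_gt w R with hwR | hwR
  · have := (le_abs_self _).trans (hC w ⟨hw, hwR⟩)
    linarith [le_max_left C 1]
  · have hw4 : 4 < w := (le_max_left _ _).trans_lt hwR
    have hwε : 2 / (ε * (1 - t)) < w := (le_max_right _ _).trans_lt hwR
    have hw2 : 0 < w ^ 2 := by positivity
    have h1 : t ^ 2 * expQuot (t * w) ≤ ε * expQuot w := by
      refine le_of_mul_le_mul_right ?_ hw2
      rw [hkey (by linarith), mul_assoc, mul_comm (expQuot w), sq_mul_expQuot]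
      have h2 := Real.quadratic_le_exp_of_nonneg (x := w) (by linarith)
      have h3 : 2 / ε ≤ Real.exp ((1 - t) * w) := by
        have h4 := Real.add_one_le_exp ((1 - t) * w)
        have h5 : 2 / ε ≤ (1 - t) * w := by
          rw [div_lt_iff₀ (by positivity)] at hwε
          rw [div_le_iff₀ hε]
          nlinarith
        linarith
      have h6 : Real.exp w = Real.exp (t * w) * Real.exp ((1 - t) * w) := by
        rw [← Real.exp_add]; congr 1; ring
      have h7 : Real.exp (t * w) * 2 ≤ ε * Real.exp w := by
        rw [div_le_iff₀ hε] at h3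
        rw [h6]
        nlinarith [Real.exp_pos (t * w)]
      have h8 : Real.exp w ≤ 2 * (Real.exp w - 1 - w) := by nlinarith
      nlinarith
    have : (0 : ℝ) ≤ max C 1 := zero_le_one.trans (le_max_right _ _)
    linarith

theorem integrable_exp_mul_mul {μ : Measure ℝ} [IsProbabilityMeasure μ] {y : ℝ}
    (hy : Integrable (fun x => Real.exp (y * x)) μ) {t : ℝ} (ht0 : 0 ≤ t) (ht1 : t ≤ 1) :
    (∀ x, Real.exp (t * y * x) ≤ 1 + Real.exp (y * x)) ∧
    Integrable (fun x => Real.exp (t * y * x)) μ := by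
  have h (x : ℝ) : Real.exp (t * y * x) ≤ 1 + Real.exp (y * x) := by
    rcases le_total 0 (y * x) with h1 | h1
    · have : Real.exp (t * y * x) ≤ Real.exp (y * x) := by
        rw [Real.exp_le_exp, mul_assoc]; nlinarith
      linarith
    · have : Real.exp (t * y * x) ≤ 1 := by
        rw [Real.exp_le_one_iff, mul_assoc]; nlinarith
      linarith [Real.exp_pos (y * x)]
  refine ⟨h, ((integrable_const 1).add hy).mono' (by fun_prop) (.of_forall fun x => ?_)⟩
  rw [Real.norm_of_nonneg (Real.exp_pos _).le]
  exact h x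

open PowerSeries Filter Topology in
/-- The Kolmogorov form of the moment generating function. Integrability of the kernel is Fatou's
lemma along the approximating measures `χ_n`. The formula follows by uniform integrability at
`t y` for `t < 1`, and extends to the boundary point `y` by dominated convergence. -/
theorem IsRootSequence.integral_exp_eq {μ : Measure ℝ} [IsProbabilityMeasure μ]
    {K : PowerSeries ℝ} {ρ : ℕ → Measure ℝ} (h : IsRootSequence μ K ρ)
    (h0 : constantCoeff K = 0) (h1 : coeff 1 K = 0) (hq : 0 < cumulant K 2)
    {χs : ℕ → ProbabilityMeasure ℝ} {χ : ProbabilityMeasure ℝ} {φ : ℕ → ℕ}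
    (hχs : ∀ l, (χs l : Measure ℝ) = sqDensity (ρ l) (((l + 1 : ℕ) : ℝ) / cumulant K 2))
    (hφ : StrictMono φ) (hχ : Tendsto (χs ∘ φ) atTop (𝓝 χ)) {y : ℝ}
    (hy : Integrable (fun x => Real.exp (y * x)) μ) :
    Integrable (kolmogorovKernel y) (χ : Measure ℝ) ∧
      ∫ x, Real.exp (y * x) ∂μ =
        Real.exp (cumulant K 2 * ∫ x, kolmogorovKernel y x ∂(χ : Measure ℝ)) := by
  have hlim {z : ℝ} (hz : Integrable (fun x => Real.exp (z * x)) μ) :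
      (∀ l, Integrable (kolmogorovKernel z) ((χs ∘ φ) l : Measure ℝ)) ∧
      Tendsto (fun l => ∫ x, kolmogorovKernel z x ∂((χs ∘ φ) l : Measure ℝ)) atTop
        (𝓝 (Real.log (∫ x, Real.exp (z * x) ∂μ) / cumulant K 2)) := by
    obtain ⟨h2, h3⟩ := h.tendsto_integral_kolmogorovKernel h0 h1 hq hz
    refine ⟨fun l => ?_, ?_⟩
    · rw [Function.comp, hχs]; exact h2 _
    · refine (h3.comp hφ.tendsto_atTop).congr fun l => ?_
      simp only [Function.comp, hχs]
  obtain ⟨hi, hty⟩ := hlim hy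
  obtain ⟨C, hC⟩ := hty.bddAbove_range
  have hC' (l : ℕ) : ∫ x, kolmogorovKernel y x ∂((χs ∘ φ) l : Measure ℝ) ≤ C := hC ⟨l, rfl⟩
  have hint := (integrable_of_tendsto_of_integral_le hχ (continuous_kolmogorovKernel y)
    (kolmogorovKernel_nonneg y) hi hC').1
  refine ⟨hint, ?_⟩
  have hsub {t : ℝ} (ht0 : 0 ≤ t) (ht1 : t < 1) :
      cumulant K 2 * ∫ x, kolmogorovKernel (t * y) x ∂(χ : Measure ℝ) =
        Real.log (∫ x, Real.exp (t * y * x) ∂μ) := by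
    have h2 := (tendsto_integral_of_uniform hχ (continuous_kolmogorovKernel y)
      (kolmogorovKernel_nonneg y) hi hC' (continuous_kolmogorovKernel (t * y)) (fun ε hε => by
        obtain ⟨B, hB⟩ := exists_expQuot_mul_le ht0 ht1 hε
        refine ⟨y ^ 2 * B, fun x => ?_⟩
        rw [abs_of_nonneg (kolmogorovKernel_nonneg _ _), kolmogorovKernel_eq, kolmogorovKernel_eq]
        have h3 := mul_le_mul_of_nonneg_left (hB (y * x)) (sq_nonneg y)
        have h4 : t * y * x = t * (y * x) := by ring
        rw [h4]
        linarith)).2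
    have h5 := tendsto_nhds_unique h2 (hlim (integrable_exp_mul_mul hy ht0 ht1.le).2).2
    rw [h5]
    field_simp
  -- the approach to the boundary point
  set t : ℕ → ℝ := fun l => 1 - 1 / ((l : ℝ) + 1) with ht
  have htl : Tendsto t atTop (𝓝 1) := by
    simpa [ht] using (tendsto_const_nhds (x := (1 : ℝ))).sub
      (tendsto_one_div_add_atTop_nhds_zero_nat (𝕜 := ℝ))
  have ht0 (l : ℕ) : 0 ≤ t l := by
    simp only [ht, sub_nonneg]
    rw [div_le_one (by positivity)]
    linarith [(Nat.cast_nonneg l : (0 : ℝ) ≤ l)]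
  have ht1 (l : ℕ) : t l < 1 := by
    have : 0 < 1 / ((l : ℝ) + 1) := by positivity
    simp only [ht]; linarith
  have hL : Tendsto (fun l => ∫ x, Real.exp (t l * y * x) ∂μ) atTop
      (𝓝 (∫ x, Real.exp (y * x) ∂μ)) := by
    refine tendsto_integral_of_dominated_convergence (fun x => 1 + Real.exp (y * x))
      (fun l => by fun_prop) ((integrable_const 1).add hy) (fun l => .of_forall fun x => ?_)
      (.of_forall fun x => ?_)
    · rw [Real.norm_of_nonneg (Real.exp_pos _).le]
      exact (integrable_exp_mul_mul hy (ht0 l) (ht1 l).le).1 x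
    · have h2 : Continuous fun s : ℝ => Real.exp (s * y * x) := by fun_prop
      have h3 := (h2.tendsto 1).comp htl
      rw [one_mul] at h3
      exact h3
  have hR : Tendsto (fun l => ∫ x, kolmogorovKernel (t l * y) x ∂(χ : Measure ℝ)) atTop
      (𝓝 (∫ x, kolmogorovKernel y x ∂(χ : Measure ℝ))) := by
    refine tendsto_integral_of_dominated_convergence (kolmogorovKernel y)
      (fun l => (continuous_kolmogorovKernel _).aestronglyMeasurable) hint
      (fun l => .of_forall fun x => ?_) (.of_forall fun x => ?_)
    · rw [Real.norm_of_nonneg (kolmogorovKernel_nonneg _ _)]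
      exact kolmogorovKernel_mul_le (ht0 l) (ht1 l).le y x
    · have hc := continuous_expQuot
      have h2 : Continuous fun s : ℝ => (s * y) ^ 2 * expQuot (s * y * x) := by fun_prop
      have h3 := (h2.tendsto 1).comp htl
      rw [one_mul, ← kolmogorovKernel_eq] at h3
      exact h3.congr fun l => (kolmogorovKernel_eq _ _).symm
  have hpos : 0 < ∫ x, Real.exp (y * x) ∂μ := integral_exp_pos hy
  have h6 := (hL.log hpos.ne').congr fun l => (hsub (ht0 l) (ht1 l)).symm
  have h7 := tendsto_nhds_unique h6 (hR.const_mul (cumulant K 2))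
  rw [← h7, Real.exp_log hpos]

/-! ### The cumulant series -/

theorem hasSum_expQuot (w : ℝ) :
    HasSum (fun j : ℕ => w ^ j / ((j + 2).factorial : ℝ)) (expQuot w) := by
  rcases eq_or_ne w 0 with rfl | hw
  · have := hasSum_single (f := fun j : ℕ => (0 : ℝ) ^ j / ((j + 2).factorial : ℝ)) 0
      (fun j hj => by simp [hj])
    simpa [expQuot] using this
  · have h1 : HasSum (fun n : ℕ => w ^ n / (n.factorial : ℝ)) (Real.exp w) := by
      rw [Real.exp_eq_exp_ℝ]
      exact NormedSpace.expSeries_div_hasSum_exp w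
    have h2 := ((hasSum_nat_add_iff' 2).2 h1).div_const (w ^ 2)
    have h3 : (Real.exp w - ∑ i ∈ Finset.range 2, w ^ i / (i.factorial : ℝ)) / w ^ 2 =
        expQuot w := by
      rw [expQuot, if_neg hw]
      simp [Finset.sum_range_succ]
      ring
    rw [h3] at h2
    refine h2.congr_fun fun j => ?_
    field_simp
    ring

/-- Expansion of the kernel under the integral. The integrability of both kernels dominates the sum
of the absolute values. -/
theorem hasSum_moments_kolmogorovKernel {χ : Measure ℝ} [IsProbabilityMeasure χ]
    (hχ : HasMoments χ) {y : ℝ} (hy : Integrable (kolmogorovKernel y) χ)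
    (hy' : Integrable (kolmogorovKernel (-y)) χ) :
    HasSum (fun j : ℕ => (∫ x, x ^ j ∂χ) * y ^ (j + 2) / ((j + 2).factorial : ℝ))
      (∫ x, kolmogorovKernel y x ∂χ) := by
  set F : ℕ → ℝ → ℝ := fun j x => y ^ 2 * ((y * x) ^ j / ((j + 2).factorial : ℝ)) with hF
  have hFi (j : ℕ) : Integrable (F j) χ := by
    simp only [hF, mul_pow]
    exact (((hχ j).const_mul _).div_const _).const_mul _
  have hFeq (j : ℕ) : ∫ x, F j x ∂χ =
      (∫ x, x ^ j ∂χ) * y ^ (j + 2) / ((j + 2).factorial : ℝ) := by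
    simp only [hF, mul_pow]
    rw [integral_const_mul, integral_div, integral_const_mul]
    ring
  have hbound (n : ℕ) (x : ℝ) : ∑ j ∈ Finset.range n, ‖F j x‖ ≤
      kolmogorovKernel y x + kolmogorovKernel (-y) x := by
    have h1 : ∑ j ∈ Finset.range n, |y * x| ^ j / ((j + 2).factorial : ℝ) ≤ expQuot |y * x| :=
      sum_le_hasSum _ (fun j _ => by positivity) (hasSum_expQuot _)
    have h2 : expQuot |y * x| ≤ expQuot (y * x) + expQuot (-y * x) := by
      rcases abs_choice (y * x) with h | h <;> rw [h]
      · linarith [expQuot_nonneg (-y * x)]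
      · rw [neg_mul]; linarith [expQuot_nonneg (y * x)]
    rw [kolmogorovKernel_eq, kolmogorovKernel_eq, neg_sq, ← mul_add]
    refine le_trans (le_of_eq ?_) (mul_le_mul_of_nonneg_left (h1.trans h2) (sq_nonneg y))
    rw [Finset.mul_sum]
    refine Finset.sum_congr rfl fun j _ => ?_
    rw [hF, norm_mul, norm_div, norm_pow, norm_pow, Real.norm_eq_abs, Real.norm_eq_abs, sq_abs,
      Real.norm_of_nonneg (by positivity)]
  have hsum : Summable fun j => ∫ x, ‖F j x‖ ∂χ := by
    refine summable_of_sum_range_le (c := ∫ x, (kolmogorovKernel y x + kolmogorovKernel (-y) x) ∂χ)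
      (fun j => integral_nonneg fun x => norm_nonneg _) fun n => ?_
    rw [← integral_finsetSum _ fun j _ => (hFi j).norm]
    exact integral_mono (integrable_finsetSum _ fun j _ => (hFi j).norm) (hy.add hy') (hbound n)
  have h := hasSum_integral_of_summable_integral_norm hFi hsum
  simp only [hFeq] at h
  have htsum : (fun x => ∑' j, F j x) = kolmogorovKernel y := by
    ext x
    rw [kolmogorovKernel_eq]
    exact ((hasSum_expQuot (y * x)).mul_left (y ^ 2)).tsum_eq
  rwa [htsum] at h

/-! ### Self-decomposable laws identified by their moments -/

section Law

variable {μ : Measure ℝ} {K : PowerSeries ℝ}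

open PowerSeries in
theorem exists_isRootSequence [IsProbabilityMeasure μ] (hdet : IsMomentDeterminate μ)
    (h0 : constantCoeff K = 0)
    (hμK : momentSeries μ id = expOf K) (hsd : IsSelfDecomposable μ) :
    ∃ ρ, IsRootSequence μ K ρ := by
  choose ρ h1 h2 h3 h4 using fun l : ℕ =>
    exists_conv_root hdet h0 hμK hsd (n := l + 1) (by omega)
  exact ⟨ρ, h1, h2, h3, h4⟩

open PowerSeries in
theorem cumulant_two_eq (h0 : constantCoeff K = 0) (h1 : coeff 1 K = 0)
    (hμK : momentSeries μ id = expOf K) : cumulant K 2 = ∫ x, x ^ 2 ∂μ := by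
  have h := congrArg (coeff 2) hμK
  rw [coeff_two_expOf h0 h1, coeff_momentSeries] at h
  rw [cumulant, ← h]
  simp [Nat.factorial]
  ring

open PowerSeries in
/-- A measure with the moments `κ_{j + 2} / κ_2` is the Kolmogorov measure of `μ`, since the law
built from it has the moments of `μ`. -/
theorem charFun_eq_of_moments (hdet : IsMomentDeterminate μ)
    (h0 : constantCoeff K = 0)
    (h1 : coeff 1 K = 0) (hμK : momentSeries μ id = expOf K) (hq : 0 < cumulant K 2)
    {χ : Measure ℝ} [IsProbabilityMeasure χ] (hχ : HasMoments χ)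
    (hmom : ∀ j, ∫ x, x ^ j ∂χ = cumulant K (j + 2) / cumulant K 2) (u : ℝ) :
    charFun μ u = Complex.exp
      (cumulant K 2 * ∫ x, kolmogorovKernelC (u * Complex.I) x ∂χ) := by
  obtain ⟨ρ, hρp, hρm, hρs, hρc⟩ := exists_law_of_kolmogorov hχ hq.le
  have hE : (exponentSeries fun j => cumulant K 2 * ∫ x, x ^ (j - 2) ∂χ) = K := by
    refine Eq.trans ?_ (exponentSeries_cumulant h0 h1)
    ext j
    simp only [exponentSeries, coeff_mk]
    split_ifs with hj
    · rw [hmom, Nat.sub_add_cancel hj, mul_div_cancel₀ _ hq.ne']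
    · rfl
  rw [← hdet.eq_of_momentSeries_eq hρm (by rw [hρs, hE, hμK]), hρc]

open PowerSeries in
/-- All measures with these moments are the Kolmogorov measure of `μ`, which is unique. -/
theorem isMomentDeterminate_of_moments (hdet : IsMomentDeterminate μ)
    (h0 : constantCoeff K = 0)
    (h1 : coeff 1 K = 0) (hμK : momentSeries μ id = expOf K) (hq : 0 < cumulant K 2)
    {χ : Measure ℝ} [IsProbabilityMeasure χ] (hχ : HasMoments χ)
    (hmom : ∀ j, ∫ x, x ^ j ∂χ = cumulant K (j + 2) / cumulant K 2) :
    IsMomentDeterminate χ := by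
  refine ⟨hχ, fun ν hν hνm hνχ => ?_⟩
  apply eq_of_exp_integral_kolmogorovKernelC_eq hq
  intro u
  rw [← charFun_eq_of_moments hdet h0 h1 hμK hq hχ hmom,
    ← charFun_eq_of_moments hdet h0 h1 hμK hq hνm (fun j => by rw [hνχ, hmom])]

open PowerSeries in
theorem exists_kolmogorov_form [IsProbabilityMeasure μ] (hdet : IsMomentDeterminate μ)
    (h0 : constantCoeff K = 0)
    (h1 : coeff 1 K = 0) (hμK : momentSeries μ id = expOf K) (hsd : IsSelfDecomposable μ)
    (hq : 0 < cumulant K 2) :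
    ∃ χ : Measure ℝ, IsProbabilityMeasure χ ∧ IsMomentDeterminate χ ∧
      (∀ j, ∫ x, x ^ j ∂χ = cumulant K (j + 2) / cumulant K 2) ∧
      (∀ u : ℝ, charFun μ u = Complex.exp
        (cumulant K 2 * ∫ x, kolmogorovKernelC (u * Complex.I) x ∂χ)) ∧
      ∀ y : ℝ, Integrable (fun x => Real.exp (y * x)) μ → Integrable (kolmogorovKernel y) χ ∧
        ∫ x, Real.exp (y * x) ∂μ = Real.exp (cumulant K 2 * ∫ x, kolmogorovKernel y x ∂χ) := by
  obtain ⟨ρ, hρ⟩ := exists_isRootSequence hdet h0 hμK hsd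
  obtain ⟨χs, χ, φ, hχs, hφ, hχ, hχm, hmom⟩ := hρ.exists_kolmogorov_measure h0 h1 hq
  exact ⟨χ, inferInstance, isMomentDeterminate_of_moments hdet h0 h1 hμK hq hχm hmom, hmom,
    charFun_eq_of_moments hdet h0 h1 hμK hq hχm hmom,
    fun y hy => hρ.integral_exp_eq h0 h1 hq hχs hφ hχ hy⟩

open PowerSeries in
/-- The logarithm of the moment generating function is the sum of the cumulant series. -/
theorem hasSum_cumulants [IsProbabilityMeasure μ] (hdet : IsMomentDeterminate μ)
    (h0 : constantCoeff K = 0)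
    (h1 : coeff 1 K = 0) (hμK : momentSeries μ id = expOf K) (hsd : IsSelfDecomposable μ) {y : ℝ}
    (hy : Integrable (fun x => Real.exp (y * x)) μ)
    (hy' : Integrable (fun x => Real.exp (-y * x)) μ) :
    HasSum (fun j : ℕ => cumulant K (j + 2) * y ^ (j + 2) / ((j + 2).factorial : ℝ))
      (Real.log (∫ x, Real.exp (y * x) ∂μ)) := by
  have h2 := cumulant_two_eq h0 h1 hμK
  have hnn : 0 ≤ cumulant K 2 := by rw [h2]; exact integral_nonneg fun x => sq_nonneg x
  rcases hnn.eq_or_lt with hq | hq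
  · -- a degenerate law is concentrated at the origin and has no cumulants
    rw [h2] at hq
    have hae : ∀ᵐ x ∂μ, x = 0 := by
      have := (integral_eq_zero_iff_of_nonneg (fun x => sq_nonneg x) (hdet.1 2)).1 hq.symm
      filter_upwards [this] with x hx
      simpa using hx
    have hK : K = 0 := by
      refine expOf_injective h0 (by simp) ?_
      rw [← hμK, expOf_zero]
      ext n
      rw [coeff_momentSeries, coeff_one]
      have : ∫ x, id x ^ n ∂μ = ∫ _, (0 : ℝ) ^ n ∂μ := by
        refine integral_congr_ae ?_
        filter_upwards [hae] with x hx
        rw [hx, id]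
      rw [this]
      rcases eq_or_ne n 0 with rfl | hn
      · simp
      · simp [hn]
    have hexp : ∫ x, Real.exp (y * x) ∂μ = 1 := by
      have : ∫ x, Real.exp (y * x) ∂μ = ∫ _, (1 : ℝ) ∂μ := by
        refine integral_congr_ae ?_
        filter_upwards [hae] with x hx
        simp [hx]
      rw [this]
      simp
    rw [hexp, Real.log_one, hK]
    simp only [cumulant, map_zero, mul_zero, zero_mul, zero_div]
    exact hasSum_zero
  · obtain ⟨χ, hχp, hχd, hmom, -, hmgf⟩ := exists_kolmogorov_form hdet h0 h1 hμK hsd hq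
    obtain ⟨hk, hk'⟩ := hmgf y hy
    have h3 := (hasSum_moments_kolmogorovKernel hχd.1 hk (hmgf (-y) hy').1).mul_left (cumulant K 2)
    rw [hk', Real.log_exp]
    refine h3.congr_fun fun j => ?_
    rw [hmom]
    field_simp

end Law

/-! ### Matrices of Appell type and the generator -/

/-- The lower triangular matrix with entries `(i choose j) f_{i - j}`, where `F = ∑ f_k y ^ k / k!`.
It is the matrix of the multiplication by `F` with respect to the dual basis of the monomials. -/
noncomputable def appellMatrix (F : PowerSeries ℝ) (n : ℕ) :
    Matrix (Fin (n + 1)) (Fin (n + 1)) ℝ :=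
  Matrix.of fun i j => ((i : ℕ).factorial : ℝ) / ((j : ℕ).factorial : ℝ) *
    PowerSeries.coeff i (PowerSeries.X ^ (j : ℕ) * F)

open PowerSeries in
theorem appellMatrix_apply (F : PowerSeries ℝ) (n : ℕ) (i j : Fin (n + 1)) :
    appellMatrix F n i j = ((i : ℕ).factorial : ℝ) / ((j : ℕ).factorial : ℝ) *
      if (j : ℕ) ≤ i then coeff ((i : ℕ) - j) F else 0 := by
  rw [appellMatrix, Matrix.of_apply, coeff_X_pow_mul']

open PowerSeries in
theorem appellMatrix_mul (F G : PowerSeries ℝ) (n : ℕ) :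
    appellMatrix F n * appellMatrix G n = appellMatrix (F * G) n := by
  ext i k
  have h (j : Fin (n + 1)) : appellMatrix F n i j * appellMatrix G n j k =
      ((i : ℕ).factorial : ℝ) / ((k : ℕ).factorial : ℝ) *
        (coeff (i : ℕ) (X ^ (j : ℕ) * F) * coeff (j : ℕ) (X ^ (k : ℕ) * G)) := by
    have : ((j : ℕ).factorial : ℝ) ≠ 0 := by positivity
    simp only [appellMatrix, Matrix.of_apply]
    field_simp
  rw [Matrix.mul_apply, Finset.sum_congr rfl fun j _ => h j, ← Finset.mul_sum]
  conv_rhs => rw [appellMatrix, Matrix.of_apply]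
  congr 1
  rw [Fin.sum_univ_eq_sum_range (fun j => coeff (i : ℕ) (X ^ j * F) *
    coeff j (X ^ (k : ℕ) * G)) (n + 1)]
  have hsub : Finset.range ((i : ℕ) + 1) ⊆ Finset.range (n + 1) :=
    Finset.range_subset_range.2 (by omega)
  rw [← Finset.sum_subset hsub (fun j _ hj => by
    rw [coeff_X_pow_mul', if_neg (by simpa using hj), zero_mul])]
  have e : X ^ (k : ℕ) * (F * G) = (X ^ (k : ℕ) * G) * F := by ring
  rw [e, coeff_mul, Finset.Nat.sum_antidiagonal_eq_sum_range_succ_mk]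
  refine Finset.sum_congr rfl fun j hj => ?_
  rw [coeff_X_pow_mul', if_pos (by simpa [Nat.lt_succ_iff] using hj), mul_comm]

open PowerSeries in
theorem appellMatrix_one (n : ℕ) : appellMatrix 1 n = 1 := by
  ext i j
  rw [appellMatrix, Matrix.of_apply, mul_one, coeff_X_pow, Matrix.one_apply]
  by_cases h : i = j
  · subst h
    have : ((i : ℕ).factorial : ℝ) ≠ 0 := by positivity
    simp [this]
  · rw [if_neg h, if_neg (fun h' => h (Fin.ext h')), mul_zero]

open PowerSeries in
theorem diagonal_mul_appellMatrix (F : PowerSeries ℝ) (a : ℝ) (n : ℕ) :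
    Matrix.diagonal (fun i : Fin (n + 1) => a ^ (i : ℕ)) * appellMatrix F n =
      appellMatrix (rescale a F) n * Matrix.diagonal (fun i : Fin (n + 1) => a ^ (i : ℕ)) := by
  ext i j
  rw [Matrix.diagonal_mul, Matrix.mul_diagonal, appellMatrix_apply, appellMatrix_apply]
  split_ifs with h
  · rw [coeff_rescale]
    have : a ^ (i : ℕ) = a ^ ((i : ℕ) - j) * a ^ (j : ℕ) := by rw [← pow_add]; congr 1; omega
    rw [this]
    ring
  · simp

/-- The constants `d_0 = 1`, `d_j = - j κ_j` attached to the cumulants. -/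
noncomputable def structuralConst (K : PowerSeries ℝ) (j : ℕ) : ℝ :=
  if j = 0 then 1 else -(j * cumulant K j)

open PowerSeries in
/-- The generator is the sum of the degree operator and the multiplication by `-y K'(y)`. -/
theorem generatorMatrix_eq (K : PowerSeries ℝ) (n : ℕ) :
    generatorMatrix (structuralConst K) n =
      Matrix.diagonal (fun i : Fin (n + 1) => ((i : ℕ) : ℝ)) +
        appellMatrix (-(X * d⁄dX ℝ K)) n := by
  have hG (k : ℕ) : coeff k (-(X * d⁄dX ℝ K)) = -(k * coeff k K) := by
    cases k with
    | zero => simp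
    | succ k => rw [map_neg, coeff_succ_X_mul, coeff_derivative]; push_cast; ring
  ext i j
  rw [generatorMatrix, Matrix.of_apply, Matrix.add_apply, appellMatrix_apply]
  rcases lt_trichotomy i j with h | h | h
  · rw [if_pos h, if_neg (by simpa using h), Matrix.diagonal_apply_ne _ h.ne]
    simp
  · subst h
    rw [if_neg (lt_irrefl i), if_pos rfl, if_pos le_rfl, Matrix.diagonal_apply_eq, hG]
    simp [structuralConst]
  · have hij : (j : ℕ) ≤ i := by exact_mod_cast h.le
    have hij' : (j : ℕ) < i := by exact_mod_cast h
    rw [if_neg h.not_gt, if_neg h.ne', if_pos hij, Matrix.diagonal_apply_ne _ h.ne', hG,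
      structuralConst, if_neg (by omega), cumulant, Nat.cast_choose ℝ hij]
    have : (((i : ℕ) - (j : ℕ)).factorial : ℝ) ≠ 0 := by positivity
    field_simp
    ring

open PowerSeries in
theorem generatorMatrix_mul_appellMatrix {K : PowerSeries ℝ} (h0 : constantCoeff K = 0) (n : ℕ) :
    generatorMatrix (structuralConst K) n * appellMatrix (expOf K) n =
      appellMatrix (expOf K) n * Matrix.diagonal (fun i : Fin (n + 1) => ((i : ℕ) : ℝ)) := by
  have h : -(X * d⁄dX ℝ K) * expOf K = -(X * d⁄dX ℝ (expOf K)) := by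
    rw [derivative_expOf h0]; ring
  rw [generatorMatrix_eq, add_mul, appellMatrix_mul, h]
  ext i j
  rw [Matrix.add_apply, Matrix.diagonal_mul, Matrix.mul_diagonal, appellMatrix_apply,
    appellMatrix_apply]
  split_ifs with hij
  · have hG (k : ℕ) : coeff k (-(X * d⁄dX ℝ (expOf K))) = -(k * coeff k (expOf K)) := by
      cases k with
      | zero => simp
      | succ k => rw [map_neg, coeff_succ_X_mul, coeff_derivative]; push_cast; ring
    rw [hG, Nat.cast_sub hij]
    ring
  · simp

open PowerSeries in
/-- Both `exp (-τ W)` and the matrix with entries `(i choose j) a ^ j N_{i - j}`, `a = e ^ (-τ)`,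
are conjugate to `diag (a ^ i)` by the Appell matrix of the moments. -/
theorem exp_neg_smul_generatorMatrix {K : PowerSeries ℝ} (h0 : constantCoeff K = 0) (n : ℕ)
    (τ : ℝ) :
    NormedSpace.exp ((-τ) • generatorMatrix (structuralConst K) n) =
      appellMatrix (expOf (K - rescale (Real.exp (-τ)) K)) n *
        Matrix.diagonal (fun i : Fin (n + 1) => Real.exp (-τ) ^ (i : ℕ)) := by
  set a := Real.exp (-τ) with ha
  set M := expOf K with hM
  have hMc : constantCoeff M ≠ 0 := by rw [hM, constantCoeff_expOf h0]; exact one_ne_zero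
  set U := appellMatrix M n with hU
  have hUinv : U * appellMatrix M⁻¹ n = 1 := by
    rw [hU, appellMatrix_mul, PowerSeries.mul_inv_cancel _ hMc, appellMatrix_one]
  have hUu : IsUnit U := IsUnit.of_mul_eq_one _ hUinv
  have hdet : IsUnit U.det := (Matrix.isUnit_iff_isUnit_det U).1 hUu
  have hW : generatorMatrix (structuralConst K) n =
      U * Matrix.diagonal (fun i : Fin (n + 1) => ((i : ℕ) : ℝ)) * U⁻¹ := by
    rw [← generatorMatrix_mul_appellMatrix h0, Matrix.mul_assoc, Matrix.mul_nonsing_inv _ hdet,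
      Matrix.mul_one]
  have hdiag : NormedSpace.exp ((-τ) • Matrix.diagonal (fun i : Fin (n + 1) => ((i : ℕ) : ℝ))) =
      Matrix.diagonal (fun i : Fin (n + 1) => a ^ (i : ℕ)) := by
    rw [← Matrix.diagonal_smul, Matrix.exp_diagonal]
    congr 1
    ext i
    rw [Pi.coe_exp, ← Real.exp_eq_exp_ℝ, ha, ← Real.exp_nat_mul]
    congr 1
    simp [mul_comm]
  have hR := constantCoeff_rescale_eq_zero h0 a
  have hN : expOf (K - rescale a K) * rescale a M = M := by
    rw [hM, rescale_expOf h0, ← expOf_add (by simp [h0, hR]) hR]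
    congr 1
    ring
  have h1 : appellMatrix (expOf (K - rescale a K)) n *
      Matrix.diagonal (fun i : Fin (n + 1) => a ^ (i : ℕ)) * U =
      U * Matrix.diagonal (fun i : Fin (n + 1) => a ^ (i : ℕ)) := by
    rw [Matrix.mul_assoc, hU, diagonal_mul_appellMatrix, ← Matrix.mul_assoc, appellMatrix_mul, hN]
  have h2 : (-τ) • generatorMatrix (structuralConst K) n =
      U * ((-τ) • Matrix.diagonal (fun i : Fin (n + 1) => ((i : ℕ) : ℝ))) * U⁻¹ := by
    rw [hW, Matrix.mul_smul, Matrix.smul_mul]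
  rw [h2, Matrix.exp_conj _ _ hUu, hdiag, ← h1, Matrix.mul_assoc _ U, Matrix.mul_nonsing_inv _ hdet,
    Matrix.mul_one]

/-! ### Moments of the process and the regression coefficient -/

open Filter Topology in
/-- A multiplicative function on the positive half-line, with limit `1` at `0`, is exponential. -/
theorem eq_exp_of_mul {r : ℝ → ℝ} (hmul : ∀ x y, 0 < x → 0 < y → r (x + y) = r x * r y)
    (h1 : r 1 = Real.exp (-1)) (h0 : Tendsto r (𝓝[>] 0) (𝓝 1)) {x : ℝ} (hx : 0 < x) :
    r x = Real.exp (-x) := by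
  have hhalf (x : ℝ) (hx : 0 < x) : r x = r (x / 2) ^ 2 := by
    have := hmul (x / 2) (x / 2) (by positivity) (by positivity)
    rw [add_halves] at this
    rw [this, sq]
  have hne (x : ℝ) (hx : 0 < x) : r x ≠ 0 := by
    intro h
    have hz (n : ℕ) : r (x / 2 ^ n) = 0 := by
      induction n with
      | zero => simpa using h
      | succ n ih =>
        have h2 := hhalf (x / 2 ^ n) (by positivity)
        rw [ih, div_div, ← pow_succ] at h2
        exact pow_eq_zero_iff (two_ne_zero) |>.1 h2.symm
    have hlim : Tendsto (fun n : ℕ => x / 2 ^ n) atTop (𝓝[>] 0) := by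
      refine tendsto_nhdsWithin_iff.2 ⟨?_, .of_forall fun n => ?_⟩
      · exact tendsto_const_nhds.div_atTop (tendsto_pow_atTop_atTop_of_one_lt one_lt_two)
      · have : 0 < x / 2 ^ n := by positivity
        exact this
    have h3 := h0.comp hlim
    have h4 : (r ∘ fun n : ℕ => x / 2 ^ n) = fun _ => 0 := funext hz
    rw [h4] at h3
    exact zero_ne_one (tendsto_nhds_unique tendsto_const_nhds h3)
  have hpos (x : ℝ) (hx : 0 < x) : 0 < r x := by
    rw [hhalf x hx]
    have := hne (x / 2) (by positivity)
    positivity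
  set g : ℝ → ℝ := fun x => Real.log (r x) + x with hg
  have hadd (x y : ℝ) (hx : 0 < x) (hy : 0 < y) : g (x + y) = g x + g y := by
    simp only [hg]
    rw [hmul x y hx hy, Real.log_mul (hne x hx) (hne y hy)]
    ring
  have hnat (n : ℕ) (x : ℝ) (hx : 0 < x) : g ((n + 1 : ℕ) * x) = (n + 1 : ℕ) * g x := by
    induction n with
    | zero => simp
    | succ n ih =>
      have : ((n + 1 + 1 : ℕ) : ℝ) * x = (n + 1 : ℕ) * x + x := by push_cast; ring
      rw [this, hadd _ _ (by positivity) hx, ih]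
      push_cast
      ring
  have hg1 : g 1 = 0 := by simp only [hg]; rw [h1, Real.log_exp]; ring
  have hrat (q : ℚ) (hq : 0 < q) : g q = 0 := by
    obtain ⟨m, hm⟩ : ∃ m : ℕ, q.num = (m + 1 : ℕ) :=
      ⟨(q.num - 1).toNat, by have := Rat.num_pos.2 hq; omega⟩
    obtain ⟨k, hk⟩ : ∃ k : ℕ, q.den = k + 1 := ⟨q.den - 1, by have := q.den_pos; omega⟩
    have hqe : ((k + 1 : ℕ) : ℝ) * (q : ℝ) = (m + 1 : ℕ) * 1 := by
      have := Rat.den_mul_eq_num q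
      rw [hk, hm] at this
      rw [mul_one]
      exact_mod_cast this
    have h2 := hnat k q (by exact_mod_cast hq)
    rw [hqe, hnat m 1 one_pos, hg1, mul_zero] at h2
    have hk0 : ((k + 1 : ℕ) : ℝ) ≠ 0 := by positivity
    exact (mul_eq_zero.1 h2.symm).resolve_left hk0
  have hlim : Tendsto g (𝓝[>] 0) (𝓝 0) := by
    have := (h0.log one_ne_zero).add (tendsto_nhdsWithin_of_tendsto_nhds tendsto_id :
      Tendsto (fun x : ℝ => x) (𝓝[>] 0) (𝓝 0))
    rwa [Real.log_one, add_zero] at this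
  have hgx : g x = 0 := by
    by_contra hgx
    have hev := (hlim.eventually (Metric.ball_mem_nhds 0 (abs_pos.2 hgx)))
    rw [eventually_nhdsWithin_iff, Metric.eventually_nhds_iff] at hev
    obtain ⟨δ, hδ, hev⟩ := hev
    obtain ⟨q, hq1, hq2⟩ := exists_rat_btwn (lt_add_of_pos_right x hδ)
    have h2 := hev (y := q - x) (by rw [Real.dist_eq, sub_zero, abs_of_pos (by linarith)]; linarith)
      (by simpa using hq1)
    have h3 := hadd x (q - x) hx (by linarith)
    rw [add_sub_cancel, hrat q (by exact_mod_cast hx.trans hq1)] at h3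
    have h4 : g (q - x) = -g x := by linarith
    simp only [Real.dist_eq, sub_zero, h4, abs_neg] at h2
    exact lt_irrefl _ h2
  have : Real.log (r x) = -x := by simp only [hg] at hgx; linarith
  rw [← this, Real.exp_log (hpos x hx)]

section StationaryProcess

theorem stronglyMeasurable_pastSigma {Ω : Type*} (X : ℝ → Ω → ℝ) {r s : ℝ} (h : r ≤ s) :
    StronglyMeasurable[pastSigma X s] (X r) := by
  have : Measurable[pastSigma X s] (X r) :=
    measurable_iff_comap_le.2 (le_iSup (fun r : Set.Iic s =>
      MeasurableSpace.comap (X r) (inferInstance : MeasurableSpace ℝ)) ⟨r, h⟩)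
  exact this.stronglyMeasurable

variable {Ω : Type*} [mΩ : MeasurableSpace Ω] {P : Measure Ω} {X : ℝ → Ω → ℝ}
  {γ : ℕ → ℕ → ℝ → ℝ}

theorem pastSigma_le (hX : ∀ t, Measurable (X t)) (s : ℝ) : pastSigma X s ≤ mΩ :=
  iSup_le fun r => (hX r).comap_le

theorem IsSMPR.integrable_pow (hX : IsSMPR P X γ) (t : ℝ) (n : ℕ) :
    Integrable (fun ω => X t ω ^ n) P := by
  have h : HasMoments (P.map (X t)) := by rw [hX.stationary t]; exact hX.determinate.1
  exact (hasMoments_map_iff (hX.measurable t)).1 h n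

theorem IsSMPR.integral_pow (hX : IsSMPR P X γ) (t : ℝ) (n : ℕ) :
    ∫ ω, X t ω ^ n ∂P = ∫ ω, X 0 ω ^ n ∂P := by
  have h (t : ℝ) : ∫ ω, X t ω ^ n ∂P = ∫ x, x ^ n ∂(P.map (X t)) := by
    rw [integral_map (hX.measurable t).aemeasurable (by fun_prop)]
  rw [h, h, hX.stationary]

theorem integrable_pow_mul_pow {Y Z : Ω → ℝ} (hY : Measurable Y) (hZ : Measurable Z)
    (hYi : ∀ n : ℕ, Integrable (fun ω => Y ω ^ n) P)
    (hZi : ∀ n : ℕ, Integrable (fun ω => Z ω ^ n) P) (i j : ℕ) :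
    Integrable (fun ω => Y ω ^ i * Z ω ^ j) P := by
  refine ((hYi (2 * i)).add (hZi (2 * j))).mono' (by fun_prop) (.of_forall fun ω => ?_)
  rw [norm_mul, Real.norm_eq_abs, Real.norm_eq_abs, Pi.add_apply, pow_mul', pow_mul',
    ← sq_abs (Y ω ^ i), ← sq_abs (Z ω ^ j)]
  nlinarith [sq_nonneg (|Y ω ^ i| - |Z ω ^ j|), abs_nonneg (Y ω ^ i), abs_nonneg (Z ω ^ j)]

/-- Pull-out property: a `𝓕_{≤ s}`-measurable factor sees only the conditional expectation. -/
theorem integral_mul_eq_of_condExp_eq [IsProbabilityMeasure P] (hX : ∀ t, Measurable (X t)) {s : ℝ}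
    {f g h : Ω → ℝ} (hf : StronglyMeasurable[pastSigma X s] f)
    (hfg : Integrable (fun ω => f ω * g ω) P) (hg : Integrable g P)
    (hc : P[g | pastSigma X s] =ᵐ[P] h) : ∫ ω, f ω * g ω ∂P = ∫ ω, f ω * h ω ∂P := by
  rw [← integral_condExp (pastSigma_le hX s) (f := fun ω => f ω * g ω)]
  refine integral_congr_ae ?_
  filter_upwards [condExp_mul_of_stronglyMeasurable_left hf hfg hg, hc] with ω h1 h2
  have h1' : (P[fun ω => f ω * g ω | pastSigma X s]) ω = f ω * (P[g | pastSigma X s]) ω := h1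
  rw [h1', h2]

/-- The increment `X_t - e ^ (-(t - s)) X_s`. -/
noncomputable def increment (X : ℝ → Ω → ℝ) (s t : ℝ) (ω : Ω) : ℝ :=
  X t ω - Real.exp (-(t - s)) * X s ω

theorem IsSMPR.measurable_increment (hX : IsSMPR P X γ) (s t : ℝ) :
    Measurable (increment X s t) :=
  (hX.measurable t).sub ((hX.measurable s).const_mul _)

theorem IsSMPR.integrable_increment_pow (hX : IsSMPR P X γ) (s t : ℝ) (n : ℕ) :
    Integrable (fun ω => increment X s t ω ^ n) P := by
  simp only [increment, sub_eq_add_neg (X t _) _, add_pow]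
  refine integrable_finsetSum _ fun m _ => Integrable.mul_const ?_ _
  have := (integrable_pow_mul_pow (hX.measurable t) (hX.measurable s) (hX.integrable_pow t)
    (hX.integrable_pow s) m (n - m)).mul_const ((-Real.exp (-(t - s))) ^ (n - m))
  refine this.congr (.of_forall fun ω => ?_)
  simp only [← neg_mul, mul_pow, mul_assoc, mul_comm (X s ω ^ (n - m))]

variable [IsProbabilityMeasure P]

open Filter Topology in
/-- The linear regression `E(X_t | 𝓕_{≤ s}) = e ^ (-(t - s)) X_s`: the correlation function is
multiplicative and continuous at `0`, and time is scaled so that it is `e ^ (-1)` at `1`. -/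
theorem IsSMPR.condExp_eq (hX : IsSMPR P X γ) (hmean : ∀ t, ∫ ω, X t ω ∂P = 0)
    (hscale : P[X 1 | pastSigma X 0] =ᵐ[P] fun ω => Real.exp (-1) * X 0 ω) {s t : ℝ}
    (hst : s < t) :
    P[X t | pastSigma X s] =ᵐ[P] fun ω => Real.exp (-(t - s)) * X s ω := by
  have hi (t : ℝ) : Integrable (X t) P := by simpa using hX.integrable_pow t 1
  have hi2 (u t : ℝ) : Integrable (fun ω => X u ω * X t ω) P := by
    simpa using integrable_pow_mul_pow (hX.measurable u) (hX.measurable t) (hX.integrable_pow u)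
      (hX.integrable_pow t) 1 1
  rcases eq_or_ne (∫ ω, X 0 ω ^ 2 ∂P) 0 with hq | hq
  · -- a degenerate process vanishes
    have hz (t : ℝ) : X t =ᵐ[P] fun _ => 0 := by
      have h1 := hX.integral_pow t 2
      rw [hq] at h1
      have h2 := (integral_eq_zero_iff_of_nonneg (fun ω => sq_nonneg (X t ω))
        (hX.integrable_pow t 2)).1 h1
      filter_upwards [h2] with ω hω
      simpa using hω
    refine (condExp_congr_ae (hz t)).trans ?_
    have h0 : P[(fun _ => (0 : ℝ)) | pastSigma X s] = 0 := condExp_zero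
    rw [h0]
    filter_upwards [hz s] with ω hω
    simp [hω]
  -- the constant term of the regression vanishes since the means do
  have hreg {s t : ℝ} (hst : s < t) :
      P[X t | pastSigma X s] =ᵐ[P] fun ω => γ 1 1 (t - s) * X s ω := by
    have h1 := hX.regression 1 s t hst
    simp only [pow_one, Finset.sum_range_succ, Finset.sum_range_zero, pow_zero, mul_one,
      zero_add] at h1
    have h2 := integral_congr_ae h1
    rw [integral_condExp (pastSigma_le hX.measurable s), hmean,
      integral_add (integrable_const _) ((hi s).const_mul _), integral_const_mul, hmean] at h2
    simp at h2
    rw [← h2] at h1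
    simpa using h1
  have hcorr {u s t : ℝ} (hus : u ≤ s) (hst : s < t) :
      ∫ ω, X u ω * X t ω ∂P = γ 1 1 (t - s) * ∫ ω, X u ω * X s ω ∂P := by
    rw [integral_mul_eq_of_condExp_eq hX.measurable (stronglyMeasurable_pastSigma X hus)
      (hi2 u t) (hi t) (hreg hst), ← integral_const_mul]
    refine integral_congr_ae (.of_forall fun ω => ?_)
    simp only
    ring
  have hq' (s : ℝ) : ∫ ω, X s ω * X s ω ∂P = ∫ ω, X 0 ω ^ 2 ∂P := by
    rw [← hX.integral_pow s 2]; simp only [sq]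
  have hr {s t : ℝ} (hst : s < t) :
      ∫ ω, X s ω * X t ω ∂P = γ 1 1 (t - s) * ∫ ω, X 0 ω ^ 2 ∂P := by
    rw [hcorr le_rfl hst, hq']
  have hexp : γ 1 1 (t - s) = Real.exp (-(t - s)) := by
    refine eq_exp_of_mul (r := γ 1 1) (fun x y hx hy => ?_) ?_ ?_ (sub_pos.2 hst)
    · have h1 := hcorr (u := 0) hx.le (by linarith : x < x + y)
      rw [hr (by linarith), hr hx, sub_zero, sub_zero, add_sub_cancel_left] at h1
      apply mul_right_cancel₀ hq
      rw [h1]; ring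
    · have h1 := integral_mul_eq_of_condExp_eq hX.measurable
        (stronglyMeasurable_pastSigma X le_rfl) (hi2 0 1) (hi 1) hscale
      have h2 : ∫ ω, X 0 ω * (Real.exp (-1) * X 0 ω) ∂P =
          Real.exp (-1) * ∫ ω, X 0 ω ^ 2 ∂P := by
        rw [← integral_const_mul]
        refine integral_congr_ae (.of_forall fun ω => ?_)
        simp only
        ring
      rw [hr one_pos, h2, sub_zero] at h1
      exact mul_right_cancel₀ hq h1
    · have h1 := (hX.msc 1 1 0).tendsto
      simp only [pow_one] at h1
      rw [hq'] at h1
      have h2 := (h1.div_const (∫ ω, X 0 ω ^ 2 ∂P)).mono_left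
        (nhdsWithin_le_nhds : 𝓝[>] (0 : ℝ) ≤ 𝓝 0)
      rw [div_self hq] at h2
      refine h2.congr' ?_
      filter_upwards [self_mem_nhdsWithin] with t ht
      have h3 := hr (show (0 : ℝ) < t from ht)
      rw [sub_zero] at h3
      rw [div_eq_iff hq, ← h3]
      simp only [mul_comm]
  rw [← hexp]
  exact hreg hst

/-- Independent regression: the conditional moments of the increment are its moments. -/
theorem IsSMPR.condExp_increment_pow (hX : IsSMPR P X γ) (hind : HasIndependentRegression P X)
    (hmean : ∀ t, ∫ ω, X t ω ∂P = 0)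
    (hscale : P[X 1 | pastSigma X 0] =ᵐ[P] fun ω => Real.exp (-1) * X 0 ω) {s t : ℝ}
    (hst : s < t) (j : ℕ) :
    P[fun ω => increment X s t ω ^ j | pastSigma X s] =ᵐ[P]
      fun _ => ∫ ω, increment X s t ω ^ j ∂P := by
  rcases Nat.eq_zero_or_pos j with rfl | hj
  · simp only [pow_zero]
    rw [condExp_const (pastSigma_le hX.measurable s)]
    simp
  obtain ⟨c, hc⟩ := hind s t hst j hj
  have h1 : (fun ω => (X t ω - (P[X t | pastSigma X s]) ω) ^ j) =ᵐ[P]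
      fun ω => increment X s t ω ^ j := by
    filter_upwards [hX.condExp_eq hmean hscale hst] with ω hω
    rw [hω, increment]
  have h2 := (condExp_congr_ae h1 (m := pastSigma X s)).symm.trans hc
  have h3 := integral_congr_ae h2
  rw [integral_condExp (pastSigma_le hX.measurable s)] at h3
  simp at h3
  rw [h3]
  exact h2

theorem IsSMPR.integral_pow_mul_increment_pow (hX : IsSMPR P X γ)
    (hind : HasIndependentRegression P X) (hmean : ∀ t, ∫ ω, X t ω ∂P = 0)
    (hscale : P[X 1 | pastSigma X 0] =ᵐ[P] fun ω => Real.exp (-1) * X 0 ω) {s t : ℝ}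
    (hst : s < t) (i j : ℕ) :
    ∫ ω, X s ω ^ i * increment X s t ω ^ j ∂P =
      (∫ ω, X s ω ^ i ∂P) * ∫ ω, increment X s t ω ^ j ∂P := by
  rw [integral_mul_eq_of_condExp_eq hX.measurable (f := fun ω => X s ω ^ i)
    ((stronglyMeasurable_pastSigma X le_rfl).pow i)
    (integrable_pow_mul_pow (hX.measurable s) (hX.measurable_increment s t) (hX.integrable_pow s)
      (hX.integrable_increment_pow s t) i j) (hX.integrable_increment_pow s t j)
    (hX.condExp_increment_pow hind hmean hscale hst j), integral_mul_const]

/-- The stationary law is the convolution of its dilation by `e ^ (-(t - s))` and the law of the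
increment, since both sides have the same moments. -/
theorem IsSMPR.conv_increment (hX : IsSMPR P X γ) (hind : HasIndependentRegression P X)
    (hmean : ∀ t, ∫ ω, X t ω ∂P = 0)
    (hscale : P[X 1 | pastSigma X 0] =ᵐ[P] fun ω => Real.exp (-1) * X 0 ω) {s t : ℝ}
    (hst : s < t) :
    ((P.map (X 0)).map (Real.exp (-(t - s)) * ·)).conv (P.map (increment X s t)) =
      P.map (X 0) := by
  set a := Real.exp (-(t - s)) with ha
  have hε := hX.measurable_increment s t
  have : IsProbabilityMeasure (P.map (X 0)) :=
    Measure.isProbabilityMeasure_map (hX.measurable 0).aemeasurable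
  have : IsProbabilityMeasure ((P.map (X 0)).map (a * ·)) :=
    Measure.isProbabilityMeasure_map (by fun_prop)
  have : IsProbabilityMeasure (P.map (increment X s t)) :=
    Measure.isProbabilityMeasure_map hε.aemeasurable
  have hm1 : HasMoments ((P.map (X 0)).map (a * ·)) := HasMoments.map_mul hX.determinate.1 a
  have hm2 : HasMoments (P.map (increment X s t)) :=
    (hasMoments_map_iff hε).2 (hX.integrable_increment_pow s t)
  refine hX.determinate.eq_of_momentSeries_eq (hm1.conv hm2) ?_
  have hsum : (fun ω => a * X s ω + increment X s t ω) = X t := by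
    ext ω; simp only [increment, ha]; ring
  have hXs : Measurable fun ω => a * X s ω := (hX.measurable s).const_mul a
  have hmap : (P.map (X s)).map (a * ·) = P.map (fun ω => a * X s ω) :=
    Measure.map_map (by fun_prop) (hX.measurable s)
  rw [momentSeries_conv hm1 hm2, ← hX.stationary s, hmap, momentSeries_map _ hXs,
    momentSeries_map _ hε, hX.stationary s, ← hX.stationary t,
    momentSeries_map _ (hX.measurable t), ← momentSeries_add (fun i j => ?_) (fun i j => ?_),
    hsum]
  · simp only [mul_pow, mul_assoc]
    exact (integrable_pow_mul_pow (hX.measurable s) hε (hX.integrable_pow s)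
      (hX.integrable_increment_pow s t) i j).const_mul _
  · simp only [mul_pow, mul_assoc, integral_const_mul,
      hX.integral_pow_mul_increment_pow hind hmean hscale hst]

end StationaryProcess

/-! ### Self-decomposability and the regression polynomials -/

section Regression

variable {Ω : Type*} [mΩ : MeasurableSpace Ω] {P : Measure Ω} [IsProbabilityMeasure P]
  {X : ℝ → Ω → ℝ} {γ : ℕ → ℕ → ℝ → ℝ}

theorem IsSMPR.isProbabilityMeasure_law (hX : IsSMPR P X γ) : IsProbabilityMeasure (P.map (X 0)) :=
  Measure.isProbabilityMeasure_map (hX.measurable 0).aemeasurable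

theorem IsSMPR.isSelfDecomposable (hX : IsSMPR P X γ) (hind : HasIndependentRegression P X)
    (hmean : ∀ t, ∫ ω, X t ω ∂P = 0)
    (hscale : P[X 1 | pastSigma X 0] =ᵐ[P] fun ω => Real.exp (-1) * X 0 ω) :
    IsSelfDecomposable (P.map (X 0)) := by
  intro a ha0 ha1
  have hτ : 0 < -Real.log a := neg_pos.2 (Real.log_neg ha0 ha1)
  have h := hX.conv_increment hind hmean hscale hτ
  rw [sub_zero, neg_neg, Real.exp_log ha0] at h
  exact ⟨_, Measure.isProbabilityMeasure_map (hX.measurable_increment _ _).aemeasurable,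
    (hasMoments_map_iff (hX.measurable_increment _ _)).2 (hX.integrable_increment_pow _ _), h⟩

open PowerSeries in
theorem IsSMPR.momentSeries_increment (hX : IsSMPR P X γ) (hind : HasIndependentRegression P X)
    (hmean : ∀ t, ∫ ω, X t ω ∂P = 0)
    (hscale : P[X 1 | pastSigma X 0] =ᵐ[P] fun ω => Real.exp (-1) * X 0 ω)
    {K : PowerSeries ℝ} (h0 : constantCoeff K = 0) (hK : momentSeries P (X 0) = expOf K) {s t : ℝ}
    (hst : s < t) :
    momentSeries P (increment X s t) = expOf (K - rescale (Real.exp (-(t - s))) K) := by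
  have := hX.isProbabilityMeasure_law
  have hε := hX.measurable_increment s t
  have : IsProbabilityMeasure (P.map (increment X s t)) :=
    Measure.isProbabilityMeasure_map hε.aemeasurable
  rw [← momentSeries_map P hε]
  refine momentSeries_cofactor hX.determinate.1
    ((hasMoments_map_iff hε).2 (hX.integrable_increment_pow s t)) h0 ?_
    (hX.conv_increment hind hmean hscale hst)
  rw [momentSeries_map P (hX.measurable 0), hK]

/-- The regression polynomials are `∑_j (i choose j) (a x) ^ j E(ε ^ (i - j))`, where `ε` is the
increment and `a = e ^ (-τ)`. -/
theorem IsSMPR.condExp_pow_eq (hX : IsSMPR P X γ) (hind : HasIndependentRegression P X)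
    (hmean : ∀ t, ∫ ω, X t ω ∂P = 0)
    (hscale : P[X 1 | pastSigma X 0] =ᵐ[P] fun ω => Real.exp (-1) * X 0 ω) {s t : ℝ}
    (hst : s < t) (i : ℕ) :
    P[fun ω => X t ω ^ i | pastSigma X s] =ᵐ[P] fun ω => ∑ j ∈ Finset.range (i + 1),
      (Real.exp (-(t - s)) * X s ω) ^ j * (∫ ω, increment X s t ω ^ (i - j) ∂P) *
        (i.choose j : ℝ) := by
  set a := Real.exp (-(t - s)) with ha
  have hint (j : ℕ) :
      Integrable (fun ω => (a * X s ω) ^ j * (i.choose j : ℝ) * increment X s t ω ^ (i - j)) P := by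
    have := (integrable_pow_mul_pow (hX.measurable s) (hX.measurable_increment s t)
      (hX.integrable_pow s) (hX.integrable_increment_pow s t) j (i - j)).const_mul
      (a ^ j * (i.choose j : ℝ))
    refine this.congr (.of_forall fun ω => ?_)
    simp only [mul_pow]
    ring
  have hexpand : (fun ω => X t ω ^ i) = ∑ j ∈ Finset.range (i + 1),
      fun ω => (a * X s ω) ^ j * (i.choose j : ℝ) * increment X s t ω ^ (i - j) := by
    ext ω
    have : X t ω = a * X s ω + increment X s t ω := by simp only [increment, ha]; ring
    rw [Finset.sum_apply, this, add_pow]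
    exact Finset.sum_congr rfl fun j _ => by ring
  rw [hexpand]
  refine (condExp_finsetSum (fun j _ => hint j) _).trans ?_
  have hterm (j : ℕ) :
      P[fun ω => (a * X s ω) ^ j * (i.choose j : ℝ) * increment X s t ω ^ (i - j) | pastSigma X s]
        =ᵐ[P] fun ω => (a * X s ω) ^ j * (∫ ω, increment X s t ω ^ (i - j) ∂P) *
          (i.choose j : ℝ) := by
    have hsm : StronglyMeasurable[pastSigma X s] fun ω => (a * X s ω) ^ j * (i.choose j : ℝ) :=
      (((stronglyMeasurable_pastSigma X le_rfl).const_mul a).pow j).mul_const _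
    filter_upwards [condExp_mul_of_stronglyMeasurable_left hsm (hint j)
      (hX.integrable_increment_pow s t (i - j)),
      hX.condExp_increment_pow hind hmean hscale hst (i - j)] with ω h1 h2
    refine Eq.trans h1 ?_
    rw [Pi.mul_apply, h2]
    ring
  filter_upwards [ae_all_iff.2 hterm] with ω hω
  rw [Finset.sum_apply]
  exact Finset.sum_congr rfl fun j _ => hω j

open Polynomial in
/-- A polynomial with fewer than `#supp μ` roots that vanishes almost surely is zero. -/
theorem eq_zero_of_ae_eval_eq_zero {μ : Measure ℝ} {p : ℝ[X]} {n : ℕ} (hp : p.natDegree ≤ n)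
    (hn : (n : ℕ∞) < μ.support.encard) (h : ∀ᵐ x ∂μ, p.eval x = 0) : p = 0 := by
  by_contra hp0
  have hsub : μ.support ⊆ {x | p.eval x = 0} :=
    Measure.support_subset_of_isClosed (isClosed_eq p.continuous continuous_const) h
  have hroots : {x | p.eval x = 0} ⊆ (p.roots.toFinset : Set ℝ) := by
    intro x hx
    simpa [hp0] using hx
  have h1 := Set.encard_le_encard (hsub.trans hroots)
  rw [Set.encard_coe_eq_coe_finsetCard] at h1
  have h2 : p.roots.toFinset.card ≤ n :=
    (Multiset.toFinset_card_le _).trans ((Polynomial.card_roots' p).trans hp)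
  exact absurd (hn.trans_le (h1.trans (by exact_mod_cast h2))) (lt_irrefl _)

open Polynomial in
/-- Below the number of points of the support, the regression coefficients are unique. -/
theorem IsSMPR.regression_coeff_eq (hX : IsSMPR P X γ) (hind : HasIndependentRegression P X)
    (hmean : ∀ t, ∫ ω, X t ω ∂P = 0)
    (hscale : P[X 1 | pastSigma X 0] =ᵐ[P] fun ω => Real.exp (-1) * X 0 ω) {i : ℕ}
    (hi : (i : ℕ∞) < supportCard P X) {τ : ℝ} (hτ : 0 < τ) {j : ℕ} (hj : j ≤ i) :
    γ i j τ = Real.exp (-τ) ^ j * (∫ ω, increment X 0 τ ω ^ (i - j) ∂P) * (i.choose j : ℝ) := by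
  set c : ℕ → ℝ := fun j =>
    Real.exp (-τ) ^ j * (∫ ω, increment X 0 τ ω ^ (i - j) ∂P) * (i.choose j : ℝ) with hc
  set p : ℝ[X] := ∑ j ∈ Finset.range (i + 1), C (γ i j τ - c j) * Polynomial.X ^ j with hp
  have hdeg : p.natDegree ≤ i := by
    refine natDegree_sum_le_of_forall_le _ _ fun j hj => ?_
    exact (natDegree_C_mul_X_pow_le _ _).trans (by simpa [Nat.lt_succ_iff] using hj)
  have hae : ∀ᵐ x ∂(P.map (X 0)), p.eval x = 0 := by
    rw [ae_map_iff (hX.measurable 0).aemeasurable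
      (measurableSet_eq_fun p.continuous.measurable measurable_const)]
    filter_upwards [hX.regression i 0 τ hτ, hX.condExp_pow_eq hind hmean hscale hτ i] with ω h1 h2
    rw [h1, sub_zero] at h2
    rw [hp, eval_finsetSum]
    simp only [eval_mul, eval_C, eval_pow, eval_X, sub_mul, Finset.sum_sub_distrib]
    rw [h2, sub_eq_zero]
    exact Finset.sum_congr rfl fun j _ => by rw [hc]; ring
  have hzero := eq_zero_of_ae_eval_eq_zero hdeg hi hae
  have hco := congrArg (fun q => coeff q j) hzero
  simp only [hp, finsetSum_coeff, coeff_C_mul_X_pow, coeff_zero] at hco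
  rw [Finset.sum_ite_eq, if_pos (Finset.mem_range.2 (by omega))] at hco
  linarith

theorem IsSMPR.structuralMatrix_eq (hX : IsSMPR P X γ) (hind : HasIndependentRegression P X)
    (hmean : ∀ t, ∫ ω, X t ω ∂P = 0)
    (hscale : P[X 1 | pastSigma X 0] =ᵐ[P] fun ω => Real.exp (-1) * X 0 ω)
    {n : ℕ} (hn : (n : ℕ∞) < supportCard P X) {τ : ℝ} (hτ : 0 < τ) :
    structuralMatrix γ n τ = appellMatrix (momentSeries P (increment X 0 τ)) n *
      Matrix.diagonal (fun i : Fin (n + 1) => Real.exp (-τ) ^ (i : ℕ)) := by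
  ext i j
  rw [structuralMatrix, Matrix.of_apply, Matrix.mul_diagonal, appellMatrix_apply]
  split_ifs with h
  · have hi : ((i : ℕ) : ℕ∞) < supportCard P X :=
      lt_of_le_of_lt (by exact_mod_cast Nat.lt_succ_iff.1 i.2) hn
    rw [hX.regression_coeff_eq hind hmean hscale hi hτ h, coeff_momentSeries,
      Nat.cast_choose ℝ h]
    have : (((i : ℕ) - (j : ℕ)).factorial : ℝ) ≠ 0 := by positivity
    field_simp
  · simp

/-- The moment generating function of the stationary law factors through the increment, whose
exponential moment is finite because the other factor is positive. -/
theorem IsSMPR.integral_exp_increment (hX : IsSMPR P X γ) (hind : HasIndependentRegression P X)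
    (hmean : ∀ t, ∫ ω, X t ω ∂P = 0)
    (hscale : P[X 1 | pastSigma X 0] =ᵐ[P] fun ω => Real.exp (-1) * X 0 ω)
    {s t : ℝ} (hst : s < t) {y : ℝ}
    (hy : Integrable (fun x => Real.exp (y * x)) (P.map (X 0))) :
    Integrable (fun ω => Real.exp (y * increment X s t ω)) P ∧
      ∫ x, Real.exp (y * x) ∂(P.map (X 0)) =
        (∫ x, Real.exp (y * Real.exp (-(t - s)) * x) ∂(P.map (X 0))) *
          ∫ ω, Real.exp (y * increment X s t ω) ∂P := by
  set a := Real.exp (-(t - s)) with ha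
  have hε := hX.measurable_increment s t
  have hμ := hX.isProbabilityMeasure_law
  set μ := P.map (X 0) with hμdef
  set ν := P.map (increment X s t) with hν
  have : IsProbabilityMeasure (μ.map (a * ·)) := Measure.isProbabilityMeasure_map (by fun_prop)
  have : IsProbabilityMeasure ν := Measure.isProbabilityMeasure_map hε.aemeasurable
  have h := lintegral_exp_conv (μ.map (a * ·)) ν y
  have hc : (μ.map (a * ·)).conv ν = μ := hX.conv_increment hind hmean hscale hst
  rw [hc, lintegral_map (μ := μ) (g := (a * ·)) (by fun_prop) (by fun_prop)] at h
  simp only [← mul_assoc] at h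
  have hpos : ∫⁻ x, ENNReal.ofReal (Real.exp (y * a * x)) ∂μ ≠ 0 := by
    rw [← pos_iff_ne_zero, lintegral_pos_iff_support (by fun_prop)]
    have : Function.support (fun x : ℝ => ENNReal.ofReal (Real.exp (y * a * x))) = Set.univ :=
      Function.support_eq_univ (fun x => by simp [Real.exp_pos])
    rw [this, measure_univ]
    exact one_pos
  have hfin := lintegral_exp_ne_top_iff.2 hy
  have hνi : Integrable (fun x => Real.exp (y * x)) ν := by
    refine lintegral_exp_ne_top_iff.1 fun htop => hfin ?_
    rw [h, htop, ENNReal.mul_top hpos]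
  refine ⟨(integrable_map_measure (by fun_prop) hε.aemeasurable).1 hνi, ?_⟩
  have hI (ρ : Measure ℝ) (z : ℝ) : ∫ x, Real.exp (z * x) ∂ρ =
      (∫⁻ x, ENNReal.ofReal (Real.exp (z * x)) ∂ρ).toReal :=
    integral_eq_lintegral_of_nonneg_ae (.of_forall fun x => (Real.exp_pos _).le) (by fun_prop)
  have hνe : ∫ ω, Real.exp (y * increment X s t ω) ∂P = ∫ x, Real.exp (y * x) ∂ν := by
    rw [hν, integral_map hε.aemeasurable (by fun_prop)]
  rw [hνe, hI, hI, hI, h, ENNReal.toReal_mul]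

end Regression

/-! ### The stationary law and the increments in terms of the cumulants -/

theorem deltaCoeff_structuralConst (K : PowerSeries ℝ) {j : ℕ} (hj : 2 ≤ j) :
    deltaCoeff (structuralConst K) j = cumulant K j := by
  have : (j : ℝ) ≠ 0 := by positivity
  rw [deltaCoeff, structuralConst, if_neg (by omega)]
  field_simp

open PowerSeries in
theorem exponentSeries_congr {κ κ' : ℕ → ℝ} (h : ∀ j, 2 ≤ j → κ j = κ' j) :
    exponentSeries κ = exponentSeries κ' := by
  ext j
  rw [exponentSeries, exponentSeries, coeff_mk, coeff_mk]
  split_ifs with hj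
  · rw [h j hj]
  · rfl

open PowerSeries in
theorem sub_rescale_eq_exponentSeries {K : PowerSeries ℝ} (h0 : constantCoeff K = 0)
    (h1 : coeff 1 K = 0) (τ : ℝ) :
    K - rescale (Real.exp (-τ)) K =
      exponentSeries fun j => cumulant K j * (1 - Real.exp (-(j * τ))) := by
  conv_lhs => rw [← exponentSeries_cumulant h0 h1]
  ext j
  rw [map_sub, coeff_rescale, exponentSeries, exponentSeries, coeff_mk, coeff_mk,
    ← Real.exp_nat_mul, mul_neg]
  split_ifs
  · ring
  · simp

theorem mainTheorem5 {Ω : Type*} [MeasurableSpace Ω] (P : Measure Ω) [IsProbabilityMeasure P]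
    (X : ℝ → Ω → ℝ) (γ : ℕ → ℕ → ℝ → ℝ)
    (hX : IsSMPR P X γ)
    (hind : HasIndependentRegression P X)
    (hmean : ∀ t, ∫ ω, X t ω ∂P = 0)
    (hscale : P[X 1 | pastSigma X 0] =ᵐ[P] fun ω => Real.exp (-1) * X 0 ω) :
    ∃ d : ℕ → ℝ, d 0 = 1 ∧
      -- the constants `d_j` are the parameters of the structural matrices
      (∀ n : ℕ, (n : ℕ∞) < supportCard P X → ∀ τ : ℝ, 0 < τ →
        structuralMatrix γ n τ = NormedSpace.exp ((-τ) • generatorMatrix d n)) ∧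
      -- the stationary law is infinitely divisible
      IsInfDivisible (P.map (X 0)) ∧
      -- its moment generating function, as a formal power series and as a function
      momentSeries P (X 0) =
        (PowerSeries.exp ℝ).subst (exponentSeries (deltaCoeff d)) ∧
      (∀ y : ℝ, Integrable (fun ω => Real.exp (y * X 0 ω)) P →
        Integrable (fun ω => Real.exp (-y * X 0 ω)) P →
        Summable (fun j : ℕ => deltaCoeff d (j + 2) * y ^ (j + 2) / ((j + 2).factorial : ℝ)) ∧
        mgf (X 0) P y = Real.exp
          (∑' j : ℕ, deltaCoeff d (j + 2) * y ^ (j + 2) / ((j + 2).factorial : ℝ))) ∧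
      -- the Kolmogorov form
      (0 < deltaCoeff d 2 → ∃ χ : Measure ℝ, IsProbabilityMeasure χ ∧ IsMomentDeterminate χ ∧
        (∀ j : ℕ, 2 ≤ j → ∫ x, x ^ (j - 2) ∂χ = deltaCoeff d j / deltaCoeff d 2) ∧
        (∀ u : ℝ, charFun (P.map (X 0)) u = Complex.exp
          ((deltaCoeff d 2 : ℂ) * ∫ x, kolmogorovKernelC (u * Complex.I) x ∂χ)) ∧
        (∀ y : ℝ, Integrable (fun ω => Real.exp (y * X 0 ω)) P →
          Integrable (kolmogorovKernel y) χ ∧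
          mgf (X 0) P y = Real.exp (deltaCoeff d 2 * ∫ x, kolmogorovKernel y x ∂χ))) ∧
      -- the increments
      (∀ s t : ℝ, s < t →
        momentSeries P (fun ω => X t ω - Real.exp (-(t - s)) * X s ω) =
          (PowerSeries.exp ℝ).subst
            (exponentSeries fun j => deltaCoeff d j * (1 - Real.exp (-(j * (t - s))))) ∧
        (∀ y : ℝ, Integrable (fun ω => Real.exp (y * X 0 ω)) P →
          Integrable (fun ω => Real.exp (-y * X 0 ω)) P →
          Integrable (fun ω => Real.exp (y * (X t ω - Real.exp (-(t - s)) * X s ω))) P ∧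
          Summable (fun j : ℕ => deltaCoeff d (j + 2) *
            (1 - Real.exp (-((j + 2 : ℕ) * (t - s)))) * y ^ (j + 2) /
              ((j + 2).factorial : ℝ)) ∧
          mgf (fun ω => X t ω - Real.exp (-(t - s)) * X s ω) P y = Real.exp
            (∑' j : ℕ, deltaCoeff d (j + 2) *
              (1 - Real.exp (-((j + 2 : ℕ) * (t - s)))) * y ^ (j + 2) /
                ((j + 2).factorial : ℝ)))) := by
  have hμ := hX.isProbabilityMeasure_law
  have hX0 := hX.measurable 0
  have hsd := hX.isSelfDecomposable hind hmean hscale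
  obtain ⟨K, h0, hK⟩ := exists_expOf_eq (constantCoeff_momentSeries P (X 0))
  have h1 : PowerSeries.coeff 1 K = 0 := by
    rw [← coeff_one_expOf h0, hK, coeff_momentSeries]
    simp [hmean]
  have hμK : momentSeries (P.map (X 0)) id = expOf K := by rw [momentSeries_map P hX0, hK]
  have hδ (j : ℕ) : deltaCoeff (structuralConst K) (j + 2) = cumulant K (j + 2) :=
    deltaCoeff_structuralConst K (by omega)
  have hint (y : ℝ) (hy : Integrable (fun ω => Real.exp (y * X 0 ω)) P) :
      Integrable (fun x => Real.exp (y * x)) (P.map (X 0)) :=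
    (integrable_map_measure (by fun_prop) hX0.aemeasurable).2 hy
  have hmgf (y : ℝ) : mgf (X 0) P y = ∫ x, Real.exp (y * x) ∂(P.map (X 0)) := by
    rw [integral_map hX0.aemeasurable (by fun_prop)]; rfl
  refine ⟨structuralConst K, if_pos rfl, fun n hn τ hτ => ?_,
    isInfDivisible_of_exists_root fun n hn => ?_, ?_, fun y hy hy' => ?_, fun hpos => ?_,
    fun s t hst => ⟨?_, fun y hy hy' => ?_⟩⟩
  · rw [hX.structuralMatrix_eq hind hmean hscale hn hτ,
      hX.momentSeries_increment hind hmean hscale h0 hK.symm hτ, sub_zero,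
      exp_neg_smul_generatorMatrix h0]
  · obtain ⟨ρ, hρ, -, -, hρn⟩ := exists_conv_root hX.determinate h0 hμK hsd hn
    exact ⟨ρ, hρ, hρn⟩
  · rw [exponentSeries_congr fun j hj => deltaCoeff_structuralConst K hj,
      exponentSeries_cumulant h0 h1]
    exact hK.symm
  · have h := hasSum_cumulants hX.determinate h0 h1 hμK hsd (hint y hy) (hint (-y) hy')
    simp only [hδ]
    exact ⟨h.summable, by rw [h.tsum_eq, Real.exp_log (integral_exp_pos (hint y hy)), hmgf]⟩
  · have hδ2 : deltaCoeff (structuralConst K) 2 = cumulant K 2 := hδ 0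
    rw [hδ2] at hpos ⊢
    obtain ⟨χ, hχ, hχd, hmom, hchar, hexp⟩ :=
      exists_kolmogorov_form hX.determinate h0 h1 hμK hsd hpos
    refine ⟨χ, hχ, hχd, fun j hj => ?_, hchar, fun y hy => ?_⟩
    · rw [hmom, Nat.sub_add_cancel hj, deltaCoeff_structuralConst K hj]
    · rw [hmgf]
      exact hexp y (hint y hy)
  · rw [exponentSeries_congr (κ' := fun j : ℕ => cumulant K j * (1 - Real.exp (-(j * (t - s)))))
      fun j hj => by rw [deltaCoeff_structuralConst K hj], ← sub_rescale_eq_exponentSeries h0 h1]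
    exact hX.momentSeries_increment hind hmean hscale h0 hK.symm hst
  · set a := Real.exp (-(t - s)) with ha
    have ha1 : a ≤ 1 := Real.exp_le_one_iff.2 (by linarith)
    have ha0 : 0 ≤ a := (Real.exp_pos _).le
    have hpos (z : ℝ) (hz : Integrable (fun x => Real.exp (z * x)) (P.map (X 0))) :
        0 < ∫ x, Real.exp (z * x) ∂(P.map (X 0)) := integral_exp_pos hz
    have hya := (integrable_exp_mul_mul (hint y hy) ha0 ha1).2
    have hya' := (integrable_exp_mul_mul (hint (-y) hy') ha0 ha1).2
    rw [mul_neg] at hya'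
    obtain ⟨hi, he⟩ := hX.integral_exp_increment hind hmean hscale hst (hint y hy)
    have hS := (hasSum_cumulants hX.determinate h0 h1 hμK hsd (hint y hy) (hint (-y) hy')).sub
      (hasSum_cumulants hX.determinate h0 h1 hμK hsd hya hya')
    have hS' : HasSum (fun j : ℕ => deltaCoeff (structuralConst K) (j + 2) *
        (1 - Real.exp (-((j + 2 : ℕ) * (t - s)))) * y ^ (j + 2) / ((j + 2).factorial : ℝ))
        (Real.log (∫ ω, Real.exp (y * increment X s t ω) ∂P)) := by
      have hlog : Real.log (∫ ω, Real.exp (y * increment X s t ω) ∂P) =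
          Real.log (∫ x, Real.exp (y * x) ∂(P.map (X 0))) -
            Real.log (∫ x, Real.exp (a * y * x) ∂(P.map (X 0))) := by
        rw [he, ← ha, mul_comm y a,
          Real.log_mul (hpos _ hya).ne' (integral_exp_pos hi).ne', add_sub_cancel_left]
      rw [hlog]
      refine hS.congr_fun fun j => ?_
      rw [hδ, ← mul_neg, Real.exp_nat_mul, ← ha, mul_pow]
      ring
    refine ⟨hi, hS'.summable, ?_⟩
    rw [hS'.tsum_eq, Real.exp_log (integral_exp_pos hi)]
    rfl
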